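/- **Conventions.** A prederivator is a 2-functor $\mathscr D:\mathrm{Cat}^{op}\to\mathrm{CAT}$ (small categories to categories; pseudofunctors are allowed); a functor $u:A\to B$ gives the restriction $u^*:\mathscr D(B)\to\mathscr D(A)$. A derivator is a prederivator such that (Der1) $\mathscr D$ sends coproducts to products, (Der2) isomorphisms in $\mathscr D(A)$ are detected at the objects of $A$, (Der3) every $u^*$ has a left adjoint $u_!$ and a right adjoint $u_*$, (Der4) these are computed pointwise (slice squares are homotopy exact). It is stable if $\mathscr D(e)$ has a zero object ($e$ the terminal category) and a square $X\in\mathscr D([1]\times[1])$ is cocartesian (in the essential image of left Kan extension from the span) if and only if it is cartesian (in the essential image of right Kan extension from the cospan). The shifted prederivator is $\mathscr D^A:I\mapsto\mathscr D(A\times I)$. Morphisms of prederivators are pseudonatural transformations, 2-cells are modifications, and "equivalence" and "adjoint" are meant in the resulting 2-category. Each $k:A\to B$ gives the restriction $k^*:\mathscr D^B\to\mathscr D^A$; its left adjoint, the left Kan extension morphism, is $k_!:\mathscr D^A\to\mathscr D^B$. An object of $\mathscr D^B(I)$ vanishes at $b\in B$ if its restriction along $\{b\}\times I\to B\times I$ is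 zero (in the essential image of left Kan extension along $\emptyset\times I\to e\times I$). Let $n\ge 3$. * $A_n$ is the poset $\{1<\dots<n\}$. * $\tilde A(n,2)\subset[n-2]\times[n-2]$ is the full subposet with objects $(0,0)$, $(p,p-1)$ and $(p-1,p)$ for $1\le p\le n-2$, and $(n-2,n-2)$. $\mathscr D^{A(n,2)}\subseteq\mathscr D^{\tilde A(n,2)}$ is the full subprederivator of the objects that vanish at all $(p-1,p)$, $1\le p\le n-2$. * $M_n$ (the mesh category) is the poset of pairs $(k,l)$ with $k\in\mathbb Z$ and $0\le l\le n+1$, generated by $(k,l)\le(k,l+1)$ and $(k,l)\le(k+1,l-1)$; thus $(k,l)\le(k',l')$ iff $k\le k'$ and $k+l\le k'+l'$. $\mathscr D^{M_n,\mathrm{ex}}\subseteq\mathscr D^{M_n}$ is the full subprederivator of the objects that vanish at all $(k,0)$ and $(k,n+1)$ and for which every mesh square with corners $(k,l),(k,l+1),(k+1,l-1),(k+1,l)$, $1\le l\le n$, is bicartesian. * $i_n:A_n\to M_n$ is $l\mapsto(0,l)$. * $j^n:\tilde A(n,2)\to M_n$ is the monotone map with $(n-2,n-2)\mapsto(0,n)$;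 with $$(0,0)\ (\text{put }p=0)\ \text{ and }\ (p,p-1)\ \longmapsto\ \begin{cases}\bigl(\tfrac{p+2-n}{2}(n-1),\,1\bigr)& n+p\text{ even},\\[2pt] \bigl(\tfrac{p+1-n}{2}(n-1),\,n\bigr)& n+p\text{ odd};\end{cases}$$ $$(p-1,p)\ \longmapsto\ \begin{cases}\bigl(\tfrac{p-n}{2}(n-1)+p-1,\,n+1\bigr)& n+p\text{ even},\\[2pt] \bigl(\tfrac{p+1-n}{2}(n-1)+p,\,0\bigr)& n+p\text{ odd}.\end{cases}$$ * $i^n:\mathscr D^{A(n,2)}\to\mathscr D^{A_n}$ is the following composite, over stages $l=1,\dots,n-2$. Put $N=n-l+1$, and let $\tau=(N-2,N-2)$ if $N>3$ and $\tau=(2,1)$ if $N=3$. All posets are full subposets of $(\mathbb N\times\mathbb N)\times\mathbb N$; the third coordinate $z$ runs through $[l-1]=\{0,\dots,l-1\}$. - $K_1=\tilde A(N,2)\times[l-1]$. - $K_2=P\times[l-1]$, where $P$ consists of $(0,0)$, $(1,1)$, $(p,p-1)$ and $(p-1,p)$ for $1\le p\le N-2$, and $\tau$. - $K_3$ is $K_2$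 without the objects $(0,0,z)$. $K_4$ is $K_3$ without the objects $(0,1,z)$. $K_5$ is $K_4$ without the objects $(1,0,z)$ with $z>0$. - $k_1:K_1\to K_2$ is the inclusion, except that $(N-2,N-2,z)\mapsto(\tau,z)$. $k_2:K_3\to K_2$ and $k_3:K_4\to K_3$ are the inclusions. $k_4:K_4\to K_5$ sends $(1,0,z)$ to $(1,0,0)$ and fixes all other objects. Stage $l$ applies $(k_1)_!$, then $k_2^*$, then $k_3^*$, then $(k_4)_!$. If $l<n-2$, it is followed by $k_5^*$, for $k_5:\tilde A(N-1,2)\times[l]\to K_5$ given by $(x,y,z)\mapsto(x+1,y+1,z-1)$ for $z\ge1$, $(x,y,0)\mapsto(x+1,y+1,0)$ for $(x,y)\ne(0,0)$, and $(0,0,0)\mapsto(1,0,0)$; this leads to the poset $K_1$ of stage $l+1$. If $l=n-2$ (so $N=3$), it is followed by $(k_6)_!$, for $k_6:K_5\to A_n$ given by $(1,0,0)\mapsto1$, $(1,1,z)\mapsto z+2$, $(2,1,z)\mapsto n$. The composite starts with the inclusion $\mathscr D^{A(n,2)}\to\mathscr D^{\tilde A(n,2)}$ and the identification $\tilde A(n,2)\times[0]\cong\tilde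 A(n,2)$. **Theorem.** Let $\mathscr D$ be a stable derivator and $n\ge3$. Then all left Kan extension morphisms $k_!$ exist, so that $i^n$ is defined; the map $(j^n)^*$ restricts to a morphism $\mathscr D^{M_n,\mathrm{ex}}\to\mathscr D^{A(n,2)}$; the three morphisms $$i^n:\mathscr D^{A(n,2)}\to\mathscr D^{A_n},\qquad (i_n)^*:\mathscr D^{M_n,\mathrm{ex}}\to\mathscr D^{A_n},\qquad (j^n)^*:\mathscr D^{M_n,\mathrm{ex}}\to\mathscr D^{A(n,2)}$$ are equivalences of prederivators; and the triangle they form commutes up to isomorphism: $i^n\circ(j^n)^*\cong(i_n)^*$. -/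

import Mathlib

open CategoryTheory Bicategory Opposite
open scoped Pseudofunctor.StrongTrans
universe u v w

set_option linter.checkUnivs false in
/-- Prederivators: (pseudo-)functors of 2-categories `Catᵒᵖ → CAT`. The 1-cells of the bicategory
`Pseudofunctor _ _` are pseudonatural transformations and its 2-cells are modifications. -/
abbrev Prederivator := Pseudofunctor (Cat.{u, u})ᵒᵖ Cat.{v, w}

namespace Prederivator

/-- The 2-functor `I ↦ A × I`. -/
def prodLeft (A : Cat.{u, u}) : Pseudofunctor (Cat.{u, u})ᵒᵖ (Cat.{u, u})ᵒᵖ where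
  obj I := op (Cat.of (A × I.unop))
  map w := (Functor.prod (𝟭 A) w.unop.toFunctor).toCatHom.op
  map₂ α := Bicategory.Opposite.op2 (NatTrans.prod (𝟙 (𝟭 A)) α.unop2.toNatTrans).toCatHom₂
  map₂_id := by intros; apply congrArg Bicategory.Opposite.op2; ext; rfl
  map₂_comp := by
    intros; apply congrArg Bicategory.Opposite.op2; ext x
    exact Prod.hom_ext (Category.comp_id (𝟙 x.1)).symm rfl
  mapId I := Iso.refl _
  mapComp f g := Iso.refl _
  map₂_whisker_left {a b c} f g h η := by
    apply congrArg Bicategory.Opposite.op2; ext x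
    refine Prod.hom_ext ?_ ?_
    · change 𝟙 x.1 = 𝟙 x.1 ≫ 𝟙 x.1 ≫ 𝟙 x.1
      simp
    · change f.unop.toFunctor.map (η.unop2.toNatTrans.app x.2) = 𝟙 _ ≫ f.unop.toFunctor.map (η.unop2.toNatTrans.app x.2) ≫ 𝟙 _
      simp
  map₂_whisker_right {a b c} f g η h := by
    apply congrArg Bicategory.Opposite.op2; ext x
    refine Prod.hom_ext ?_ ?_
    · change 𝟙 x.1 = 𝟙 x.1 ≫ 𝟙 x.1 ≫ 𝟙 x.1
      simp
    · change (η.unop2.toNatTrans.app (h.unop.toFunctor.obj x.2)) = 𝟙 _ ≫ (η.unop2.toNatTrans.app (h.unop.toFunctor.obj x.2)) ≫ 𝟙 _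
      simp
  map₂_associator {a b c d} f g h := by
    apply congrArg Bicategory.Opposite.op2; ext x
    refine Prod.hom_ext ?_ ?_
    · change 𝟙 x.1 = 𝟙 x.1 ≫ 𝟙 x.1 ≫ 𝟙 x.1 ≫ 𝟙 x.1 ≫ 𝟙 x.1
      simp
    · change 𝟙 _ = 𝟙 _ ≫ 𝟙 _ ≫ 𝟙 _ ≫ f.unop.toFunctor.map (𝟙 _) ≫ 𝟙 _
      simp
  map₂_left_unitor {a b} f := by
    apply congrArg Bicategory.Opposite.op2; ext x
    refine Prod.hom_ext ?_ ?_
    · change 𝟙 x.1 = 𝟙 x.1 ≫ 𝟙 x.1 ≫ 𝟙 x.1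
      simp
    · change 𝟙 _ = 𝟙 _ ≫ 𝟙 _ ≫ 𝟙 _
      simp
  map₂_right_unitor {a b} f := by
    apply congrArg Bicategory.Opposite.op2; ext x
    refine Prod.hom_ext ?_ ?_
    · change 𝟙 x.1 = 𝟙 x.1 ≫ 𝟙 x.1 ≫ 𝟙 x.1
      simp
    · change 𝟙 _ = 𝟙 _ ≫ f.unop.toFunctor.map (𝟙 _) ≫ 𝟙 _
      simp

instance instStrictCatOp : Strict (Cat.{u, u})ᵒᵖ where
  id_comp f := rfl
  comp_id f := rfl
  assoc f g h := rfl
  leftUnitor_eqToIso f := by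
    ext; apply congrArg Bicategory.Opposite.op2; ext; rfl
  rightUnitor_eqToIso f := by
    ext; apply congrArg Bicategory.Opposite.op2; ext; rfl
  associator_eqToIso f g h := by
    ext; apply congrArg Bicategory.Opposite.op2; ext; rfl

section
variable {B C : Type*} [Bicategory B] [Strict B] [Bicategory C] (F : Pseudofunctor B C)

lemma isoMapOfCommSq_comp {x₀ x₁ x₂ y₀ y₁ y₂ : B} {t₁ : x₀ ⟶ x₁} {t₂ : x₁ ⟶ x₂}
    {l : x₀ ⟶ y₀} {r : x₁ ⟶ y₁} {s : x₂ ⟶ y₂} {b₁ : y₀ ⟶ y₁} {b₂ : y₁ ⟶ y₂}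
    (sq₁ : CommSq t₁ l r b₁) (sq₂ : CommSq t₂ r s b₂) (sq : CommSq (t₁ ≫ t₂) l s (b₁ ≫ b₂)) :
    (F.isoMapOfCommSq sq).hom ≫ F.map l ◁ (F.mapComp b₁ b₂).hom =
      (F.mapComp t₁ t₂).hom ▷ F.map s ≫ (α_ _ _ _).hom ≫
        F.map t₁ ◁ (F.isoMapOfCommSq sq₂).hom ≫ (α_ _ _ _).inv ≫
          (F.isoMapOfCommSq sq₁).hom ▷ F.map b₂ ≫ (α_ _ _ _).hom := by
  have h₁ : t₁ ≫ r ≫ b₂ = l ≫ b₁ ≫ b₂ := by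
    rw [← Strict.assoc, sq₁.w, Strict.assoc]
  rw [F.isoMapOfCommSq_eq sq (l ≫ b₁ ≫ b₂) sq.w, F.isoMapOfCommSq_eq sq₂ (r ≫ b₂) sq₂.w,
    F.isoMapOfCommSq_eq sq₁ (l ≫ b₁) sq₁.w]
  have e₁ := F.mapComp'₀₁₃_hom_comp_whiskerLeft_mapComp'_hom l b₁ b₂ (l ≫ b₁) (b₁ ≫ b₂)
    (l ≫ b₁ ≫ b₂) rfl rfl rfl
  have e₂ := F.mapComp'₀₁₃_inv_comp_mapComp'₀₂₃_hom t₁ r b₂ (l ≫ b₁) (r ≫ b₂)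
    (l ≫ b₁ ≫ b₂) sq₁.w rfl h₁
  have e₃ := F.mapComp'₀₂₃_inv t₁ t₂ s (t₁ ≫ t₂) (r ≫ b₂) (l ≫ b₁ ≫ b₂) rfl sq₂.w sq.w
  rw [F.mapComp'_eq_mapComp b₁ b₂] at e₁
  rw [F.mapComp'_eq_mapComp t₁ t₂] at e₃
  simp only [Iso.trans_hom, Iso.symm_hom, Category.assoc, comp_whiskerRight,
    Bicategory.whiskerLeft_comp]
  rw [e₁, e₃]
  simp only [Category.assoc]
  rw [reassoc_of% e₂]

lemma isoMapOfCommSq_whisker {x₀ x₁ y₀ y₁ : B} {t t' : x₀ ⟶ x₁}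
    {l : x₀ ⟶ y₀} {r : x₁ ⟶ y₁} {b b' : y₀ ⟶ y₁}
    (sq : CommSq t l r b) (sq' : CommSq t' l r b') (η : t ⟶ t') (θ : b ⟶ b')
    (h : η ▷ r = eqToHom sq.w ≫ l ◁ θ ≫ eqToHom sq'.w.symm) :
    F.map₂ η ▷ F.map r ≫ (F.isoMapOfCommSq sq').hom =
      (F.isoMapOfCommSq sq).hom ≫ F.map l ◁ F.map₂ θ := by
  have e : F.map₂ (η ▷ r) = F.map₂ (eqToHom sq.w ≫ l ◁ θ ≫ eqToHom sq'.w.symm) := by rw [h]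
  simp only [F.map₂_whisker_right, F.map₂_whisker_left, F.map₂_comp] at e
  have e' := (F.mapComp t r).inv ≫= ((e =≫ F.map₂ (eqToHom sq'.w)) =≫ (F.mapComp l b').hom)
  simp only [Category.assoc, Iso.inv_hom_id_assoc, Iso.inv_hom_id, Category.comp_id,
    ← F.map₂_comp_assoc, eqToHom_trans, eqToHom_refl, F.map₂_id, Category.id_comp] at e'
  simpa [Pseudofunctor.isoMapOfCommSq, Pseudofunctor.mapComp'] using e'
end

/-- The shifted prederivator `𝒟^A : I ↦ 𝒟(A × I)`. -/
def shift (D : Prederivator.{u, v, w}) (A : Cat.{u, u}) : Prederivator.{u, v, w} :=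
  (prodLeft A).comp D

lemma shift_mapId (D : Prederivator.{u, v, w}) (A : Cat.{u, u}) (I : (Cat.{u, u})ᵒᵖ) :
    ((D.shift A).mapId I).hom = (D.mapId (op (Cat.of (A × I.unop)))).hom := by
  change D.map₂ (𝟙 _) ≫ _ = _
  exact (congrArg (fun z => z ≫ (_ : _ ⟶ _)) (D.map₂_id _)).trans (Category.id_comp _)

lemma shift_mapComp (D : Prederivator.{u, v, w}) (A : Cat.{u, u}) {I J K : (Cat.{u, u})ᵒᵖ}
    (f : I ⟶ J) (g : J ⟶ K) :
    ((D.shift A).mapComp f g).hom = (D.mapComp ((prodLeft A).map f) ((prodLeft A).map g)).hom := by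
  change D.map₂ (𝟙 _) ≫ _ = _
  exact (congrArg (fun z => z ≫ (_ : _ ⟶ _)) (D.map₂_id _)).trans (Category.id_comp _)

variable (D : Prederivator.{u, v, w}) {A B : Cat.{u, u}} (k : A ⟶ B)

lemma restr_sq {I J : (Cat.{u, u})ᵒᵖ} (w : I ⟶ J) :
    CommSq ((prodLeft B).map w) (Functor.prod k.toFunctor (𝟭 I.unop)).toCatHom.op
      (Functor.prod k.toFunctor (𝟭 J.unop)).toCatHom.op ((prodLeft A).map w) := ⟨rfl⟩

/-- The restriction morphism `k^* : 𝒟^B ⟶ 𝒟^A` of prederivators, given at `I` by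
`(k × id_I)^*`. -/
def restr : D.shift B ⟶ D.shift A where
  app I := D.map (Functor.prod k.toFunctor (𝟭 I.unop)).toCatHom.op
  naturality {I J} w := D.isoMapOfCommSq (restr_sq k w)
  naturality_naturality {I J f g} η := by
    refine isoMapOfCommSq_whisker D (restr_sq k f) (restr_sq k g) _ _ ?_
    apply congrArg Bicategory.Opposite.op2; ext x
    refine Prod.hom_ext ?_ ?_
    · change 𝟙 (k.toFunctor.obj x.1) = 𝟙 _ ≫ k.toFunctor.map (𝟙 x.1) ≫ 𝟙 _
      simp
    · change η.unop2.toNatTrans.app x.2 = 𝟙 _ ≫ η.unop2.toNatTrans.app x.2 ≫ 𝟙 _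
      simp
  naturality_id I := by
    have h := congrArg Iso.hom
      (D.isoMapOfCommSq_horiz_id (Functor.prod k.toFunctor (𝟭 I.unop)).toCatHom.op)
    have h' := h =≫ D.map (Functor.prod k.toFunctor (𝟭 I.unop)).toCatHom.op ◁ (D.mapId _).hom
    simp only [Iso.trans_hom, Iso.symm_hom, whiskerLeftIso_inv, Category.assoc,
      ← Bicategory.whiskerLeft_comp, Iso.inv_hom_id, Bicategory.whiskerLeft_id,
      Category.comp_id, whiskerRightIso_hom] at h'
    exact (congrArg (fun z => _ ≫ D.map _ ◁ z) (shift_mapId D A I)).trans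
      (h'.trans (congrArg (fun z => z ▷ D.map _ ≫ _) (shift_mapId D B I)).symm)
  naturality_comp f g := by
    have h := isoMapOfCommSq_comp D (restr_sq k f) (restr_sq k g) (restr_sq k (f ≫ g))
    exact (congrArg (fun z => _ ≫ D.map _ ◁ z) (shift_mapComp D A f g)).trans
      (h.trans (congrArg (fun z => z ▷ D.map _ ≫ _) (shift_mapComp D B f g)).symm)

/-- The restriction functor `w^* : 𝒟(B) ⥤ 𝒟(A)`. -/
def res {A B : Cat.{u, u}} (w : A ⟶ B) : D.obj (op B) ⥤ D.obj (op A) := (D.map w.op).toFunctor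

/-- The natural transformation `p^* w^* ⟶ q^* x^*` induced by a 2-cell `w ∘ p ⟶ x ∘ q`. -/
def resCell {C A E B : Cat.{u, u}} {p : C ⟶ A} {w : A ⟶ B} {q : C ⟶ E} {x : E ⟶ B}
    (α : p ≫ w ⟶ q ≫ x) : D.res w ⋙ D.res p ⟶ D.res x ⋙ D.res q :=
  ((D.mapComp w.op p.op).inv ≫ D.map₂ (Bicategory.Opposite.op2 α) ≫
    (D.mapComp x.op q.op).hom).toNatTrans

/-- The terminal category `e`. -/
abbrev pt : Cat.{u, u} := Cat.of (Discrete PUnit.{u + 1})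

/-- The functor `e ⟶ B` picking out the object `b`. -/
abbrev const {B : Cat.{u, u}} (b : B) : pt ⟶ B := (Functor.fromPUnit.{u} b).toCatHom

/-- The axioms (Der1)--(Der4) of a derivator. In (Der4) the slice squares are homotopy exact,
i.e. the canonical mates `π_! p^* ⟶ b^* w_!` and `b^* w_* ⟶ π_* q^*` are invertible; the slice
categories `w/b` and `b/w` are the comma categories of `w` and `b : e ⟶ B`. -/
class IsDerivator (D : Prederivator.{u, v, w}) : Prop where
  der1 (ι : Type u) (A : ι → Cat.{u, u}) :
    (Functor.pi' fun i ↦ D.res (Sigma.incl (C := fun i ↦ A i) i).toCatHom).IsEquivalence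
  der2 (A : Cat.{u, u}) {X Y : D.obj (op A)} (f : X ⟶ Y)
    (hf : ∀ a : A, IsIso ((D.res (const a)).map f)) : IsIso f
  der3_left {A B : Cat.{u, u}} (w : A ⟶ B) : (D.res w).IsRightAdjoint
  der3_right {A B : Cat.{u, u}} (w : A ⟶ B) : (D.res w).IsLeftAdjoint
  der4_left {A B : Cat.{u, u}} (w : A ⟶ B) (b : B)
    {L₁ : D.obj (op A) ⥤ D.obj (op B)} (adj₁ : L₁ ⊣ D.res w)
    {L₂ : D.obj (op (Cat.of (Comma w.toFunctor (Functor.fromPUnit.{u} b)))) ⥤ D.obj (op pt)}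
    (adj₂ : L₂ ⊣ D.res (Comma.snd w.toFunctor (Functor.fromPUnit.{u} b)).toCatHom) :
    IsIso ((mateEquiv adj₁ adj₂).symm (D.resCell
      (p := (Comma.fst w.toFunctor (Functor.fromPUnit.{u} b)).toCatHom) (w := w)
      (q := (Comma.snd w.toFunctor (Functor.fromPUnit.{u} b)).toCatHom) (x := const b)
      (Comma.natTrans w.toFunctor (Functor.fromPUnit.{u} b)).toCatHom₂))
  der4_right {A B : Cat.{u, u}} (w : A ⟶ B) (b : B)
    {R₁ : D.obj (op A) ⥤ D.obj (op B)} (adj₁ : D.res w ⊣ R₁)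
    {R₂ : D.obj (op (Cat.of (Comma (Functor.fromPUnit.{u} b) w.toFunctor))) ⥤ D.obj (op pt)}
    (adj₂ : D.res (Comma.fst (Functor.fromPUnit.{u} b) w.toFunctor).toCatHom ⊣ R₂) :
    IsIso (mateEquiv adj₁ adj₂ (D.resCell
      (p := (Comma.fst (Functor.fromPUnit.{u} b) w.toFunctor).toCatHom) (w := const b)
      (q := (Comma.snd (Functor.fromPUnit.{u} b) w.toFunctor).toCatHom) (x := w)
      (Comma.natTrans (Functor.fromPUnit.{u} b) w.toFunctor).toCatHom₂))

attribute [instance] IsDerivator.der3_left IsDerivator.der3_right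

/-! ### Shapes given by posets -/

/-- A poset, regarded as a small category (in the universe `u`). -/
def shape (P : Type) [Preorder P] : Cat.{u, u} := Cat.of (AsSmall.{u} P)

/-- A monotone map, regarded as a functor. -/
def shapeMap {P Q : Type} [Preorder P] [Preorder Q] (f : P →o Q) : shape.{u} P ⟶ shape.{u} Q :=
  (AsSmall.down ⋙ f.monotone.functor ⋙ AsSmall.up : AsSmall.{u} P ⥤ AsSmall.{u} Q).toCatHom

/-- An element of a poset, regarded as an object. -/
def shapePt {P : Type} [Preorder P] (x : P) : shape.{u} P := AsSmall.up.obj x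

/-- The square `□ = [1] × [1]`. -/
abbrev Sq : Type := Fin 2 × Fin 2
/-- The span, `□` without its terminal object. -/
abbrev SqUL : Type := {x : Sq // x ≠ (1, 1)}
/-- The cospan, `□` without its initial object. -/
abbrev SqLR : Type := {x : Sq // x ≠ (0, 0)}

/-- The inclusion of the span into the square. -/
def sqUL : shape.{u} SqUL ⟶ shape.{u} Sq := shapeMap (OrderHom.Subtype.val _)

/-- The inclusion of the cospan into the square. -/
def sqLR : shape.{u} SqLR ⟶ shape.{u} Sq := shapeMap (OrderHom.Subtype.val _)

/-- A coherent square is cocartesian if it lies in the essential image of the left Kan extension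
along the inclusion of the span. -/
def IsCocartesian [D.IsDerivator] (X : D.obj (op (shape.{u} Sq))) : Prop :=
  (D.res sqUL).leftAdjoint.essImage X

/-- A coherent square is cartesian if it lies in the essential image of the right Kan extension
along the inclusion of the cospan. -/
def IsCartesian [D.IsDerivator] (X : D.obj (op (shape.{u} Sq))) : Prop :=
  (D.res sqLR).rightAdjoint.essImage X

/-- A derivator is stable if it is pointed and a coherent square is cocartesian if and only if it
is cartesian. -/
class IsStable (D : Prederivator.{u, v, w}) [D.IsDerivator] : Prop where
  pointed : Limits.HasZeroObject (D.obj (op pt))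
  isCocartesian_iff (X : D.obj (op (shape.{u} Sq))) : D.IsCocartesian X ↔ D.IsCartesian X

/-- The restriction morphisms `k^* : 𝒟^B ⟶ 𝒟^A` have left adjoints internally to the bicategory of
prederivators, i.e. left Kan extensions form morphisms `k_! : 𝒟^A ⟶ 𝒟^B` of prederivators.
This holds for every derivator. -/
class HasLan (D : Prederivator.{u, v, w}) : Prop where
  isRightAdjoint {A B : Cat.{u, u}} (k : A ⟶ B) : Bicategory.IsRightAdjoint (D.restr k)

attribute [instance] HasLan.isRightAdjoint

/-- The left Kan extension morphism `k_! : 𝒟^A ⟶ 𝒟^B`, the left adjoint of `k^*`. -/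
noncomputable def lan [D.HasLan] : D.shift A ⟶ D.shift B := Bicategory.leftAdjoint (D.restr k)

/-! ### Strict full subderivators -/

section lift
variable {F G : Prederivator.{u, v, w}} (η : F ⟶ G) (P : G.ObjectProperty)
  [P.IsClosedUnderMapObj] (h : ∀ I X, P.prop I ((η.app I).toFunctor.obj X))

/-- The factorization of a morphism of prederivators through a strict full subprederivator that
contains its image. -/
def lift : F ⟶ P.fullsubcategory where
  app I := ((P.prop I).lift (η.app I).toFunctor (h I)).toCatHom
  naturality {I J} w := Cat.Hom.isoMk (((P.prop J).fullyFaithfulι.whiskeringRight _).preimageIso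
    (Cat.Hom.toNatIso (η.naturality w)))
  naturality_naturality {I J f g} α := by
    ext X
    apply ObjectProperty.hom_ext
    exact congr_arg (fun z ↦ z.toNatTrans.app X) (η.naturality_naturality α)
  naturality_id I := by
    ext X
    apply ObjectProperty.hom_ext
    exact congr_arg (fun z ↦ z.toNatTrans.app X) (η.naturality_id I)
  naturality_comp f g := by
    ext X
    apply ObjectProperty.hom_ext
    exact congr_arg (fun z ↦ z.toNatTrans.app X) (η.naturality_comp f g)
end lift

section sub
variable [D.HasLan] {S : Cat.{u, u}}

/-- For `k : A ⟶ S` and `j : S ⟶ B`, the objects `X` of `𝒟^B(I)` such that `j^* X` lies in the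
essential image of `k_!`. -/
def LiesInImage (k : A ⟶ S) (j : S ⟶ B) (I : (Cat.{u, u})ᵒᵖ) (X : (D.shift B).obj I) : Prop :=
  ((D.lan k).app I).toFunctor.essImage (((D.restr j).app I).toFunctor.obj X)

variable {D}
lemma LiesInImage.map {k : A ⟶ S} {j : S ⟶ B} {I J : (Cat.{u, u})ᵒᵖ} {X : (D.shift B).obj I}
    (hX : D.LiesInImage k j I X) (f : I ⟶ J) :
    D.LiesInImage k j J (((D.shift B).map f).toFunctor.obj X) := by
  obtain ⟨Y, ⟨e⟩⟩ := hX
  exact ⟨((D.shift A).map f).toFunctor.obj Y,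
    ⟨(Cat.Hom.toNatIso ((D.lan k).naturality f)).app Y ≪≫
      ((D.shift S).map f).toFunctor.mapIso e ≪≫
      ((Cat.Hom.toNatIso ((D.restr j).naturality f)).app X).symm⟩⟩

/-- The functor from the empty category. -/
def fromEmpty (B : Cat.{u, u}) : Cat.of (Discrete PEmpty.{u + 1}) ⟶ B :=
  (Functor.empty B).toCatHom

variable (D) in
/-- `X` vanishes at `b`: the restriction of `X` to `b` lies in the essential image of the Kan
extension along `∅ ⟶ e`. -/
def VanishesAt (b : B) (I : (Cat.{u, u})ᵒᵖ) (X : (D.shift B).obj I) : Prop :=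
  D.LiesInImage (fromEmpty pt) (const b) I X

lemma VanishesAt.restr {b : A} {c : B} (hc : k.toFunctor.obj b = c) {I : (Cat.{u, u})ᵒᵖ}
    {X : (D.shift B).obj I} (hX : D.VanishesAt c I X) :
    D.VanishesAt b I (((D.restr k).app I).toFunctor.obj X) := by
  subst hc
  obtain ⟨Y, ⟨e⟩⟩ := hX
  have hk : (Functor.prod (const b).toFunctor (𝟭 I.unop)) ⋙ (Functor.prod k.toFunctor (𝟭 I.unop)) =
      Functor.prod (const (k.toFunctor.obj b)).toFunctor (𝟭 I.unop) := by
    refine CategoryTheory.Functor.ext (fun _ ↦ rfl) (fun X Y f ↦ ?_)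
    refine Prod.hom_ext ?_ ?_
    · change k.toFunctor.map (𝟙 b) = 𝟙 _ ≫ 𝟙 _ ≫ 𝟙 _
      simp
    · change f.2 = 𝟙 _ ≫ f.2 ≫ 𝟙 _
      simp
  exact ⟨Y, ⟨e ≪≫ (Cat.Hom.toNatIso (D.mapComp'
    (Functor.prod k.toFunctor (𝟭 I.unop)).toCatHom.op
    (Functor.prod (const b).toFunctor (𝟭 I.unop)).toCatHom.op
    (Functor.prod (const (k.toFunctor.obj b)).toFunctor (𝟭 I.unop)).toCatHom.op
    (congrArg (fun z ↦ z.toCatHom.op) hk))).app X⟩⟩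

end sub

/-! ### The posets `Ã(n,2)`, `A_n` and `M_n` -/

/-- The positions `(p-1,p)`, `1 ≤ p ≤ n-2`, at which the objects of `𝒟^{A(n,2)}` vanish. -/
def IsZeroPos (n : ℕ) (x : ℕ × ℕ) : Prop := x.2 = x.1 + 1 ∧ x.2 + 2 ≤ n

/-- The objects of `Ã(n,2)`: `(0,0)`, `(p,p-1)` and `(p-1,p)` for `1 ≤ p ≤ n-2`, and
`(n-2,n-2)`. -/
def MemAT (n : ℕ) (x : ℕ × ℕ) : Prop :=
  x = (0, 0) ∨ (x.1 = x.2 + 1 ∧ x.1 + 2 ≤ n) ∨ IsZeroPos n x ∨ (x.1 + 2 = n ∧ x.2 + 2 = n)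

/-- The full subposet `Ã(n,2)` of `[n-2] × [n-2]`. -/
abbrev AT (n : ℕ) : Type := {x : ℕ × ℕ // MemAT n x}

/-- The poset `A_n = {1 < ⋯ < n}`. -/
abbrev An (n : ℕ) : Type := {i : ℕ // 1 ≤ i ∧ i ≤ n}

/-- The mesh category `M_n`: its objects are the pairs `(k,l)` with `0 ≤ l ≤ n+1`. -/
@[ext]
structure Mesh (n : ℕ) where
  k : ℤ
  l : ℤ
  l_nonneg : 0 ≤ l
  l_le : l ≤ n + 1

/-- `M_n` is the poset generated by the arrows `(k,l) ⟶ (k,l+1)` and `(k,l) ⟶ (k+1,l-1)`. -/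
instance (n : ℕ) : PartialOrder (Mesh n) where
  le a b := a.k ≤ b.k ∧ a.k + a.l ≤ b.k + b.l
  le_refl a := ⟨le_rfl, le_rfl⟩
  le_trans a b c h h' := ⟨h.1.trans h'.1, h.2.trans h'.2⟩
  le_antisymm a b h h' := by
    have h₁ := h.1
    have h₂ := h.2
    have h₃ := h'.1
    have h₄ := h'.2
    exact Mesh.ext (by lia) (by lia)

/-- The mesh square with corners `(k,l)`, `(k,l+1)`, `(k+1,l-1)` and `(k+1,l)`. -/
def Mesh.square (n : ℕ) (k l : ℤ) (h : 1 ≤ l ∧ l ≤ n) : Sq →o Mesh n where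
  toFun x := ⟨k + (x.2 : ℕ), l + (x.1 : ℕ) - (x.2 : ℕ),
    by have := x.1.2; have := x.2.2; omega, by have := x.1.2; have := x.2.2; omega⟩
  monotone' x y hxy := by
    have h₁ : (x.1 : ℕ) ≤ y.1 := hxy.1
    have h₂ : (x.2 : ℕ) ≤ y.2 := hxy.2
    constructor <;> dsimp only <;> lia

section ex
variable [D.HasLan] (n : ℕ)

/-- The objects of `𝒟^{A(n,2)}`: coherent diagrams of shape `Ã(n,2)` that vanish at the
positions `(p-1,p)`. -/
def anTwo : (D.shift (shape.{u} (AT n))).ObjectProperty where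
  prop I X := ∀ x : AT n, IsZeroPos n x.1 → D.VanishesAt (shapePt x) I X

instance : (D.anTwo n).IsClosedUnderMapObj where
  map_obj hX f x hx := (hX x hx).map f

/-- The objects of `𝒟^{M_n,ex}`: coherent diagrams of shape `M_n` that vanish at `(k,0)` and
`(k,n+1)` and make all mesh squares (bi)cartesian. -/
def meshEx : (D.shift (shape.{u} (Mesh n))).ObjectProperty where
  prop I X := (∀ x : Mesh n, x.l = 0 ∨ x.l = n + 1 → D.VanishesAt (shapePt x) I X) ∧
    ∀ (k l : ℤ) (h : 1 ≤ l ∧ l ≤ n), D.LiesInImage sqUL (shapeMap (Mesh.square n k l h)) I X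

instance : (D.meshEx n).IsClosedUnderMapObj where
  map_obj hX f := ⟨fun x hx ↦ (hX.1 x hx).map f, fun k l h ↦ (hX.2 k l h).map f⟩

/-- The strict full subderivator `𝒟^{A(n,2)}` of `𝒟^{Ã(n,2)}`. -/
abbrev DA2 : Prederivator.{u, v, w} := (D.anTwo n).fullsubcategory

/-- The strict full subderivator `𝒟^{M_n,ex}` of `𝒟^{M_n}`. -/
abbrev DMex : Prederivator.{u, v, w} := (D.meshEx n).fullsubcategory

/-- The embedding `i_n : A_n ⟶ M_n`, `l ↦ (0,l)`. -/
def iMap : An n →o Mesh n where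
  toFun i := ⟨0, i.1, by lia, by have := i.2.2; lia⟩
  monotone' i j h := by
    have : i.1 ≤ j.1 := h
    constructor <;> dsimp only <;> lia

/-- `(i_n)^* : 𝒟^{M_n,ex} ⟶ 𝒟^{A_n}`. -/
def iRes : D.DMex n ⟶ D.shift (shape.{u} (An n)) := (D.meshEx n).ι ≫ D.restr (shapeMap (iMap n))

/-- The embedding `j^n` of `Ã(n,2)` into `M_n`, on coordinates. It sends `(n-2,n-2)` to `(0,n)`.
The zero object `(p-1,p)` goes to `(((p-n)/2)(n-1)+p-1, n+1)` if `n+p` is even and to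
`(((p+1-n)/2)(n-1)+p, 0)` otherwise; `(0,0)` (with `p = 0`) and `(p,p-1)` go to
`(((p+2-n)/2)(n-1), 1)` if `n+p` is even and to `(((p+1-n)/2)(n-1), n)` otherwise. All the
divisions by two are exact. -/
def jPos (n : ℕ) (x : ℕ × ℕ) : ℤ × ℤ :=
  if x.1 + 2 = n ∧ x.2 + 2 = n then (0, (n : ℤ))
  else if x.2 = x.1 + 1 then
    if Even (n + x.2) then
      (((x.2 : ℤ) - n) / 2 * ((n : ℤ) - 1) + ((x.2 : ℤ) - 1), (n : ℤ) + 1)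
    else (((x.2 : ℤ) + 1 - n) / 2 * ((n : ℤ) - 1) + (x.2 : ℤ), 0)
  else
    if Even (n + x.1) then (((x.1 : ℤ) + 2 - n) / 2 * ((n : ℤ) - 1), 1)
    else (((x.1 : ℤ) + 1 - n) / 2 * ((n : ℤ) - 1), (n : ℤ))

lemma jPos_bounds (n : ℕ) (x : ℕ × ℕ) : 0 ≤ (jPos n x).2 ∧ (jPos n x).2 ≤ n + 1 := by
  unfold jPos
  split_ifs <;> dsimp only <;> lia

/-- The height of an object of `Ã(n,2)`. -/
def height (n : ℕ) (x : ℕ × ℕ) : ℕ := if x.1 + 2 = n ∧ x.2 + 2 = n then n - 1 else max x.1 x.2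

lemma height_lt {n : ℕ} (hn : 3 ≤ n) {x y : ℕ × ℕ} (hx : MemAT n x) (hy : MemAT n y)
    (h : x ≤ y) : x = y ∨ height n x < height n y := by
  obtain ⟨a, b⟩ := x
  obtain ⟨c, d⟩ := y
  have h₁ : a ≤ c := h.1
  have h₂ : b ≤ d := h.2
  simp only [MemAT, IsZeroPos, Prod.mk.injEq] at hx hy
  simp only [height, Prod.mk.injEq]
  split_ifs <;> omega

lemma jPos_spec {n : ℕ} (hn : 3 ≤ n) {x : ℕ × ℕ} (hx : MemAT n x) : ∃ t : ℤ,
    (2 * t = height n x - n ∧ jPos n x = ((t + 1) * ((n : ℤ) - 1), 1)) ∨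
    (2 * t = height n x + 1 - n ∧ jPos n x = (t * ((n : ℤ) - 1), (n : ℤ))) ∨
    (1 ≤ height n x ∧ height n x + 2 ≤ n ∧ 2 * t = height n x - n ∧
      jPos n x = (t * ((n : ℤ) - 1) + ((height n x : ℤ) - 1), (n : ℤ) + 1)) ∨
    (1 ≤ height n x ∧ height n x + 2 ≤ n ∧ 2 * t = height n x + 1 - n ∧
      jPos n x = (t * ((n : ℤ) - 1) + (height n x : ℤ), 0)) := by
  obtain ⟨a, b⟩ := x
  simp only [MemAT, IsZeroPos, Prod.mk.injEq] at hx
  by_cases h₁ : a + 2 = n ∧ b + 2 = n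
  · refine ⟨0, Or.inr (Or.inl ?_)⟩
    simp only [height, jPos, h₁, and_self, if_true]
    refine ⟨by omega, by simp⟩
  by_cases h₂ : b = a + 1
  · have hh : height n (a, b) = b := by simp only [height, if_neg h₁]; omega
    rw [hh]
    by_cases h₃ : Even (n + b)
    · refine ⟨((b : ℤ) - n) / 2, Or.inr (Or.inr (Or.inl ⟨by omega, by omega, ?_, ?_⟩))⟩
      · rw [Nat.even_iff] at h₃
        omega
      · simp only [jPos, if_neg h₁, if_pos h₂, if_pos h₃]
    · refine ⟨((b : ℤ) + 1 - n) / 2, Or.inr (Or.inr (Or.inr ⟨by omega, by omega, ?_, ?_⟩))⟩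
      · rw [Nat.even_iff] at h₃
        omega
      · simp only [jPos, if_neg h₁, if_pos h₂, if_neg h₃]
  · have hh : height n (a, b) = a := by simp only [height, if_neg h₁]; omega
    rw [hh]
    by_cases h₃ : Even (n + a)
    · refine ⟨((a : ℤ) - n) / 2, Or.inl ⟨?_, ?_⟩⟩
      · rw [Nat.even_iff] at h₃
        omega
      · simp only [jPos, if_neg h₁, if_neg h₂, if_pos h₃]
        congr 2
        omega
    · refine ⟨((a : ℤ) + 1 - n) / 2, Or.inr (Or.inl ⟨?_, ?_⟩)⟩
      · rw [Nat.even_iff] at h₃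
        omega
      · simp only [jPos, if_neg h₁, if_neg h₂, if_neg h₃]

lemma jPos_mono {n : ℕ} (hn : 3 ≤ n) {x y : ℕ × ℕ} (hx : MemAT n x) (hy : MemAT n y) (h : x ≤ y) :
    (jPos n x).1 ≤ (jPos n y).1 ∧ (jPos n x).1 + (jPos n x).2 ≤ (jPos n y).1 + (jPos n y).2 := by
  rcases height_lt hn hx hy h with rfl | hlt
  · exact ⟨le_rfl, le_rfl⟩
  obtain ⟨t, ht⟩ := jPos_spec hn hx
  obtain ⟨r, hr⟩ := jPos_spec hn hy
  have hs : (0 : ℤ) ≤ (n : ℤ) - 1 := by omega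
  have key₀ : t ≤ r → t * ((n : ℤ) - 1) ≤ r * ((n : ℤ) - 1) :=
    fun h ↦ mul_le_mul_of_nonneg_right h hs
  have key₁ : t + 1 ≤ r → (t + 1) * ((n : ℤ) - 1) ≤ r * ((n : ℤ) - 1) :=
    fun h ↦ mul_le_mul_of_nonneg_right h hs
  rw [add_mul, one_mul] at key₁
  rcases ht with ⟨ht, e⟩ | ⟨ht, e⟩ | ⟨hh, hh', ht, e⟩ | ⟨hh, hh', ht, e⟩ <;>
  rcases hr with ⟨hr, e'⟩ | ⟨hr, e'⟩ | ⟨gg, gg', hr, e'⟩ | ⟨gg, gg', hr, e'⟩ <;>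
  rw [e, e'] <;> simp only [add_mul, one_mul] <;>
  generalize t * ((n : ℤ) - 1) = T at * <;> generalize r * ((n : ℤ) - 1) = R at * <;>
  omega

/-- The embedding `j^n : Ã(n,2) ⟶ M_n`. -/
def jMap (hn : 3 ≤ n) : AT n →o Mesh n where
  toFun x := ⟨(jPos n x.1).1, (jPos n x.1).2, (jPos_bounds n x.1).1, (jPos_bounds n x.1).2⟩
  monotone' x y h := jPos_mono hn x.2 y.2 h

lemma jMap_isZeroPos (hn : 3 ≤ n) (x : AT n) (hx : IsZeroPos n x.1) :
    (jMap n hn x).l = 0 ∨ (jMap n hn x).l = n + 1 := by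
  change (jPos n x.1).2 = 0 ∨ (jPos n x.1).2 = n + 1
  obtain ⟨h₁, h₂⟩ := hx
  unfold jPos
  split_ifs <;> dsimp only <;> lia

/-- `(j^n)^* : 𝒟^{M_n,ex} ⟶ 𝒟^{A(n,2)}`. -/
def jRes (hn : 3 ≤ n) : D.DMex n ⟶ D.DA2 n :=
  lift ((D.meshEx n).ι ≫ D.restr (shapeMap (jMap n hn))) (D.anTwo n) fun _ X x hx ↦
    VanishesAt.restr (shapeMap (jMap n hn)) rfl (X.2.1 _ (jMap_isZeroPos n hn x hx))

end ex

/-! ### The morphism `i^n`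

The construction passes through the following three-dimensional posets, with `z < l` in the third
coordinate and with `N = n-l+1` at the stage `l`. -/

/-- The last object of the posets `K2`, ..., `K5`. -/
def topK (N : ℕ) : ℕ × ℕ := if N = 3 then (2, 1) else (N - 2, N - 2)

/-- `K1 = Ã(N,2) × [l-1]`. -/
def MemK1 (N l : ℕ) (x : (ℕ × ℕ) × ℕ) : Prop := MemAT N x.1 ∧ x.2 < l

/-- `K2` is `Ã(N,2) × [l-1]` with the column at `(1,1)` added; for `N = 3`, where `(1,1)` is the last
object of `Ã(N,2)`, the last object is renamed `(2,1)`. -/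
def MemK2 (N l : ℕ) (x : (ℕ × ℕ) × ℕ) : Prop :=
  (x.1 = (0, 0) ∨ x.1 = (1, 1) ∨ (x.1.1 = x.1.2 + 1 ∧ x.1.1 + 2 ≤ N) ∨ IsZeroPos N x.1 ∨
    x.1 = topK N) ∧ x.2 < l

/-- `K3` is `K2` without the column at `(0,0)`. -/
def MemK3 (N l : ℕ) (x : (ℕ × ℕ) × ℕ) : Prop := MemK2 N l x ∧ x.1 ≠ (0, 0)

/-- `K4` is `K3` without the column at `(0,1)`. -/
def MemK4 (N l : ℕ) (x : (ℕ × ℕ) × ℕ) : Prop := MemK3 N l x ∧ x.1 ≠ (0, 1)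

/-- `K5` is `K4` without the objects `(1,0,z)` with `z > 0`. -/
def MemK5 (N l : ℕ) (x : (ℕ × ℕ) × ℕ) : Prop := MemK4 N l x ∧ (x.1 = (1, 0) → x.2 = 0)

/-- The poset `K1`. -/
abbrev K1 (N l : ℕ) : Type := {x : (ℕ × ℕ) × ℕ // MemK1 N l x}
/-- The poset `K2`. -/
abbrev K2 (N l : ℕ) : Type := {x : (ℕ × ℕ) × ℕ // MemK2 N l x}
/-- The poset `K3`. -/
abbrev K3 (N l : ℕ) : Type := {x : (ℕ × ℕ) × ℕ // MemK3 N l x}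
/-- The poset `K4`. -/
abbrev K4 (N l : ℕ) : Type := {x : (ℕ × ℕ) × ℕ // MemK4 N l x}
/-- The poset `K5`. -/
abbrev K5 (N l : ℕ) : Type := {x : (ℕ × ℕ) × ℕ // MemK5 N l x}

/-- The isomorphism `Ã(m,2) × [0] ≅ Ã(n,2)` for `m = n`. -/
def kStart (m n : ℕ) (h : m = n) : K1 m 1 →o AT n where
  toFun x := ⟨x.1.1, h ▸ x.2.1⟩
  monotone' _ _ h := h.1

/-- The inclusion of `K1` into `K2`, sending the last object to the last object. -/
def k1 (N l : ℕ) (hN : 3 ≤ N) : K1 N l →o K2 N l where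
  toFun x := ⟨(if x.1.1 = (N - 2, N - 2) then topK N else x.1.1, x.1.2), by
    obtain ⟨⟨⟨a, b⟩, c⟩, h, hc⟩ := x
    refine ⟨?_, hc⟩
    simp only [MemAT, IsZeroPos, topK, Prod.mk.injEq] at h ⊢
    split_ifs <;> simp only [Prod.mk.injEq] at * <;> grind⟩
  monotone' := by
    rintro ⟨⟨⟨a, b⟩, c⟩, h, hc⟩ ⟨⟨⟨a', b'⟩, c'⟩, h', hc'⟩ hle
    have h₁ : a ≤ a' := hle.1.1
    have h₂ : b ≤ b' := hle.1.2
    refine ⟨?_, hle.2⟩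
    simp only [MemAT, IsZeroPos, topK, Prod.mk.injEq] at h h' ⊢
    split_ifs <;> constructor <;> dsimp only <;> omega

/-- The inclusion of `K3` into `K2`. -/
def k2 (N l : ℕ) : K3 N l →o K2 N l where
  toFun x := ⟨x.1, x.2.1⟩
  monotone' _ _ h := h

/-- The inclusion of `K4` into `K3`. -/
def k3 (N l : ℕ) : K4 N l →o K3 N l where
  toFun x := ⟨x.1, x.2.1⟩
  monotone' _ _ h := h

/-- The map `K4 ⟶ K5` with `(1,0,z) ↦ (1,0,0)` and `(x,y,z) ↦ (x,y,z)` otherwise. -/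
def k4 (N l : ℕ) : K4 N l →o K5 N l where
  toFun x := ⟨(x.1.1, if x.1.1 = (1, 0) then 0 else x.1.2), by
    obtain ⟨⟨⟨a, b⟩, c⟩, ⟨⟨h, hc⟩, h₁⟩, h₂⟩ := x
    refine ⟨⟨⟨⟨h, ?_⟩, h₁⟩, h₂⟩, ?_⟩
    · dsimp only at hc ⊢
      split_ifs <;> omega
    · intro h₃
      exact if_pos h₃⟩
  monotone' := by
    rintro ⟨⟨⟨a, b⟩, c⟩, ⟨⟨h, hc⟩, h₁⟩, h₂⟩ ⟨⟨⟨a', b'⟩, c'⟩, ⟨⟨h', hc'⟩, h₁'⟩, h₂'⟩ hle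
    refine ⟨hle.1, ?_⟩
    have h₃ : a ≤ a' := hle.1.1
    have h₄ : b ≤ b' := hle.1.2
    have h₅ : c ≤ c' := hle.2
    simp only [IsZeroPos, topK, Prod.mk.injEq, ne_eq] at h h' h₁ h₁' h₂ h₂' ⊢
    split_ifs at * <;> simp only [Prod.mk.injEq] at * <;> omega

/-- The map from `K1` of the next stage to `K5`, given by `(x,y,z) ↦ (x+1,y+1,z-1)` for `z ≠ 0`,
`(x,y,0) ↦ (x+1,y+1,0)` for `(x,y) ≠ (0,0)`, and `(0,0,0) ↦ (1,0,0)`. -/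
def k5 (N l : ℕ) (hN : 3 ≤ N) (hl : 1 ≤ l) : K1 N (l + 1) →o K5 (N + 1) l where
  toFun x := ⟨if x.1.2 = 0 then
      if x.1.1 = (0, 0) then ((1, 0), 0) else ((x.1.1.1 + 1, x.1.1.2 + 1), 0)
    else ((x.1.1.1 + 1, x.1.1.2 + 1), x.1.2 - 1), by
    obtain ⟨⟨⟨a, b⟩, c⟩, h, hc⟩ := x
    simp only [MemAT, IsZeroPos, Prod.mk.injEq] at h hc ⊢
    simp only [MemK5, MemK4, MemK3, MemK2, IsZeroPos, topK, ne_eq]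
    split_ifs <;> simp only [Prod.mk.injEq] at * <;> grind⟩
  monotone' := by
    rintro ⟨⟨⟨a, b⟩, c⟩, h, hc⟩ ⟨⟨⟨a', b'⟩, c'⟩, h', hc'⟩ hle
    have h₁ : a ≤ a' := hle.1.1
    have h₂ : b ≤ b' := hle.1.2
    have h₃ : c ≤ c' := hle.2
    simp only [MemAT, IsZeroPos, Prod.mk.injEq] at h h' hc hc'
    simp only [Subtype.mk_le_mk, Prod.mk.injEq]
    split_ifs <;> simp only [Prod.mk_le_mk] <;> omega

/-- The last map `K5 ⟶ A_n`: `(1,0,0) ↦ 1`, `(1,1,z) ↦ z+2` and `(2,1,z) ↦ n`. -/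
def kEnd (n l : ℕ) (h : l + 2 = n) : K5 3 l →o An n where
  toFun x := ⟨if x.1.1 = (1, 0) then 1 else if x.1.1 = (1, 1) then x.1.2 + 2 else n, by
    obtain ⟨⟨⟨a, b⟩, c⟩, ⟨⟨⟨h, hc⟩, h₁⟩, h₂⟩, h₃⟩ := x
    dsimp only at *
    split_ifs <;> omega⟩
  monotone' := by
    rintro ⟨⟨⟨a, b⟩, c⟩, ⟨⟨⟨h, hc⟩, h₁⟩, h₂⟩, h₃⟩ ⟨⟨⟨a', b'⟩, c'⟩, ⟨⟨⟨h', hc'⟩, h₁'⟩, h₂'⟩, h₃'⟩ hle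
    have h₄ : a ≤ a' := hle.1.1
    have h₅ : b ≤ b' := hle.1.2
    have h₆ : c ≤ c' := hle.2
    simp only [IsZeroPos, topK, Prod.mk.injEq, ne_eq, if_true] at h h' h₁ h₁' h₂ h₂' h₃ h₃'
    simp only [Subtype.mk_le_mk, Prod.mk.injEq]
    split_ifs <;> omega

section main
variable [D.HasLan]

/-- The common part of all the stages: left Kan extension along `K1 ⟶ K2`, then the inverses of the
right Kan extension along `K3 ⟶ K2` and of the left Kan extension along `K4 ⟶ K3`, i.e. the two
restrictions, and then the inverse of the restriction along `K4 ⟶ K5`, i.e. its left adjoint. -/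
noncomputable def stage (N l : ℕ) (hN : 3 ≤ N) :
    D.shift (shape.{u} (K1 N l)) ⟶ D.shift (shape.{u} (K5 N l)) :=
  D.lan (shapeMap (k1 N l hN)) ≫ D.restr (shapeMap (k2 N l)) ≫ D.restr (shapeMap (k3 N l)) ≫
    D.lan (shapeMap (k4 N l))

/-- The composite of the stages `l, ..., n-2` (with `r = n-2-l`). After every stage but the last one
restrict to `K1` of the next stage; after the last one apply the inverse of the restriction along
`K5 ⟶ A_n`, i.e. its left adjoint. -/
noncomputable def fromStage (n : ℕ) : (r l : ℕ) → 1 ≤ l → l + r + 2 = n →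
    (D.shift (shape.{u} (K1 (r + 3) l)) ⟶ D.shift (shape.{u} (An n)))
  | 0, l, _, h => D.stage 3 l le_rfl ≫ D.lan (shapeMap (kEnd n l h))
  | r + 1, l, hl, h => D.stage (r + 4) l (by omega) ≫
      D.restr (shapeMap (k5 (r + 3) l (by omega) hl)) ≫
        fromStage n r (l + 1) (by omega) (by omega)

/-- The morphism `i^n : 𝒟^{A(n,2)} ⟶ 𝒟^{A_n}`. -/
noncomputable def mainMorphism (n : ℕ) (hn : 3 ≤ n) : D.DA2 n ⟶ D.shift (shape.{u} (An n)) :=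
  (D.anTwo n).ι ≫ D.restr (shapeMap (kStart (n - 3 + 3) n (by omega))) ≫
    D.fromStage n (n - 3) 1 le_rfl (by omega)

end main

/-- Equivalences in the bicategory of prederivators. -/
def IsEquiv {F G : Prederivator.{u, v, w}} (f : F ⟶ G) : Prop :=
  ∃ g : G ⟶ F, Nonempty (f ≫ g ≅ 𝟙 F) ∧ Nonempty (g ≫ f ≅ 𝟙 G)

end Prederivator

set_option linter.unusedSectionVars false

/-! The statement is proved at each parameter category `I` and then globalized. A pseudonatural
transformation that is objectwise an equivalence is an equivalence (`exists_inverse_of_objectwise`),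
and objectwise left adjoints form a morphism of prederivators once they satisfy base change
(`lanTrans`). For `k^*` base change is the exactness of the squares formed by `k × id` and `id × f`
(`isLan_unitCell`). To avoid calculations with mates, Kan extensions are described by universal
arrows (`IsLan`, `IsRan`). A diagram counts as extended from a subposet if the identity of its
restriction is such an arrow (`LanProp`, `RanProp`), and this is checked locally: on values that are
zero and on squares that are cocartesian, or equivalently cartesian by stability.

Restriction along `i_n`. A diagram in `𝒟^{M_n,ex}` is determined by its values at `k = 0`. The zeros
to the right of this slice are a right Kan extension by zero, the rest of the part `k ≥ 0` is
obtained by pushouts along mesh squares, and the remaining values with `k < 0` by pullbacks.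
Conversely these three extensions produce an exact diagram from any diagram on `A_n`. This gives
`iRes_isEquivalence`.

Full faithfulness of `i^n`. The diagrams that occur in the construction vanish at the prescribed
places and invert certain vertical arrows (`IsStage`). On them every step is bijective on morphisms.
The extension along `k1` is along an embedding. The squares it adds are also cartesian, so
restricting along `k2` loses nothing. The objects dropped by `k3` are zeros with empty slices. The
steps `k4`, `k5` and the last one belong to coreflections and reflections of posets. This gives
`bijective_mainMorphism`.

The triangle. The posets `K2` of all stages are mapped to `M_n` by `stageMap`, which is built from
the glide reflection `meshRot`. The pushout squares of a stage go to rotated rectangles, which are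
pastings of mesh squares and hence cocartesian. So a stage takes the restriction of an exact diagram
to `K1` to its restriction to `K5`. Consecutive stages match, the first one starts at `j^n` and the
last one ends at `i_n`. This gives `jRes_mainMorphism`.

Conclusion. The composite of `(j^n)^*` and `i^n` is an equivalence because `(i_n)^*` is one. Hence
`i^n` is essentially surjective, without any inverse construction for the stages. Being full and
faithful it is an equivalence, and then so is `(j^n)^*`. -/

namespace Prederivator

/-! ### Universal arrows in place of mates -/

section universal
variable {C₁ C₂ C₃ : Type*} [Category C₁] [Category C₂] [Category C₃]

/-- `η : Z ⟶ R Y` is a universal arrow from `Z` to `R`, i.e. it exhibits `Y` as the value at `Z` of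
a partial left adjoint of `R`. -/
def IsLan (R : C₁ ⥤ C₂) {Z : C₂} {Y : C₁} (η : Z ⟶ R.obj Y) : Prop :=
  ∀ Y', Function.Bijective fun f : Y ⟶ Y' ↦ η ≫ R.map f

/-- `θ : R Y ⟶ Z` is a universal arrow from `R` to `Z`, i.e. it exhibits `Y` as the value at `Z` of
a partial right adjoint of `R`. -/
def IsRan (R : C₁ ⥤ C₂) {Z : C₂} {Y : C₁} (θ : R.obj Y ⟶ Z) : Prop :=
  ∀ Y', Function.Bijective fun f : Y' ⟶ Y ↦ R.map f ≫ θ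

lemma isLan_unit {L : C₂ ⥤ C₁} {R : C₁ ⥤ C₂} (adj : L ⊣ R) (Z : C₂) :
    IsLan R (adj.unit.app Z) := fun Y' ↦ by
  have : (fun f : L.obj Z ⟶ Y' ↦ adj.unit.app Z ≫ R.map f) = adj.homEquiv Z Y' := by
    funext f
    simp [Adjunction.homEquiv_unit]
  rw [this]
  exact (adj.homEquiv Z Y').bijective

lemma isRan_counit {L : C₂ ⥤ C₁} {R : C₁ ⥤ C₂} (adj : L ⊣ R) (Z : C₁) :
    IsRan L (adj.counit.app Z) := fun Y' ↦ by
  have : (fun f : Y' ⟶ R.obj Z ↦ L.map f ≫ adj.counit.app Z) = (adj.homEquiv Y' Z).symm := by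
    funext f
    simp [Adjunction.homEquiv_counit]
  rw [this]
  exact (adj.homEquiv Y' Z).symm.bijective

namespace IsLan
variable {R : C₁ ⥤ C₂} {Z : C₂} {Y : C₁} {η : Z ⟶ R.obj Y}

/-- Uniqueness of universal arrows, in the form used to recognize a comparison map as invertible. -/
lemma isIso (h : IsLan R η) {Y' : C₁} {f : Y ⟶ Y'} (h' : IsLan R (η ≫ R.map f)) : IsIso f := by
  obtain ⟨g, hg⟩ := (h' Y).2 η
  dsimp only at hg
  have h₁ : f ≫ g = 𝟙 Y := (h Y).1 (by simpa using hg)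
  refine ⟨g, h₁, (h' Y').1 ?_⟩
  dsimp only
  rw [R.map_comp, ← Category.assoc, hg]
  simp

lemma comp_map (h : IsLan R η) {Y' : C₁} (f : Y ⟶ Y') [IsIso f] : IsLan R (η ≫ R.map f) :=
  fun W ↦ by
    have : (fun g : Y' ⟶ W ↦ (η ≫ R.map f) ≫ R.map g) =
        (fun g : Y ⟶ W ↦ η ≫ R.map g) ∘ (fun g : Y' ⟶ W ↦ f ≫ g) := by ext; simp
    rw [this]
    exact (h W).comp ⟨fun _ _ h ↦ (cancel_epi f).1 h, fun g ↦ ⟨inv f ≫ g, by simp⟩⟩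

lemma comp_iso_left (h : IsLan R η) {Z' : C₂} (e : Z' ⟶ Z) [IsIso e] : IsLan R (e ≫ η) :=
  fun W ↦ by
    have : (fun g : Y ⟶ W ↦ (e ≫ η) ≫ R.map g) =
        (fun g : Z ⟶ R.obj W ↦ e ≫ g) ∘ (fun g : Y ⟶ W ↦ η ≫ R.map g) := by ext; simp
    rw [this]
    exact .comp ⟨fun _ _ h ↦ (cancel_epi e).1 h, fun g ↦ ⟨inv e ≫ g, by simp⟩⟩ (h W)

lemma of_comp_iso_left {Z' : C₂} (e : Z' ⟶ Z) [IsIso e] (h : IsLan R (e ≫ η)) : IsLan R η := by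
  simpa using h.comp_iso_left (inv e)

lemma of_natIso (h : IsLan R η) {R' : C₁ ⥤ C₂} (τ : R ≅ R') : IsLan R' (η ≫ τ.hom.app Y) :=
  fun W ↦ by
    have : (fun g : Y ⟶ W ↦ (η ≫ τ.hom.app Y) ≫ R'.map g) =
        (fun g : Z ⟶ R.obj W ↦ g ≫ τ.hom.app W) ∘ (fun g : Y ⟶ W ↦ η ≫ R.map g) := by ext; simp
    rw [this]
    exact .comp ⟨fun _ _ h ↦ (cancel_mono _).1 h, fun g ↦ ⟨g ≫ τ.inv.app W, by simp⟩⟩ (h W)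

lemma of_natIso' {R' : C₁ ⥤ C₂} (τ : R ≅ R') (h : IsLan R' (η ≫ τ.hom.app Y)) : IsLan R η := by
  simpa using h.of_natIso τ.symm

variable {S : C₂ ⥤ C₃} {W : C₃} {ζ : W ⟶ S.obj Z}

lemma comp (h : IsLan S ζ) (h' : IsLan R η) : IsLan (R ⋙ S) (ζ ≫ S.map η) := fun V ↦ by
  have : (fun g : Y ⟶ V ↦ (ζ ≫ S.map η) ≫ (R ⋙ S).map g) =
      (fun g : Z ⟶ R.obj V ↦ ζ ≫ S.map g) ∘ (fun g : Y ⟶ V ↦ η ≫ R.map g) := by ext; simp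
  rw [this]
  exact (h _).comp (h' V)

lemma of_comp (h : IsLan S ζ) (h' : IsLan (R ⋙ S) (ζ ≫ S.map η)) : IsLan R η := fun V ↦ by
  have : (fun g : Y ⟶ V ↦ (ζ ≫ S.map η) ≫ (R ⋙ S).map g) =
      (fun g : Z ⟶ R.obj V ↦ ζ ≫ S.map g) ∘ (fun g : Y ⟶ V ↦ η ≫ R.map g) := by ext; simp
  have h'' := h' V
  rw [this] at h''
  exact (Function.Bijective.of_comp_iff' (h _) _).1 h''

/-- Used for the functor `id^*`, to which base change reduces universal arrows along fully faithful
functors. -/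
lemma isIso_of_natIso {R : C₁ ⥤ C₁} (τ : R ≅ 𝟭 C₁) {Z Y : C₁} {η : Z ⟶ R.obj Y}
    (h : IsLan R η) : IsIso η := by
  have h' := h.of_natIso τ
  have : IsIso (η ≫ τ.hom.app Y) := by
    obtain ⟨g, hg⟩ := (h' Z).2 (𝟙 Z)
    dsimp at hg
    refine ⟨g, hg, (h' Y).1 ?_⟩
    dsimp only [Functor.id_map]
    rw [← Category.assoc, hg]
    exact (Category.id_comp _).trans (Category.comp_id _).symm
  exact IsIso.of_isIso_comp_right η (τ.hom.app Y)

/-- The mate of a 2-cell is invertible if and only if the 2-cell preserves universal arrows. -/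
lemma map_comp_app {C₄ : Type*} [Category C₄] {L₁ : C₂ ⥤ C₁} {R₁ : C₁ ⥤ C₂} (adj₁ : L₁ ⊣ R₁)
    {L₂ : C₄ ⥤ C₃} {R₂ : C₃ ⥤ C₄} (adj₂ : L₂ ⊣ R₂) {G : C₂ ⥤ C₄} {H : C₁ ⥤ C₃}
    (β : R₁ ⋙ G ⟶ H ⋙ R₂) (h : ∀ Z, IsIso (((mateEquiv adj₁ adj₂).symm β).app Z))
    {Z : C₂} {Y : C₁} {η : Z ⟶ R₁.obj Y} (hη : IsLan R₁ η) : IsLan R₂ (G.map η ≫ β.app Y) := by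
  obtain ⟨m, rfl⟩ := (mateEquiv adj₁ adj₂).surjective β
  rw [Equiv.symm_apply_apply] at h
  obtain ⟨f, hf⟩ := ((isLan_unit adj₁ Z) Y).2 η
  dsimp only at hf
  subst hf
  have := (isLan_unit adj₁ Z).isIso hη
  -- After replacing `η` by the unit followed by an isomorphism, the unit-mate identity exhibits the
  -- arrow as the unit of `adj₂` followed by the images of the two isomorphisms `m.app Z` and `H.map
  -- f`.
  have e : G.map (adj₁.unit.app Z ≫ R₁.map f) ≫ (mateEquiv adj₁ adj₂ m).app Y =
      (adj₂.unit.app (G.obj Z) ≫ R₂.map (m.app Z)) ≫ R₂.map (H.map f) := by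
    have hβ := unit_mateEquiv adj₁ adj₂ m Z
    have hn := (mateEquiv adj₁ adj₂ m).naturality f
    dsimp only [Functor.comp_map, Functor.id_obj] at hn hβ
    rw [← hβ, G.map_comp, Category.assoc, Category.assoc, hn]
  rw [e]
  have := h Z
  exact ((isLan_unit adj₂ _).comp_map _).comp_map _

end IsLan

lemma isLan_of_isIso {R : C₁ ⥤ C₁} (τ : R ≅ 𝟭 C₁) {Z Y : C₁} (η : Z ⟶ R.obj Y) [IsIso η] :
    IsLan R η := by
  refine .of_natIso' τ fun V ↦ ⟨fun a b h ↦ ?_, fun g ↦ ⟨inv (η ≫ τ.hom.app Y) ≫ g, ?_⟩⟩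
  · exact (cancel_epi (η ≫ τ.hom.app Y)).1 h
  · exact IsIso.hom_inv_id_assoc (η ≫ τ.hom.app Y) g

namespace IsRan
variable {R : C₁ ⥤ C₂} {Z : C₂} {Y : C₁} {θ : R.obj Y ⟶ Z}

lemma of_natIso (h : IsRan R θ) {R' : C₁ ⥤ C₂} (τ : R ≅ R') : IsRan R' (τ.inv.app Y ≫ θ) :=
  fun W ↦ by
    have : (fun g : W ⟶ Y ↦ R'.map g ≫ τ.inv.app Y ≫ θ) =
        (fun g : R.obj W ⟶ Z ↦ τ.inv.app W ≫ g) ∘ (fun g : W ⟶ Y ↦ R.map g ≫ θ) := by ext; simp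
    rw [this]
    exact .comp ⟨fun _ _ h ↦ (cancel_epi _).1 h, fun g ↦ ⟨τ.hom.app W ≫ g, by simp⟩⟩ (h W)

lemma comp_iso_right (h : IsRan R θ) {Z' : C₂} (e : Z ⟶ Z') [IsIso e] : IsRan R (θ ≫ e) :=
  fun W ↦ by
    have : (fun g : W ⟶ Y ↦ R.map g ≫ θ ≫ e) =
        (fun g : R.obj W ⟶ Z ↦ g ≫ e) ∘ (fun g : W ⟶ Y ↦ R.map g ≫ θ) := by ext; simp
    rw [this]
    exact .comp ⟨fun _ _ h ↦ (cancel_mono e).1 h, fun g ↦ ⟨g ≫ inv e, by simp⟩⟩ (h W)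

lemma isIso_of_natIso {R : C₁ ⥤ C₁} (τ : R ≅ 𝟭 C₁) {Z Y : C₁} {θ : R.obj Y ⟶ Z}
    (h : IsRan R θ) : IsIso θ := by
  have h' := h.of_natIso τ
  have : IsIso (τ.inv.app Y ≫ θ) := by
    obtain ⟨g, hg⟩ := (h' Z).2 (𝟙 Z)
    dsimp at hg
    refine ⟨g, (h' Y).1 ?_, hg⟩
    dsimp only [Functor.id_map]
    rw [Category.assoc, hg]
    exact (Category.comp_id _).trans (Category.id_comp _).symm
  exact IsIso.of_isIso_comp_left (τ.inv.app Y) θ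

/-- If a 2-cell preserves universal arrows, then the conjugate statement for couniversal arrows
holds as well. -/
lemma map_app_comp {C₄ : Type*} [Category C₄] {R₁ : C₁ ⥤ C₂} [R₁.IsRightAdjoint]
    {R₂ : C₃ ⥤ C₄} {G : C₂ ⥤ C₄} {H : C₁ ⥤ C₃}
    (β : R₁ ⋙ G ⟶ H ⋙ R₂)
    (h : ∀ {Z : C₂} {Y : C₁} {η : Z ⟶ R₁.obj Y}, IsLan R₁ η → IsLan R₂ (G.map η ≫ β.app Y))
    {Y : C₁} {Z : C₃} {θ : H.obj Y ⟶ Z} (hθ : IsRan H θ) :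
    IsRan G (β.app Y ≫ R₂.map θ) := fun V ↦ by
  obtain ⟨L₁, ⟨adj⟩⟩ := ‹R₁.IsRightAdjoint›
  have h₁ := isLan_unit adj V
  -- Precomposed with the bijection from maps `L₁ V ⟶ Y` to maps `V ⟶ R₁ Y`, the map in question is
  -- a composite of two known bijections. Right exactness of a square thus follows from left
  -- exactness.
  have e : (fun g : V ⟶ R₁.obj Y ↦ G.map g ≫ β.app Y ≫ R₂.map θ) ∘
      (fun k : L₁.obj V ⟶ Y ↦ adj.unit.app V ≫ R₁.map k) =
      (fun k : H.obj (L₁.obj V) ⟶ Z ↦ (G.map (adj.unit.app V) ≫ β.app _) ≫ R₂.map k) ∘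
        (fun k : L₁.obj V ⟶ Y ↦ H.map k ≫ θ) := by
    funext k
    have := β.naturality k
    dsimp at this ⊢
    simp [reassoc_of% this]
  refine (Function.Bijective.of_comp_iff _ (h₁ Y)).1 ?_
  rw [e]
  exact (h h₁ Z).comp (hθ _)

end IsRan

end universal

/-! ### Restriction functors -/

section api
variable (D : Prederivator.{u, v, w}) {A B C E : Cat.{u, u}}

/-- The natural transformation `w^* ⟶ w'^*` induced by a 2-cell `w ⟶ w'`. -/
def resMap {w w' : A ⟶ B} (α : w ⟶ w') : D.res w ⟶ D.res w' :=
  (D.map₂ (Bicategory.Opposite.op2 α)).toNatTrans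

/-- The isomorphism `(x ∘ w)^* ≅ w^* x^*`. -/
def resComp (w : A ⟶ B) (x : B ⟶ C) : D.res (w ≫ x) ≅ D.res x ⋙ D.res w :=
  Cat.Hom.toNatIso (D.mapComp x.op w.op)

/-- The isomorphism `id^* ≅ id`. -/
def resId (A : Cat.{u, u}) : D.res (𝟙 A) ≅ 𝟭 _ := Cat.Hom.toNatIso (D.mapId (op A))

@[simp]
lemma resMap_id (w : A ⟶ B) : D.resMap (𝟙 w) = 𝟙 _ := by
  change (D.map₂ (𝟙 w.op)).toNatTrans = _
  rw [D.map₂_id]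
  rfl

lemma resMap_comp {w w' w'' : A ⟶ B} (α : w ⟶ w') (β : w' ⟶ w'') :
    D.resMap (α ≫ β) = D.resMap α ≫ D.resMap β := by
  change (D.map₂ (op2 α ≫ op2 β)).toNatTrans = _
  rw [D.map₂_comp]
  rfl

lemma resCell_app {p : C ⟶ A} {w : A ⟶ B} {q : C ⟶ E} {x : E ⟶ B}
    (α : p ≫ w ⟶ q ≫ x) (Y : D.obj (op B)) :
    (D.resCell α).app Y = (D.resComp p w).inv.app Y ≫ (D.resMap α).app Y ≫
      (D.resComp q x).hom.app Y := rfl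

lemma resMap_whiskerLeft (p : C ⟶ A) {w w' : A ⟶ B} (α : w ⟶ w') (Y : D.obj (op B)) :
    (D.resMap (p ◁ α)).app Y = (D.resComp p w).hom.app Y ≫ (D.res p).map ((D.resMap α).app Y) ≫
      (D.resComp p w').inv.app Y := by
  -- Passing to the opposite bicategory exchanges the two whiskerings.
  change (D.map₂ (op2 α ▷ p.op)).toNatTrans.app Y = _
  rw [D.map₂_whisker_right]
  rfl

lemma resMap_whiskerRight {p p' : C ⟶ A} (α : p ⟶ p') (w : A ⟶ B) (Y : D.obj (op B)) :
    (D.resMap (α ▷ w)).app Y = (D.resComp p w).hom.app Y ≫ (D.resMap α).app ((D.res w).obj Y) ≫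
      (D.resComp p' w).inv.app Y := by
  change (D.map₂ (w.op ◁ op2 α)).toNatTrans.app Y = _
  rw [D.map₂_whisker_left]
  rfl

lemma resComp_assoc (p : C ⟶ A) (w : A ⟶ B) (x : B ⟶ E) (Y : D.obj (op E)) :
    (D.resComp (p ≫ w) x).hom.app Y ≫ (D.resComp p w).hom.app ((D.res x).obj Y) =
      (D.resComp p (w ≫ x)).hom.app Y ≫ (D.res p).map ((D.resComp w x).hom.app Y) := by
  have h := D.mapComp'₀₁₃_hom_comp_whiskerLeft_mapComp'_hom x.op w.op p.op (x.op ≫ w.op)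
    (w.op ≫ p.op) (x.op ≫ w.op ≫ p.op) rfl rfl rfl
  simp only [Pseudofunctor.mapComp'_eq_mapComp] at h
  have e : D.mapComp' (x.op ≫ w.op) p.op (x.op ≫ w.op ≫ p.op) rfl =
    D.mapComp (x.op ≫ w.op) p.op := D.mapComp'_eq_mapComp (x.op ≫ w.op) p.op
  rw [e] at h
  have h' := congrArg (fun z ↦ z.toNatTrans.app Y) h
  simp only [Cat.Hom.toNatTrans_comp, NatTrans.comp_app, Cat.whiskerLeft_app, Cat.whiskerRight_app,
    Cat.associator_hom_toNatTrans, Functor.associator_hom_app] at h'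
  erw [Category.comp_id] at h'
  exact h'

lemma resComp_id_left (p : C ⟶ A) (Y : D.obj (op A)) :
    (D.resComp (𝟙 C) p).hom.app Y = (D.resId C).inv.app ((D.res p).obj Y) := by
  have h := D.mapComp'_comp_id_hom p.op
  have e : D.mapComp' p.op (𝟙 _) p.op = D.mapComp p.op (𝟙 _) := D.mapComp'_eq_mapComp _ _
  rw [e] at h
  have h' := congrArg (fun z ↦ z.toNatTrans.app Y) h
  simp at h'
  exact h'

lemma resComp_id_right (p : C ⟶ A) (Y : D.obj (op A)) :
    (D.resComp p (𝟙 A)).hom.app Y = (D.res p).map ((D.resId A).inv.app Y) := by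
  have h := D.mapComp'_id_comp_hom p.op
  have e : D.mapComp' (𝟙 _) p.op p.op = D.mapComp (𝟙 _) p.op := D.mapComp'_eq_mapComp _ _
  rw [e] at h
  have h' := congrArg (fun z ↦ z.toNatTrans.app Y) h
  simp at h'
  exact h'

/-- With the three lemmas that follow, this rewrites structure cells sitting inside `p^*` or at a
restricted object as structure cells of composites, a normal form in which triangle identities and
pastings can be compared. -/
lemma res_map_resMap (p : C ⟶ A) {w w' : A ⟶ B} (α : w ⟶ w') (Y : D.obj (op B)) :
    (D.res p).map ((D.resMap α).app Y) = (D.resComp p w).inv.app Y ≫ (D.resMap (p ◁ α)).app Y ≫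
      (D.resComp p w').hom.app Y := by
  simp [resMap_whiskerLeft]

lemma resMap_app_res {p p' : C ⟶ A} (α : p ⟶ p') (w : A ⟶ B) (Y : D.obj (op B)) :
    (D.resMap α).app ((D.res w).obj Y) = (D.resComp p w).inv.app Y ≫ (D.resMap (α ▷ w)).app Y ≫
      (D.resComp p' w).hom.app Y := by
  simp [resMap_whiskerRight]

lemma res_map_resComp_hom (p : C ⟶ A) (w : A ⟶ B) (x : B ⟶ E) (Y : D.obj (op E)) :
    (D.res p).map ((D.resComp w x).hom.app Y) = (D.resComp p (w ≫ x)).inv.app Y ≫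
      (D.resComp (p ≫ w) x).hom.app Y ≫ (D.resComp p w).hom.app ((D.res x).obj Y) := by
  rw [resComp_assoc]
  simp

lemma res_map_resComp_inv (p : C ⟶ A) (w : A ⟶ B) (x : B ⟶ E) (Y : D.obj (op E)) :
    (D.res p).map ((D.resComp w x).inv.app Y) = (D.resComp p w).inv.app ((D.res x).obj Y) ≫
      (D.resComp (p ≫ w) x).inv.app Y ≫ (D.resComp p (w ≫ x)).hom.app Y := by
  rw [← cancel_epi ((D.res p).map ((D.resComp w x).hom.app Y)), ← Functor.map_comp,
    Iso.hom_inv_id_app, res_map_resComp_hom]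
  simp

/-- An adjunction `l ⊣ r` of functors induces an adjunction `r^* ⊣ l^*`. -/
def resAdj {r : C ⟶ A} {l : A ⟶ C} (a : 𝟙 A ⟶ l ≫ r) (b : r ≫ l ⟶ 𝟙 C)
    (h₁ : r ◁ a ≫ b ▷ r = 𝟙 r) (h₂ : a ▷ l ≫ l ◁ b = 𝟙 l) : D.res r ⊣ D.res l where
  unit := (D.resId A).inv ≫ D.resMap a ≫ (D.resComp l r).hom
  counit := (D.resComp r l).inv ≫ D.resMap b ≫ (D.resId C).hom
  left_triangle_components Z := by
    have h' := congrArg (fun z ↦ (D.resMap z).app Z) h₁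
    simp only [resMap_comp, NatTrans.comp_app] at h'
    have e := D.resComp_id_left r Z
    have e' := D.resComp_id_right r Z
    simp only [NatTrans.comp_app, Functor.map_comp, res_map_resMap, resMap_app_res,
      res_map_resComp_hom, Category.assoc, Iso.hom_inv_id_app_assoc, Functor.comp_obj]
    rw [reassoc_of% h', e, ← e']
    erw [Iso.hom_inv_id_app_assoc, Iso.inv_hom_id_app]
    exact (Category.comp_id _).trans (congrArg (fun z ↦ z.app Z) (D.resMap_id r))
  right_triangle_components Z := by
    have h' := congrArg (fun z ↦ (D.resMap z).app Z) h₂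
    simp only [resMap_comp, NatTrans.comp_app] at h'
    have e := D.resComp_id_left l Z
    have e' := D.resComp_id_right l Z
    simp [res_map_resMap, resMap_app_res,
      res_map_resComp_inv, Category.assoc, Iso.hom_inv_id_app_assoc, Functor.comp_obj]
    rw [reassoc_of% h', ← e]
    erw [Iso.hom_inv_id_app_assoc, e', ← Functor.map_comp, Iso.inv_hom_id_app,
      CategoryTheory.Functor.map_id]
    exact (Category.comp_id _).trans (congrArg (fun z ↦ z.app Z) (D.resMap_id l))
end api
-- Cofinal cones over slice categories
section cones
variable {C A B : Type*} [Category C] [Category A] [Category B]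

/-- A cone `(C, c, γ)` over the slice `w / b` such that the induced functor `C ⥤ w / b` has a left
adjoint, so that colimits over `w / b` can be computed over `C`. -/
def IsGoodCone (w : A ⥤ B) (b : B) (c : C ⥤ A) (γ : ∀ y, w.obj (c.obj y) ⟶ b) : Prop :=
  (∀ ⦃y y' : C⦄ (f : y ⟶ y'), w.map (c.map f) ≫ γ y' = γ y) ∧
    ∀ (a : A) (g : w.obj a ⟶ b), ∃ (y : C) (h : a ⟶ c.obj y), w.map h ≫ γ y = g ∧
      ∀ (y' : C) (h' : a ⟶ c.obj y'), w.map h' ≫ γ y' = g → ∃! k : y ⟶ y', h ≫ c.map k = h'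

/-- A slice of a product functor is the product of the slices, and the universal factorizations are
formed in each factor. This is how a parameter category is carried along. -/
lemma IsGoodCone.prod {w : A ⥤ B} {b : B} {c : C ⥤ A} {γ : ∀ y, w.obj (c.obj y) ⟶ b}
    (h : IsGoodCone w b c γ) {I J : Type*} [Category I] [Category J] (f : I ⥤ J) (j : J)
    {K : Type*} [Category K] {d : K ⥤ I} {δ : ∀ y, f.obj (d.obj y) ⟶ j}
    (h' : IsGoodCone f j d δ) :
    IsGoodCone (Functor.prod w f) (b, j) (Functor.prod c d) (fun y ↦ (γ y.1, δ y.2)) := by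
  refine ⟨fun y y' k ↦ Prod.hom_ext (h.1 k.1) (h'.1 k.2), fun a g ↦ ?_⟩
  obtain ⟨y, k, hk, hk'⟩ := h.2 a.1 g.1
  obtain ⟨z, l, hl, hl'⟩ := h'.2 a.2 g.2
  refine ⟨(y, z), (k, l), Prod.hom_ext hk hl, fun y' m hm ↦ ?_⟩
  obtain ⟨n, hn, hn'⟩ := hk' y'.1 m.1 (congrArg (·.1) hm)
  obtain ⟨o, ho, ho'⟩ := hl' y'.2 m.2 (congrArg (·.2) hm)
  exact ⟨(n, o), Prod.hom_ext hn ho, fun z hz ↦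
    Prod.hom_ext (hn' _ (congrArg (·.1) hz)) (ho' _ (congrArg (·.2) hz))⟩

/-- The functor to the slice category induced by a cone. -/
def toSlice {w : A ⥤ B} {P : Type*} [Category P] {b : P ⥤ B} (c : C ⥤ A) (π : C ⥤ P)
    (γ : c ⋙ w ⟶ π ⋙ b) : C ⥤ Comma w b where
  obj y := ⟨c.obj y, π.obj y, γ.app y⟩
  map f := ⟨c.map f, π.map f, γ.naturality f⟩

/-- The second clause of `IsGoodCone` provides an initial object in every category of arrows from an
object of the slice to the functor; this is the pointwise criterion for a left adjoint. -/
lemma IsGoodCone.isRightAdjoint {w : A ⥤ B} {b : Discrete PUnit.{u+1} ⥤ B} {c : C ⥤ A}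
    {π : C ⥤ Discrete PUnit.{u+1}} {γ : c ⋙ w ⟶ π ⋙ b}
    (h : IsGoodCone w (b.obj ⟨⟨⟩⟩) c (fun y ↦ γ.app y)) :
    (toSlice c π γ).IsRightAdjoint := by
  have (X : Comma w b) : Limits.HasInitial (StructuredArrow X (toSlice c π γ)) := by
    have hb {U : B} (x : U ⟶ b.obj ⟨⟨⟩⟩) (f : (⟨⟨⟩⟩ : Discrete PUnit.{u + 1}) ⟶ ⟨⟨⟩⟩) :
        x ≫ b.map f = x := by
      rw [Subsingleton.elim f (𝟙 _), b.map_id, Category.comp_id]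
    obtain ⟨y, k, hk, hk'⟩ := h.2 X.left X.hom
    let i : StructuredArrow X (toSlice c π γ) :=
      StructuredArrow.mk (Y := y) (⟨k, ⟨⟨Subsingleton.elim _ _⟩⟩,
        hk.trans (hb X.hom _).symm⟩ : X ⟶ (toSlice c π γ).obj y)
    have : ∀ Z, Nonempty (Unique (i ⟶ Z)) := fun Z ↦ by
      obtain ⟨m, hm, hm'⟩ := hk' Z.right Z.hom.left (by
        refine Eq.trans ?_ (hb X.hom Z.hom.right)
        exact Z.hom.w)
      refine ⟨⟨⟨StructuredArrow.homMk m ?_⟩, fun f ↦ ?_⟩⟩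
      · exact CommaMorphism.ext hm (Subsingleton.elim (α := ULift (PLift _)) _ _)
      · ext
        exact hm' _ (congrArg (·.left) (StructuredArrow.w f))
    have := fun Z ↦ (this Z).some
    exact Limits.hasInitial_of_unique i
  exact isRightAdjointOfStructuredArrowInitials _
end cones

/-! ### Homotopy exact squares -/

section exactness
variable (D : Prederivator.{u, v, w}) {A B C C' E : Cat.{u, u}}

lemma resCell_precomp (r : C ⟶ C') {p : C' ⟶ A} {w : A ⟶ B} {q : C' ⟶ E} {x : E ⟶ B}
    (α : p ≫ w ⟶ q ≫ x) (Y : D.obj (op B)) :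
    (D.resCell (p := r ≫ p) (q := r ≫ q) (r ◁ α)).app Y =
      (D.resComp r p).hom.app ((D.res w).obj Y) ≫ (D.res r).map ((D.resCell α).app Y) ≫
        (D.resComp r q).inv.app ((D.res x).obj Y) := by
  have e₁ := D.resComp_assoc r p w Y
  have e₂ := D.resComp_assoc r q x Y
  have h := D.resMap_whiskerLeft r α Y
  simp only [resCell_app]
  erw [h]
  rw [← cancel_epi ((D.resComp (r ≫ p) w).hom.app Y),
    ← cancel_mono ((D.resComp r q).hom.app ((D.res x).obj Y))]
  simp only [Category.assoc, Functor.map_comp]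
  rw [e₂, reassoc_of% e₁]
  simp only [Iso.hom_inv_id_app_assoc, Iso.inv_hom_id_app_assoc, Iso.inv_hom_id_app]
  rw [← Functor.map_comp_assoc, Iso.hom_inv_id_app]
  simp

instance resMap_isIso {w w' : A ⟶ B} (α : w ⟶ w') [IsIso α] (Y : D.obj (op B)) :
    IsIso ((D.resMap α).app Y) := by
  refine ⟨(D.resMap (inv α)).app Y, ?_, ?_⟩
  · rw [← NatTrans.comp_app, ← resMap_comp, IsIso.hom_inv_id, resMap_id]
    rfl
  · rw [← NatTrans.comp_app, ← resMap_comp, IsIso.inv_hom_id, resMap_id]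
    rfl

lemma isIso_of_pt {f g : A ⟶ pt.{u}} (α : f ⟶ g) : IsIso α := by
  let β : g.toFunctor ⟶ f.toFunctor :=
    { app x := ⟨⟨Subsingleton.elim (α := PUnit) _ _⟩⟩
      naturality _ _ _ := Subsingleton.elim (α := ULift (PLift _)) _ _ }
  exact ⟨β.toCatHom₂, by ext x; exact Subsingleton.elim (α := ULift (PLift _)) _ _,
    by ext x; exact Subsingleton.elim (α := ULift (PLift _)) _ _⟩

/-- Right adjoint functors are homotopy final. -/
lemma isLan_final_iff (r : C ⟶ C') [hr : r.toFunctor.IsRightAdjoint] (π : C' ⟶ pt)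
    {Z : D.obj (op C')} {V : D.obj (op pt)} (θ : Z ⟶ (D.res π).obj V) :
    IsLan (D.res π ⋙ D.res r) ((D.res r).map θ) ↔ IsLan (D.res π) θ := by
  obtain ⟨l, ⟨adj⟩⟩ := hr
  let a : 𝟙 C' ⟶ l.toCatHom ≫ r := adj.unit.toCatHom₂
  let b : r ≫ l.toCatHom ⟶ 𝟙 C := adj.counit.toCatHom₂
  let adj' : D.res r ⊣ D.res l.toCatHom := D.resAdj a b
    (by ext x; exact adj.right_triangle_components x)
    (by ext x; exact adj.left_triangle_components x)
  -- Every 2-cell between functors to `e` is invertible. So the unit of the adjunction between `r^*`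
  -- and `l^*` is invertible on objects pulled back from `e`, and transposing along this adjunction
  -- compares the two universal properties.
  have ha : IsIso (a ▷ π) := isIso_of_pt _
  have hu (V) : IsIso (adj'.unit.app ((D.res π).obj V)) := by
    change IsIso ((D.resId C').inv.app _ ≫ (D.resMap a).app _ ≫ (D.resComp l.toCatHom r).hom.app _)
    rw [resMap_app_res]
    have : IsIso ((D.resMap (a ▷ π)).app V) := D.resMap_isIso _ V
    exact IsIso.comp_isIso' inferInstance (IsIso.comp_isIso' (IsIso.comp_isIso' inferInstance
      (IsIso.comp_isIso' this inferInstance)) ((D.resComp _ r).app _).isIso_hom)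
  let τ : D.res π ≅ D.res π ⋙ D.res r ⋙ D.res l.toCatHom :=
    NatIso.ofComponents (fun V ↦ @asIso _ _ _ _ _ (hu V)) (fun f ↦ adj'.unit.naturality _)
  have e : θ ≫ τ.hom.app V = adj'.unit.app Z ≫ (D.res l.toCatHom).map ((D.res r).map θ) :=
    adj'.unit.naturality θ
  constructor
  · intro h
    refine .of_natIso' τ ?_
    rw [e]
    exact (isLan_unit adj' Z).comp h
  · intro h
    refine (isLan_unit adj' Z).of_comp ?_
    have h' := h.of_natIso τ
    rw [e] at h'
    exact h'

lemma isLan_precomp {w : A ⟶ B} {p : C' ⟶ A} {π : C' ⟶ pt} {b : pt ⟶ B} (α : p ≫ w ⟶ π ≫ b)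
    {r : C ⟶ C'} [this : r.toFunctor.IsRightAdjoint] {Z : D.obj (op A)} {Y : D.obj (op B)}
    {η : Z ⟶ (D.res w).obj Y} (h : IsLan (D.res π) ((D.res p).map η ≫ (D.resCell α).app Y)) :
    IsLan (D.res (r ≫ π)) ((D.res (r ≫ p)).map η ≫
      (D.resCell (p := r ≫ p) (q := r ≫ π) (r ◁ α)).app Y) := by
  have h' := ((D.isLan_final_iff r π _).2 h).of_natIso (D.resComp r π).symm
  have h'' := h'.comp_iso_left (Z' := (D.res (r ≫ p)).obj Z) (((D.resComp r p).app Z).hom)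
  have e := (D.resComp r p).hom.naturality η
  dsimp only [Functor.comp_map] at e
  rw [resCell_precomp, reassoc_of% e]
  simpa using h''

/-- Pasting of 2-cells. -/
lemma res_map_resCell {p : C ⟶ A} {w : A ⟶ B} {q : C ⟶ E} {x : E ⟶ B} (α : p ≫ w ⟶ q ≫ x)
    {F : Cat.{u, u}} {c : C' ⟶ C} {π : C' ⟶ F} {e : F ⟶ E} (γ : c ≫ q ⟶ π ≫ e)
    (Y : D.obj (op B)) :
    (D.res c).map ((D.resCell α).app Y) ≫ (D.resCell γ).app ((D.res x).obj Y) =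
      (D.resComp c p).inv.app ((D.res w).obj Y) ≫
        (D.resCell (p := c ≫ p) (x := e ≫ x) (c ◁ α ≫ γ ▷ x)).app Y ≫
          (D.res π).map ((D.resComp e x).hom.app Y) := by
  have h₁ := D.res_map_resComp_inv c p w Y
  have h₂ := D.res_map_resComp_hom c q x Y
  have h₃ := D.res_map_resMap c α Y
  have h₄ := D.resMap_app_res γ x Y
  have h₅ := D.resComp_assoc π e x Y
  have h₆ := congrArg (fun z ↦ z.app Y) (D.resMap_comp (c ◁ α) (γ ▷ x))
  simp only [NatTrans.comp_app] at h₆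
  simp only [resCell_app, Functor.map_comp, Category.assoc]
  rw [h₁, h₂, h₃, h₄, ← h₅]
  erw [h₆]
  simp

variable [D.IsDerivator]

/-- (Der4) is the exactness of the comma square, and homotopy finality of right adjoints allows the
slice to be replaced by any good cone. -/
lemma isLan_slice {w : A ⟶ B} {Z : D.obj (op A)} {Y : D.obj (op B)} {η : Z ⟶ (D.res w).obj Y}
    (hη : IsLan (D.res w) η) {b : pt ⟶ B} {c : C ⟶ A} {π : C ⟶ pt} (γ : c ≫ w ⟶ π ≫ b)
    (h : IsGoodCone w.toFunctor (b.toFunctor.obj ⟨⟨⟩⟩) c.toFunctor (fun y ↦ γ.toNatTrans.app y)) :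
    IsLan (D.res π) ((D.res c).map η ≫ (D.resCell γ).app Y) := by
  -- (Der4) speaks of the functors `const b₀`; every functor from `e` is equal to one of them.
  obtain ⟨b₀, rfl⟩ : ∃ b₀, b = const b₀ :=
    ⟨b.toFunctor.obj ⟨⟨⟩⟩, congrArg Functor.toCatHom (CategoryTheory.Functor.ext (fun _ ↦ rfl) (fun p q f ↦ by
      obtain ⟨⟨⟩⟩ := p
      obtain ⟨⟨⟩⟩ := q
      have hf : f = 𝟙 _ := Subsingleton.elim (α := ULift (PLift _)) _ _
      subst hf
      exact (b.toFunctor.map_id _).trans (by change 𝟙 _ = 𝟙 _ ≫ 𝟙 _ ≫ 𝟙 _; simp)))⟩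
  let r : C ⟶ Cat.of (Comma w.toFunctor (Functor.fromPUnit.{u} b₀)) :=
    (toSlice c.toFunctor π.toFunctor γ.toNatTrans).toCatHom
  have : r.toFunctor.IsRightAdjoint := h.isRightAdjoint
  let α : (Comma.fst w.toFunctor (Functor.fromPUnit.{u} b₀)).toCatHom ≫ w ⟶
      (Comma.snd w.toFunctor (Functor.fromPUnit.{u} b₀)).toCatHom ≫ const b₀ :=
    (Comma.natTrans w.toFunctor (Functor.fromPUnit.{u} b₀)).toCatHom₂
  have h₁ : IsLan (D.res (Comma.snd w.toFunctor (Functor.fromPUnit.{u} b₀)).toCatHom)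
      ((D.res (Comma.fst w.toFunctor (Functor.fromPUnit.{u} b₀)).toCatHom).map η ≫
        (D.resCell α).app Y) := by
    refine hη.map_comp_app (Adjunction.ofIsRightAdjoint _) (Adjunction.ofIsRightAdjoint _) _
      fun Z ↦ ?_
    have := IsDerivator.der4_left (D := D) w b₀ (Adjunction.ofIsRightAdjoint _)
      (Adjunction.ofIsRightAdjoint _)
    exact @NatIso.isIso_app_of_isIso _ _ _ _ _ _ _ this Z
  have h₂ := (D.isLan_final_iff r (Comma.snd w.toFunctor (Functor.fromPUnit.{u} b₀)).toCatHom _).2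
    h₁
  exact D.isLan_precomp α (this := this) h₁

/-- The comparison of `η` with the unit is invertible at every object, by `isLan_slice` for the unit
and uniqueness of universal arrows; so (Der2) applies. -/
lemma isLan_of_slice {w : A ⟶ B} {Z : D.obj (op A)} {Y : D.obj (op B)} {η : Z ⟶ (D.res w).obj Y}
    (h : ∀ b : pt ⟶ B, ∃ (C : Cat.{u, u}) (c : C ⟶ A) (π : C ⟶ pt) (γ : c ≫ w ⟶ π ≫ b),
      IsGoodCone w.toFunctor (b.toFunctor.obj ⟨⟨⟩⟩) c.toFunctor (fun y ↦ γ.toNatTrans.app y) ∧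
      IsLan (D.res π) ((D.res c).map η ≫ (D.resCell γ).app Y)) :
    IsLan (D.res w) η := by
  let adj := Adjunction.ofIsRightAdjoint (D.res w)
  obtain ⟨f, hf⟩ := ((isLan_unit adj Z) Y).2 η
  dsimp only at hf
  subst hf
  have : IsIso f := IsDerivator.der2 B f fun b ↦ by
    obtain ⟨C, c, π, γ, hγ, hγ'⟩ := h (const b)
    refine (D.isLan_slice (isLan_unit adj Z) γ hγ).isIso ?_
    have e := (D.resCell γ).naturality f
    rw [Category.assoc]
    dsimp at e
    rw [← e, ← Category.assoc, ← Functor.map_comp]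
    exact hγ'
  exact (isLan_unit adj Z).comp_map f

/-- A square all of whose induced functors between slices are homotopy final is homotopy exact. -/
lemma isLan_of_square {p : C ⟶ A} {w : A ⟶ B} {q : C ⟶ E} {x : E ⟶ B} (α : p ≫ w ⟶ q ≫ x)
    (h : ∀ e : pt ⟶ E, ∃ (C' : Cat.{u, u}) (c : C' ⟶ C) (π : C' ⟶ pt) (γ : c ≫ q ⟶ π ≫ e),
      IsGoodCone q.toFunctor (e.toFunctor.obj ⟨⟨⟩⟩) c.toFunctor (fun y ↦ γ.toNatTrans.app y) ∧
      IsGoodCone w.toFunctor (x.toFunctor.obj (e.toFunctor.obj ⟨⟨⟩⟩)) (c ≫ p).toFunctor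
        (fun y ↦ (c ◁ α ≫ γ ▷ x).toNatTrans.app y))
    {Z : D.obj (op A)} {Y : D.obj (op B)} {η : Z ⟶ (D.res w).obj Y} (hη : IsLan (D.res w) η) :
    IsLan (D.res q) ((D.res p).map η ≫ (D.resCell α).app Y) := by
  -- At an object `e`, the slice square of `q` pasted with `α` is a slice square of `w` at `x e`,
  -- because the same `C'` is a good cone for both.
  refine D.isLan_of_slice fun e ↦ ?_
  obtain ⟨C', c, π, γ, h₁, h₂⟩ := h e
  refine ⟨C', c, π, γ, h₁, ?_⟩
  let δ : (c ≫ p) ≫ w ⟶ π ≫ e ≫ x := c ◁ α ≫ γ ▷ x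
  have h₃ : IsLan (D.res π) ((D.res (c ≫ p)).map η ≫ (D.resCell δ).app Y) := D.isLan_slice hη δ h₂
  have h₄ := (h₃.comp_map ((D.resComp e x).hom.app Y)).comp_iso_left
    ((D.resComp c p).inv.app Z)
  have e₁ := (D.resComp c p).inv.naturality η
  have e₂ := D.res_map_resCell α γ Y
  dsimp only [Functor.comp_map] at e₁
  rw [Functor.map_comp, Category.assoc, e₂, reassoc_of% e₁]
  simpa using h₄
end exactness
-- Pseudonatural transformations and modifications through their components
section objectwise
variable {B : Type*} [Bicategory B] {F G H : Pseudofunctor B Cat.{v, w}}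

/-- The components of the naturality constraint of a pseudonatural transformation. -/
def natCell (η : F ⟶ G) {a b : B} (f : a ⟶ b) (X : F.obj a) :
    (η.app b).toFunctor.obj ((F.map f).toFunctor.obj X) ≅
      (G.map f).toFunctor.obj ((η.app a).toFunctor.obj X) :=
  (Cat.Hom.toNatIso (η.naturality f)).app X

section natCell
variable (η : F ⟶ G) {a b c : B}

lemma natCell_natural (f : a ⟶ b) {X Y : F.obj a} (g : X ⟶ Y) :
    (η.app b).toFunctor.map ((F.map f).toFunctor.map g) ≫ (natCell η f Y).hom =
      (natCell η f X).hom ≫ (G.map f).toFunctor.map ((η.app a).toFunctor.map g) :=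
  (η.naturality f).hom.toNatTrans.naturality g

lemma natCell_map₂ {f g : a ⟶ b} (β : f ⟶ g) (X : F.obj a) :
    (η.app b).toFunctor.map ((F.map₂ β).toNatTrans.app X) ≫ (natCell η g X).hom =
      (natCell η f X).hom ≫ (G.map₂ β).toNatTrans.app ((η.app a).toFunctor.obj X) :=
  congrArg (fun z ↦ z.toNatTrans.app X) (η.naturality_naturality β)

lemma natCell_id (X : F.obj a) :
    (natCell η (𝟙 a) X).hom ≫ (G.mapId a).hom.toNatTrans.app ((η.app a).toFunctor.obj X) =
      (η.app a).toFunctor.map ((F.mapId a).hom.toNatTrans.app X) := by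
  have h := congrArg (fun z ↦ z.toNatTrans.app X) (η.naturality_id a)
  simp only [Cat.Hom.toNatTrans_comp, NatTrans.comp_app, Cat.whiskerLeft_app, Cat.whiskerRight_app,
    Cat.leftUnitor_hom_toNatTrans, Cat.rightUnitor_inv_toNatTrans, Functor.leftUnitor_hom_app,
    Functor.rightUnitor_inv_app] at h
  exact h.trans ((congrArg (fun z ↦ _ ≫ z) (Category.comp_id _)).trans (Category.comp_id _))

lemma natCell_comp (f : a ⟶ b) (g : b ⟶ c) (X : F.obj a) :
    (natCell η (f ≫ g) X).hom ≫
        (G.mapComp f g).hom.toNatTrans.app ((η.app a).toFunctor.obj X) =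
      (η.app c).toFunctor.map ((F.mapComp f g).hom.toNatTrans.app X) ≫
        (natCell η g ((F.map f).toFunctor.obj X)).hom ≫
          (G.map g).toFunctor.map (natCell η f X).hom := by
  have h := congrArg (fun z ↦ z.toNatTrans.app X) (η.naturality_comp f g)
  simp only [Cat.Hom.toNatTrans_comp, NatTrans.comp_app, Cat.whiskerLeft_app, Cat.whiskerRight_app,
    Cat.associator_hom_toNatTrans, Cat.associator_inv_toNatTrans, Functor.associator_hom_app,
    Functor.associator_inv_app] at h
  erw [Category.id_comp, Category.id_comp, Category.comp_id] at h
  exact h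
lemma natCell_inv_natural (f : a ⟶ b) {X Y : F.obj a} (g : X ⟶ Y) :
    (natCell η f X).inv ≫ (η.app b).toFunctor.map ((F.map f).toFunctor.map g) =
      (G.map f).toFunctor.map ((η.app a).toFunctor.map g) ≫ (natCell η f Y).inv := by
  rw [Iso.inv_comp_eq, ← Category.assoc, Iso.eq_comp_inv]
  exact natCell_natural η f g

lemma natCell_inv_map₂ {f g : a ⟶ b} (β : f ⟶ g) (X : F.obj a) :
    (natCell η f X).inv ≫ (η.app b).toFunctor.map ((F.map₂ β).toNatTrans.app X) =
      (G.map₂ β).toNatTrans.app ((η.app a).toFunctor.obj X) ≫ (natCell η g X).inv := by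
  rw [Iso.inv_comp_eq, ← Category.assoc, Iso.eq_comp_inv]
  exact natCell_map₂ η β X

lemma natCell_inv_id (X : F.obj a) :
    (natCell η (𝟙 a) X).inv ≫ (η.app a).toFunctor.map ((F.mapId a).hom.toNatTrans.app X) =
      (G.mapId a).hom.toNatTrans.app ((η.app a).toFunctor.obj X) := by
  rw [Iso.inv_comp_eq]
  exact (natCell_id η X).symm

lemma natCell_inv_comp (f : a ⟶ b) (g : b ⟶ c) (X : F.obj a) :
    (natCell η (f ≫ g) X).inv ≫ (η.app c).toFunctor.map ((F.mapComp f g).hom.toNatTrans.app X) =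
      (G.mapComp f g).hom.toNatTrans.app ((η.app a).toFunctor.obj X) ≫
        (G.map g).toFunctor.map (natCell η f X).inv ≫
          (natCell η g ((F.map f).toFunctor.obj X)).inv := by
  have h := natCell_comp η f g X
  rw [Iso.inv_comp_eq, ← Category.assoc]
  erw [h]
  rw [Category.assoc, Category.assoc, ← Functor.map_comp_assoc]
  simp
end natCell

/-- A pseudonatural transformation given by its components. -/
def strongTransMk (app : ∀ a, F.obj a ⟶ G.obj a)
    (cell : ∀ {a b : B} (f : a ⟶ b) (X : F.obj a),
      (app b).toFunctor.obj ((F.map f).toFunctor.obj X) ≅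
      (G.map f).toFunctor.obj ((app a).toFunctor.obj X))
    (h₁ : ∀ {a b : B} (f : a ⟶ b) {X Y : F.obj a} (g : X ⟶ Y),
      (app b).toFunctor.map ((F.map f).toFunctor.map g) ≫ (cell f Y).hom =
      (cell f X).hom ≫ (G.map f).toFunctor.map ((app a).toFunctor.map g))
    (h₂ : ∀ {a b : B} {f g : a ⟶ b} (β : f ⟶ g) (X : F.obj a),
      (app b).toFunctor.map ((F.map₂ β).toNatTrans.app X) ≫ (cell g X).hom =
      (cell f X).hom ≫ (G.map₂ β).toNatTrans.app ((app a).toFunctor.obj X))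
    (h₃ : ∀ {a : B} (X : F.obj a),
      (cell (𝟙 a) X).hom ≫ (G.mapId a).hom.toNatTrans.app ((app a).toFunctor.obj X) =
      (app a).toFunctor.map ((F.mapId a).hom.toNatTrans.app X))
    (h₄ : ∀ {a b c : B} (f : a ⟶ b) (g : b ⟶ c) (X : F.obj a),
      (cell (f ≫ g) X).hom ≫
        (G.mapComp f g).hom.toNatTrans.app ((app a).toFunctor.obj X) =
      (app c).toFunctor.map ((F.mapComp f g).hom.toNatTrans.app X) ≫
        (cell g ((F.map f).toFunctor.obj X)).hom ≫
          (G.map g).toFunctor.map (cell f X).hom) : F ⟶ G where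
  app := app
  naturality f := Cat.Hom.isoMk (NatIso.ofComponents (cell f) (h₁ f))
  naturality_naturality β := by
    ext X
    exact h₂ β X
  naturality_id a := by
    ext X
    have h := h₃ X
    simp
    exact h
  naturality_comp f g := by
    ext X
    have h := h₄ f g X
    simp
    exact h

/-- A modification given by its components. -/
def modMk {η θ : F ⟶ G} (app : ∀ (a : B) (X : F.obj a), (η.app a).toFunctor.obj X ⟶
      (θ.app a).toFunctor.obj X)
    (h₁ : ∀ {a : B} {X Y : F.obj a} (g : X ⟶ Y),
      (η.app a).toFunctor.map g ≫ app a Y = app a X ≫ (θ.app a).toFunctor.map g)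
    (h₂ : ∀ {a b : B} (f : a ⟶ b) (X : F.obj a),
      app b ((F.map f).toFunctor.obj X) ≫ (natCell θ f X).hom =
        (natCell η f X).hom ≫ (G.map f).toFunctor.map (app a X)) : η ⟶ θ :=
  ⟨{ app a := NatTrans.toCatHom₂ { app := app a, naturality := fun _ _ g ↦ h₁ g }
     naturality f := by
      ext X
      exact h₂ f X }⟩

/-- A modification all of whose components are invertible is invertible. -/
lemma isIso_modMk {η θ : F ⟶ G} (Γ : η ⟶ θ)
    (h : ∀ (a : B) (X : F.obj a), IsIso ((Γ.as.app a).toNatTrans.app X)) : Nonempty (η ≅ θ) := by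
  have h' (a : B) : IsIso (Γ.as.app a).toNatTrans :=
    @NatIso.isIso_of_isIso_app _ _ _ _ _ _ _ (h a)
  exact ⟨Pseudofunctor.StrongTrans.isoMk
    (fun a ↦ Cat.Hom.isoMk (@asIso _ _ _ _ (Γ.as.app a).toNatTrans (h' a)))
    (fun f ↦ Γ.as.naturality f)⟩

lemma natCell_comp_hom (η : F ⟶ G) (θ : G ⟶ H) {a b : B} (f : a ⟶ b) (X : F.obj a) :
    (natCell (η ≫ θ) f X).hom = (θ.app b).toFunctor.map (natCell η f X).hom ≫
      (natCell θ f ((η.app a).toFunctor.obj X)).hom := by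
  have e : (natCell (η ≫ θ) f X).hom = 𝟙 _ ≫ (θ.app b).toFunctor.map (natCell η f X).hom ≫ 𝟙 _ ≫
      (natCell θ f ((η.app a).toFunctor.obj X)).hom ≫ 𝟙 _ := rfl
  rw [e]
  erw [Category.id_comp, Category.id_comp, Category.comp_id]

lemma natCell_id_hom {a b : B} (f : a ⟶ b) (X : F.obj a) :
    (natCell (𝟙 F) f X).hom = 𝟙 _ := by
  have e : (natCell (𝟙 F) f X).hom = 𝟙 ((F.map f).toFunctor.obj X) ≫ 𝟙 _ := rfl
  rw [e, Category.comp_id]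
  rfl

section leftAdjoint
variable (η : F ⟶ G) {L : ∀ a, G.obj a ⥤ F.obj a} (adj : ∀ a, L a ⊣ (η.app a).toFunctor)
  {a b c : B}

/-- The arrow adjoint to the naturality constraint of the objectwise left adjoints. -/
def unitCell (f : a ⟶ b) (Z : G.obj a) : (G.map f).toFunctor.obj Z ⟶
    (η.app b).toFunctor.obj ((F.map f).toFunctor.obj ((L a).obj Z)) :=
  (G.map f).toFunctor.map ((adj a).unit.app Z) ≫ (natCell η f ((L a).obj Z)).inv

/-- The mate of the naturality constraint. -/
def lanCell (f : a ⟶ b) (Z : G.obj a) :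
    (L b).obj ((G.map f).toFunctor.obj Z) ⟶ (F.map f).toFunctor.obj ((L a).obj Z) :=
  ((adj b).homEquiv _ _).symm (unitCell η adj f Z)

lemma unit_lanCell (f : a ⟶ b) (Z : G.obj a) :
    (adj b).unit.app _ ≫ (η.app b).toFunctor.map (lanCell η adj f Z) = unitCell η adj f Z :=
  (Adjunction.homEquiv_unit (adj b) _ _ _).symm.trans (((adj b).homEquiv _ _).apply_symm_apply _)

lemma unit_lanCell_assoc (f : a ⟶ b) (Z : G.obj a) {W : G.obj b}
    (h : (η.app b).toFunctor.obj ((F.map f).toFunctor.obj ((L a).obj Z)) ⟶ W) :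
    (adj b).unit.app _ ≫ (η.app b).toFunctor.map (lanCell η adj f Z) ≫ h =
      unitCell η adj f Z ≫ h := by
  rw [← unit_lanCell η adj f Z]
  exact (Category.assoc _ _ _).symm

lemma unit_map (Z Z' : G.obj a) (g : Z ⟶ Z') : (adj a).unit.app Z ≫
    (η.app a).toFunctor.map ((L a).map g) = g ≫ (adj a).unit.app Z' :=
  ((adj a).unit.naturality g).symm

lemma unit_map_assoc (Z Z' : G.obj a) (g : Z ⟶ Z') {W : G.obj a}
    (h : (η.app a).toFunctor.obj ((L a).obj Z') ⟶ W) :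
    (adj a).unit.app Z ≫ (η.app a).toFunctor.map ((L a).map g) ≫ h =
      g ≫ (adj a).unit.app Z' ≫ h := by
  have e := unit_map η adj Z Z' g =≫ h
  exact (Category.assoc _ _ _).symm.trans (e.trans (Category.assoc _ _ _))

include adj in
lemma hom_ext_of_unit {Z : G.obj a} {X : F.obj a} {g g' : (L a).obj Z ⟶ X}
    (h : (adj a).unit.app Z ≫ (η.app a).toFunctor.map g =
      (adj a).unit.app Z ≫ (η.app a).toFunctor.map g') : g = g' :=
  (isLan_unit (adj a) Z X).1 h

variable {η} {adj}

lemma isIso_lanCell {f : a ⟶ b} {Z : G.obj a}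
    (h : IsLan (η.app b).toFunctor (unitCell η adj f Z)) : IsIso (lanCell η adj f Z) := by
  refine (isLan_unit (adj b) _).isIso ?_
  have e := unit_lanCell η adj f Z
  dsimp only [Functor.id_obj] at e ⊢
  rw [e]
  exact h

variable (η adj)

/-- Here and in the next four coherence laws both sides are maps out of a value of a left adjoint.
They may be compared after the unit, where `lanCell` turns into `unitCell` and the corresponding law
for `η` applies. -/
lemma lanCell_natural (f : a ⟶ b) {Z Z' : G.obj a} (g : Z ⟶ Z') :
    (L b).map ((G.map f).toFunctor.map g) ≫ lanCell η adj f Z' =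
      lanCell η adj f Z ≫ (F.map f).toFunctor.map ((L a).map g) := by
  refine hom_ext_of_unit η adj ?_
  have e₁ := unit_map_assoc η adj _ _ ((G.map f).toFunctor.map g)
    ((η.app b).toFunctor.map (lanCell η adj f Z'))
  have e₂ := unit_lanCell_assoc η adj f Z
    ((η.app b).toFunctor.map ((F.map f).toFunctor.map ((L a).map g)))
  have e₃ := natCell_inv_natural η f ((L a).map g)
  have e₄ := unit_map η adj _ _ g
  rw [Functor.map_comp, Functor.map_comp]
  erw [e₁, e₂]
  rw [unit_lanCell]
  simp only [unitCell, Category.assoc]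
  rw [e₃, ← Functor.map_comp_assoc, ← Functor.map_comp_assoc, e₄]

lemma lanCell_map₂ {f g : a ⟶ b} (β : f ⟶ g) (Z : G.obj a) :
    (L b).map ((G.map₂ β).toNatTrans.app Z) ≫ lanCell η adj g Z =
      lanCell η adj f Z ≫ (F.map₂ β).toNatTrans.app ((L a).obj Z) := by
  refine hom_ext_of_unit η adj ?_
  have e₁ := unit_map_assoc η adj _ _ ((G.map₂ β).toNatTrans.app Z)
    ((η.app b).toFunctor.map (lanCell η adj g Z))
  have e₂ := unit_lanCell_assoc η adj f Z
    ((η.app b).toFunctor.map ((F.map₂ β).toNatTrans.app ((L a).obj Z)))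
  have e₃ := natCell_inv_map₂ η β ((L a).obj Z)
  have e₄ := (G.map₂ β).toNatTrans.naturality ((adj a).unit.app Z)
  rw [Functor.map_comp, Functor.map_comp]
  erw [e₁, e₂]
  rw [unit_lanCell]
  simp only [unitCell, Category.assoc]
  rw [e₃]
  erw [reassoc_of% e₄]

lemma lanCell_id (Z : G.obj a) :
    lanCell η adj (𝟙 a) Z ≫ (F.mapId a).hom.toNatTrans.app ((L a).obj Z) =
      (L a).map ((G.mapId a).hom.toNatTrans.app Z) := by
  refine hom_ext_of_unit η adj ?_
  have e₁ := unit_map η adj _ _ ((G.mapId a).hom.toNatTrans.app Z)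
  have e₂ := unit_lanCell_assoc η adj (𝟙 a) Z
    ((η.app a).toFunctor.map ((F.mapId a).hom.toNatTrans.app ((L a).obj Z)))
  have e₃ := natCell_inv_id η ((L a).obj Z)
  have e₄ := (G.mapId a).hom.toNatTrans.naturality ((adj a).unit.app Z)
  rw [Functor.map_comp]
  erw [e₁, e₂]
  simp only [unitCell, Category.assoc]
  erw [e₃]
  exact e₄

lemma lanCell_comp (f : a ⟶ b) (g : b ⟶ c) (Z : G.obj a) :
    lanCell η adj (f ≫ g) Z ≫ (F.mapComp f g).hom.toNatTrans.app ((L a).obj Z) =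
      (L c).map ((G.mapComp f g).hom.toNatTrans.app Z) ≫
        lanCell η adj g ((G.map f).toFunctor.obj Z) ≫
          (F.map g).toFunctor.map (lanCell η adj f Z) := by
  refine hom_ext_of_unit η adj ?_
  have e₁ := unit_map_assoc η adj _ _ ((G.mapComp f g).hom.toNatTrans.app Z)
    ((η.app c).toFunctor.map (lanCell η adj g ((G.map f).toFunctor.obj Z)) ≫
      (η.app c).toFunctor.map ((F.map g).toFunctor.map (lanCell η adj f Z)))
  have e₂ := unit_lanCell_assoc η adj (f ≫ g) Z
    ((η.app c).toFunctor.map ((F.mapComp f g).hom.toNatTrans.app ((L a).obj Z)))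
  have e₃ := natCell_inv_comp η f g ((L a).obj Z)
  have e₄ := (G.mapComp f g).hom.toNatTrans.naturality ((adj a).unit.app Z)
  have e₅ := unit_lanCell_assoc η adj g ((G.map f).toFunctor.obj Z)
    ((η.app c).toFunctor.map ((F.map g).toFunctor.map (lanCell η adj f Z)))
  have e₆ := natCell_inv_natural η g (lanCell η adj f Z)
  have e₇ := congrArg (G.map g).toFunctor.map (unit_lanCell η adj f Z)
  rw [Functor.map_comp] at e₇
  rw [Functor.map_comp, Functor.map_comp, Functor.map_comp]
  erw [e₁, e₂, e₅]
  simp only [unitCell, Category.assoc]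
  erw [e₃, e₆, reassoc_of% e₇, reassoc_of% e₄]
  simp only [unitCell, Functor.map_comp, Category.assoc]
  rfl

lemma lanCell_counit (f : a ⟶ b) (X : F.obj a) :
    (L b).map (natCell η f X).hom ≫ lanCell η adj f ((η.app a).toFunctor.obj X) ≫
      (F.map f).toFunctor.map ((adj a).counit.app X) = (adj b).counit.app _ := by
  refine hom_ext_of_unit η adj ?_
  have e₁ := unit_map_assoc η adj _ _ (natCell η f X).hom
    ((η.app b).toFunctor.map (lanCell η adj f ((η.app a).toFunctor.obj X)) ≫
      (η.app b).toFunctor.map ((F.map f).toFunctor.map ((adj a).counit.app X)))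
  have e₂ := unit_lanCell_assoc η adj f ((η.app a).toFunctor.obj X)
    ((η.app b).toFunctor.map ((F.map f).toFunctor.map ((adj a).counit.app X)))
  have e₃ := natCell_inv_natural η f ((adj a).counit.app X)
  have e₄ := congrArg (G.map f).toFunctor.map ((adj a).right_triangle_components X)
  rw [Functor.map_comp] at e₄
  rw [(adj b).right_triangle_components, Functor.map_comp, Functor.map_comp, e₁, e₂]
  simp only [unitCell, Category.assoc]
  erw [e₃, reassoc_of% e₄]
  simp

/-- The objectwise left adjoints of a pseudonatural transformation, if they are compatible with
restrictions, form a pseudonatural transformation. -/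
noncomputable def lanTrans (h : ∀ {a b : B} (f : a ⟶ b) (Z : G.obj a),
    IsLan (η.app b).toFunctor (unitCell η adj f Z)) : G ⟶ F :=
  strongTransMk (fun a ↦ (L a).toCatHom)
    (fun f Z ↦ @asIso _ _ _ _ (lanCell η adj f Z) (isIso_lanCell (h f Z)))
    (fun f _ _ g ↦ lanCell_natural η adj f g) (fun β Z ↦ lanCell_map₂ η adj β Z)
    (fun Z ↦ lanCell_id η adj Z) (fun f g Z ↦ lanCell_comp η adj f g Z)

lemma natCell_lanTrans_hom (h : ∀ {a b : B} (f : a ⟶ b) (Z : G.obj a),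
    IsLan (η.app b).toFunctor (unitCell η adj f Z)) (f : a ⟶ b) (Z : G.obj a) :
    (natCell (lanTrans η adj h) f Z).hom = lanCell η adj f Z := rfl

/-- The objectwise adjunctions form an adjunction of pseudonatural transformations. -/
noncomputable def lanTransAdj (h : ∀ {a b : B} (f : a ⟶ b) (Z : G.obj a),
    IsLan (η.app b).toFunctor (unitCell η adj f Z)) :
    Bicategory.Adjunction (lanTrans η adj h) η where
  unit := modMk (fun a Z ↦ (adj a).unit.app Z) (fun {a} {_ _} g ↦ (adj a).unit.naturality g)
    (fun {a b} f Z ↦ by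
      have e₂ := unit_lanCell_assoc η adj f Z (natCell η f ((L a).obj Z)).hom
      rw [natCell_comp_hom, natCell_id_hom]
      erw [Category.id_comp, e₂]
      simp only [unitCell, Category.assoc, Iso.inv_hom_id]
      exact Category.comp_id _)
  counit := modMk (fun a X ↦ (adj a).counit.app X) (fun {a} {_ _} g ↦ (adj a).counit.naturality g)
    (fun {a b} f X ↦ by
      rw [natCell_comp_hom, natCell_id_hom, natCell_lanTrans_hom]
      refine (Category.comp_id _).trans ((lanCell_counit η adj f X).symm.trans ?_)
      exact (Category.assoc _ _ _).symm)
  left_triangle := by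
    ext a Z
    simp [leftZigzag, bicategoricalComp]
    exact ((adj a).left_triangle_components Z).trans (Category.comp_id (𝟙 _)).symm
  right_triangle := by
    ext a Z
    simp [rightZigzag, bicategoricalComp]
    exact ((adj a).right_triangle_components Z).trans (Category.comp_id (𝟙 _)).symm
end leftAdjoint

/-- The objectwise adjunctions underlying an adjunction of pseudonatural transformations. -/
def adjApp {l : G ⟶ F} {η : F ⟶ G} (A : Bicategory.Adjunction l η) (a : B) :
    (l.app a).toFunctor ⊣ (η.app a).toFunctor where
  unit := (A.unit.as.app a).toNatTrans
  counit := (A.counit.as.app a).toNatTrans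
  left_triangle_components Z := by
    have h := congrArg (fun z ↦ (z.as.app a).toNatTrans.app Z) A.left_triangle
    simp [leftZigzag, bicategoricalComp] at h
    exact h.trans (Category.comp_id (𝟙 _))
  right_triangle_components Z := by
    have h := congrArg (fun z ↦ (z.as.app a).toNatTrans.app Z) A.right_triangle
    simp [rightZigzag, bicategoricalComp] at h
    exact h.trans (Category.comp_id (𝟙 _))

lemma isLan_of_isEquivalence {C₁ C₂ : Type*} [Category C₁] [Category C₂] (R : C₁ ⥤ C₂)
    [R.IsEquivalence] {Z : C₂} {Y : C₁} (η : Z ⟶ R.obj Y) [IsIso η] : IsLan R η := fun V ↦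
  ⟨fun a b h ↦ R.map_injective ((cancel_epi η).1 h), fun g ↦ ⟨R.preimage (inv η ≫ g), by simp⟩⟩

/-- A pseudonatural transformation that is objectwise an equivalence is an equivalence. -/
theorem exists_inverse_of_objectwise (η : F ⟶ G) (h : ∀ a, (η.app a).toFunctor.IsEquivalence) :
    ∃ θ : G ⟶ F, Nonempty (η ≫ θ ≅ 𝟙 F) ∧ Nonempty (θ ≫ η ≅ 𝟙 G) := by
  let adj : ∀ a, (η.app a).toFunctor.inv ⊣ (η.app a).toFunctor := fun a ↦
    (η.app a).toFunctor.asEquivalence.symm.toAdjunction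
  have hu (a Z) : IsIso ((adj a).unit.app Z) :=
    inferInstanceAs (IsIso ((η.app a).toFunctor.asEquivalence.symm.unit.app Z))
  have hc (a Z) : IsIso ((adj a).counit.app Z) :=
    inferInstanceAs (IsIso ((η.app a).toFunctor.asEquivalence.symm.counit.app Z))
  -- Base change is automatic for equivalences: an invertible arrow `Z ⟶ R Y` is universal when `R`
  -- is an equivalence.
  have h' : ∀ {a b : B} (f : a ⟶ b) (Z : G.obj a),
      IsLan (η.app b).toFunctor (unitCell η adj f Z) := fun {a b} f Z ↦ by
    have := hu a Z
    have : IsIso (unitCell η adj f Z) := by unfold unitCell; infer_instance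
    exact isLan_of_isEquivalence _ _
  refine ⟨lanTrans η adj h', isIso_modMk (lanTransAdj η adj h').counit hc, ?_⟩
  obtain ⟨e⟩ := isIso_modMk (lanTransAdj η adj h').unit hu
  exact ⟨e.symm⟩

end objectwise

lemma isEquiv_of_objectwise {F G : Prederivator.{u, v, w}} (η : F ⟶ G)
    (h : ∀ I, (η.app I).toFunctor.IsEquivalence) : IsEquiv η := exists_inverse_of_objectwise η h

/-! ### Existence of left Kan extension morphisms -/

section cones
variable {C A B I : Type*} [Category C] [Category A] [Category B] [Category I]

lemma IsGoodCone.congr {w : A ⥤ B} {b : B} {c : C ⥤ A} {γ γ' : ∀ y, w.obj (c.obj y) ⟶ b}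
    (h : IsGoodCone w b c γ) (e : ∀ y, γ y = γ' y) : IsGoodCone w b c γ' := by
  obtain rfl : γ = γ' := funext e
  exact h

lemma isGoodCone_comma (w : A ⥤ B) (b : B) :
    IsGoodCone w b (Comma.fst w (Functor.fromPUnit.{u} b)) (fun y ↦ y.hom) := by
  refine ⟨fun y y' f ↦ f.w.trans (Category.comp_id _), fun a g ↦
    ⟨⟨a, ⟨⟨⟩⟩, g⟩, 𝟙 _, (congrArg (fun z ↦ z ≫ g) (w.map_id a)).trans (Category.id_comp g),
      fun y' h' e ↦ ⟨⟨h', ⟨⟨Subsingleton.elim _ _⟩⟩, e.trans (Category.comp_id g).symm⟩,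
        Category.id_comp _, fun k hk ↦ ?_⟩⟩⟩
  exact CommaMorphism.ext ((Category.id_comp _).symm.trans hk)
    (Subsingleton.elim (α := ULift (PLift _)) _ _)

/-- The slice over `i` has a terminal object, so one point is cofinal. Any isomorphism `δ` is
allowed, so that the image of a point under a further functor is covered too. -/
lemma isGoodCone_id {i : I} (d : Discrete PUnit.{u + 1} ⥤ I) (δ : ∀ y, d.obj y ⟶ i)
    [hδ : ∀ y, IsIso (δ y)] : IsGoodCone (𝟭 I) i d δ := by
  have key (y y') (f : y ⟶ y') : d.map f ≫ δ y' = δ y := by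
    obtain ⟨⟨⟩⟩ := y
    obtain ⟨⟨⟩⟩ := y'
    rw [Subsingleton.elim f (𝟙 _), d.map_id, Category.id_comp]
  refine ⟨key, fun a g ↦ ⟨⟨⟨⟩⟩, g ≫ inv (δ _), by simp, fun y' h' e ↦
    ⟨⟨⟨Subsingleton.elim _ _⟩⟩, ?_, fun k _ ↦ Subsingleton.elim (α := ULift (PLift _)) _ _⟩⟩⟩
  change (g ≫ inv (δ ⟨⟨⟩⟩)) ≫ d.map _ = h'
  dsimp only [Functor.id_map] at e
  rw [← cancel_mono (δ y'), e, Category.assoc, key]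
  simp
end cones

section exact
variable (D : Prederivator.{u, v, w}) [D.IsDerivator] {A B C E : Cat.{u, u}}

/-- A square all of whose induced functors between slices are homotopy final is homotopy exact. -/
lemma isLan_of_goodCones {p : C ⟶ A} {w : A ⟶ B} {q : C ⟶ E} {x : E ⟶ B} (α : p ≫ w ⟶ q ≫ x)
    (h : ∀ e : E, ∃ (C' : Type u) (_ : Category.{u} C') (c : C' ⥤ C)
      (γ : ∀ y, q.toFunctor.obj (c.obj y) ⟶ e), IsGoodCone q.toFunctor e c γ ∧
      IsGoodCone w.toFunctor (x.toFunctor.obj e) (c ⋙ p.toFunctor)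
        (fun y ↦ α.toNatTrans.app (c.obj y) ≫ x.toFunctor.map (γ y)))
    {Z : D.obj (op A)} {Y : D.obj (op B)} {η : Z ⟶ (D.res w).obj Y} (hη : IsLan (D.res w) η) :
    IsLan (D.res q) ((D.res p).map η ≫ (D.resCell α).app Y) := by
  refine D.isLan_of_square α (fun e ↦ ?_) hη
  obtain ⟨C', _, c, γ, h₁, h₂⟩ := h (e.toFunctor.obj ⟨⟨⟩⟩)
  let π : Cat.of C' ⟶ pt.{u} := (Functor.star C').toCatHom
  let γ' : c.toCatHom ≫ q ⟶ π ≫ e := NatTrans.toCatHom₂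
    { app y := γ y
      naturality y y' f := (h₁.1 f).trans ((Category.comp_id _).symm.trans
        (congrArg (fun z ↦ γ y ≫ z) (e.toFunctor.map_id _).symm)) }
  refine ⟨Cat.of C', c.toCatHom, π, γ', h₁, h₂.congr fun y ↦ ?_⟩
  rfl

omit [D.IsDerivator] in
lemma isoMapOfCommSq_inv_app {p : C ⟶ A} {w : A ⟶ B} {q : C ⟶ E} {x : E ⟶ B}
    (sq : CommSq x.op w.op q.op p.op) (h : p ≫ w = q ≫ x) (X : D.obj (op B)) :
    (D.isoMapOfCommSq sq).inv.toNatTrans.app X = (D.resCell (eqToHom h)).app X := by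
  have e : ∀ {f g : C ⟶ B} (h : f = g), op2 (eqToHom h) = eqToHom (congrArg Quiver.Hom.op h) := by
    rintro f _ rfl
    rfl
  have h' : D.resCell (eqToHom h) = ((D.mapComp w.op p.op).inv ≫
    D.map₂ (op2 (eqToHom h)) ≫ (D.mapComp x.op q.op).hom).toNatTrans := rfl
  rw [h', e]
  simp [Pseudofunctor.isoMapOfCommSq, Pseudofunctor.mapComp']

-- The naturality constraint of `k^*` comes from a strictly commutative square of categories, which
-- makes it accessible to the exactness results for `resCell`.
omit [D.IsDerivator] in
lemma natCell_restr_inv (k : A ⟶ B) {I J : (Cat.{u, u})ᵒᵖ} (f : I ⟶ J)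
    (X : (D.shift B).obj I) : (natCell (D.restr k) f X).inv =
      (D.resCell (p := (Functor.prod (𝟭 A) f.unop.toFunctor).toCatHom)
        (w := (Functor.prod k.toFunctor (𝟭 I.unop)).toCatHom)
        (q := (Functor.prod k.toFunctor (𝟭 J.unop)).toCatHom)
        (x := (Functor.prod (𝟭 B) f.unop.toFunctor).toCatHom) (𝟙 _)).app X := by
  exact D.isoMapOfCommSq_inv_app (restr_sq k f) rfl X

/-- The square of `k × id` and `id × f` is exact. In the direction of the parameter both slices have
a terminal object, so at `(b, j)` both are computed over the slice of `k` at `b`. -/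
lemma isLan_unitCell (k : A ⟶ B) {L : ∀ I, (D.shift A).obj I ⥤ (D.shift B).obj I}
    (adj : ∀ I, L I ⊣ ((D.restr k).app I).toFunctor) {I J : (Cat.{u, u})ᵒᵖ} (f : I ⟶ J)
    (Z : (D.shift A).obj I) :
    IsLan ((D.restr k).app J).toFunctor (unitCell (D.restr k) adj f Z) := by
  unfold unitCell
  rw [natCell_restr_inv]
  let α : (Functor.prod (𝟭 A) f.unop.toFunctor).toCatHom ≫
      (Functor.prod k.toFunctor (𝟭 I.unop)).toCatHom ⟶
      (Functor.prod k.toFunctor (𝟭 J.unop)).toCatHom ≫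
      (Functor.prod (𝟭 B) f.unop.toFunctor).toCatHom := 𝟙 _
  refine D.isLan_of_goodCones α (fun e ↦ ?_) (isLan_unit (adj I) Z)
  refine ⟨_, _, Functor.prod (Comma.fst k.toFunctor (Functor.fromPUnit.{u} e.1))
    (Functor.fromPUnit.{u} e.2), fun y ↦ (y.1.hom, 𝟙 _),
    (isGoodCone_comma k.toFunctor e.1).prod (𝟭 J.unop) e.2
      (isGoodCone_id (Functor.fromPUnit.{u} e.2) (fun _ ↦ 𝟙 _)), ?_⟩
  refine ((isGoodCone_comma k.toFunctor e.1).prod (𝟭 I.unop) (f.unop.toFunctor.obj e.2)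
      (isGoodCone_id (Functor.fromPUnit.{u} e.2 ⋙ f.unop.toFunctor) (fun _ ↦ 𝟙 _))).congr
        fun y ↦ ?_
  refine Prod.hom_ext ?_ ?_
  · exact (Category.id_comp _).symm
  · exact ((Category.id_comp _).trans (f.unop.toFunctor.map_id _)).symm

/-- Every derivator has left Kan extension morphisms. -/
instance hasLan : D.HasLan where
  isRightAdjoint k :=
    ⟨⟨lanTrans (D.restr k) (fun _ ↦ Adjunction.ofIsRightAdjoint (D.res _))
      (fun f Z ↦ D.isLan_unitCell k _ f Z), lanTransAdj _ _ _⟩⟩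
end exact
/-! ### Coherent diagrams of poset shape, with a parameter category -/

section posets
variable {P Q R A B C E L : Type} [Preorder P] [Preorder Q] [Preorder R] [Preorder A] [Preorder B]
  [Preorder C] [Preorder E] [Preorder L]

instance (a b : shape.{u} P) : Subsingleton (a ⟶ b) :=
  inferInstanceAs (Subsingleton (ULift (ULift (PLift _))))

lemma shape_hom_ext {a b : AsSmall.{u} P} (f g : a ⟶ b) : f = g :=
  Subsingleton.elim (α := ULift (ULift (PLift _))) f g

/-- The arrow given by an inequality. -/
def shapeArrow {x y : P} (h : x ≤ y) : shapePt.{u} x ⟶ shapePt.{u} y := AsSmall.up.map (homOfLE h)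

lemma le_of_shapeArrow {a b : shape.{u} P} (f : a ⟶ b) : AsSmall.down.obj a ≤ AsSmall.down.obj b :=
  leOfHom (AsSmall.down.map f)

/-- An inequality of monotone maps is a natural transformation. -/
def shapeCell {f g : P →o Q} (h : f ≤ g) :
    (shapeMap.{u} f).toFunctor ⟶ (shapeMap.{u} g).toFunctor where
  app a := AsSmall.up.map (homOfLE (h (AsSmall.down.obj a)))
  naturality _ _ _ := Subsingleton.elim _ _

/-- `L` is a cofinal subposet, by a left adjoint, of `{x | w x ≤ b}`. -/
def IsGoodSlice (w : A →o B) (b : B) (c : L →o A) : Prop :=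
  (∀ y, w (c y) ≤ b) ∧ ∀ a, w a ≤ b → ∃ y, a ≤ c y ∧ ∀ y', a ≤ c y' → y ≤ y'

lemma isGoodSlice_self (w : A →o B) (b : B) :
    IsGoodSlice w b (OrderHom.Subtype.val fun a ↦ w a ≤ b) :=
  ⟨fun y ↦ y.2, fun a h ↦ ⟨⟨a, h⟩, le_rfl, fun _ h' ↦ h'⟩⟩

lemma isGoodSlice_point {w : A →o B} {b : B} {a : A} (h : w a ≤ b) (h' : ∀ a', w a' ≤ b → a' ≤ a) :
    IsGoodSlice w b (⟨fun _ : Unit ↦ a, fun _ _ _ ↦ le_rfl⟩ : Unit →o A) :=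
  ⟨fun _ ↦ h, fun a' ha ↦ ⟨(), h' a' ha, fun _ _ ↦ le_rfl⟩⟩

lemma isGoodSlice_empty [IsEmpty L] {w : A →o B} {b : B} (h : ∀ a, ¬ w a ≤ b) (c : L →o A) :
    IsGoodSlice w b c := ⟨fun y ↦ (IsEmpty.false y).elim, fun a ha ↦ (h a ha).elim⟩

lemma IsGoodSlice.isGoodCone {w : A →o B} {b : B} {c : L →o A} (h : IsGoodSlice w b c) :
    IsGoodCone (shapeMap.{u} w).toFunctor (shapePt b) (shapeMap.{u} c).toFunctor
      (fun y ↦ shapeArrow (h.1 (AsSmall.down.obj y))) := by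
  refine ⟨fun _ _ _ ↦ shape_hom_ext _ _, fun a g ↦ ?_⟩
  obtain ⟨y, hy, hy'⟩ := h.2 (AsSmall.down.obj a) (le_of_shapeArrow g)
  refine ⟨AsSmall.up.obj y, AsSmall.up.map (homOfLE hy), shape_hom_ext _ _, fun y' h' _ ↦
    ⟨AsSmall.up.map (homOfLE (hy' (AsSmall.down.obj y') (le_of_shapeArrow h'))),
      shape_hom_ext _ _, fun _ _ ↦ shape_hom_ext _ _⟩⟩

variable (D : Prederivator.{u, v, w}) (I : Cat.{u, u})

/-- The category `𝒟(P × I)`. -/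
abbrev Dia (P : Type) [Preorder P] : Cat.{v, w} := D.obj (op (Cat.of (shape.{u} P × I)))

/-- The functor `f × id_I`. -/
abbrev timesId (f : P →o Q) : Cat.of (shape.{u} P × I) ⟶ Cat.of (shape.{u} Q × I) :=
  (Functor.prod (shapeMap f).toFunctor (𝟭 I)).toCatHom

/-- An inequality of monotone maps as a 2-cell. -/
def timesCell {f g : P →o Q} (h : f ≤ g) : timesId.{u} I f ⟶ timesId I g :=
  (NatTrans.prod (shapeCell h) (𝟙 (𝟭 I))).toCatHom₂

/-- The restriction `f^* : 𝒟(Q × I) ⥤ 𝒟(P × I)`. -/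
def pull (f : P →o Q) : D.Dia I Q ⥤ D.Dia I P := D.res (timesId I f)

/-- The natural transformation `f^* ⟶ g^*` for `f ≤ g`. -/
def pullCell {f g : P →o Q} (h : f ≤ g) : D.pull I f ⟶ D.pull I g := D.resMap (timesCell I h)

/-- The isomorphism `(g ∘ f)^* ≅ f^* g^*`. -/
def pullComp (f : P →o Q) (g : Q →o R) : D.pull I (g.comp f) ≅ D.pull I g ⋙ D.pull I f :=
  D.resComp (timesId I f) (timesId I g)

/-- The isomorphism `id^* ≅ id`. -/
def pullId (P : Type) [Preorder P] : D.pull I (OrderHom.id : P →o P) ≅ 𝟭 _ :=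
  D.resId (Cat.of (shape.{u} P × I))

variable {I} in
lemma timesCell_comp {f g h : P →o Q} (h₁ : f ≤ g) (h₂ : g ≤ h) :
    timesCell.{u} I h₁ ≫ timesCell I h₂ = timesCell I (h₁.trans h₂) := by
  ext x
  exact Prod.hom_ext (Subsingleton.elim _ _) (Category.comp_id (𝟙 x.2))

variable {I} in
lemma timesCell_refl (f : P →o Q) : timesCell.{u} I (le_refl f) = 𝟙 (timesId I f) := by
  ext x
  exact Prod.hom_ext (Subsingleton.elim _ _) rfl

lemma pullCell_refl (f : P →o Q) : D.pullCell I (le_refl f) = 𝟙 _ :=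
  (congrArg D.resMap (timesCell_refl f)).trans (D.resMap_id _)

lemma pullCell_comp {f g h : P →o Q} (h₁ : f ≤ g) (h₂ : g ≤ h) :
    D.pullCell I h₁ ≫ D.pullCell I h₂ = D.pullCell I (h₁.trans h₂) :=
  (D.resMap_comp (timesCell I h₁) (timesCell I h₂)).symm.trans
    (congrArg D.resMap (timesCell_comp h₁ h₂))

/-- Equal monotone maps have isomorphic restrictions. -/
def pullEq {f g : P →o Q} (h : f = g) : D.pull I f ≅ D.pull I g where
  hom := D.pullCell I h.le
  inv := D.pullCell I h.ge
  hom_inv_id := (D.pullCell_comp I _ _).trans (D.pullCell_refl I f)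
  inv_hom_id := (D.pullCell_comp I _ _).trans (D.pullCell_refl I g)

/-- The isomorphism given by a commutative square. -/
def pullSquare {p : C →o A} {w : A →o B} {q : C →o E} {x : E →o B} (h : w.comp p = x.comp q) :
    D.pull I w ⋙ D.pull I p ≅ D.pull I x ⋙ D.pull I q :=
  (D.pullComp I p w).symm ≪≫ D.pullEq I h ≪≫ D.pullComp I q x

section
variable [D.IsDerivator]

instance (f : P →o Q) : (D.pull I f).IsRightAdjoint :=
  inferInstanceAs (D.res _).IsRightAdjoint

instance (f : P →o Q) : (D.pull I f).IsLeftAdjoint :=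
  inferInstanceAs (D.res _).IsLeftAdjoint

/-- A commutative square of posets is exact if corresponding slices have a common cofinal
subposet. -/
def IsExact (p : C →o A) (w : A →o B) (q : C →o E) (x : E →o B) : Prop :=
  ∀ e : E, ∃ (L : Type) (_ : Preorder L) (c : L →o C), IsGoodSlice q e c ∧
    IsGoodSlice w (x e) (p.comp c)

variable {D I}

/-- A cofinal `L` for the posets, multiplied with a point of `I`, is cofinal for the slices with
parameters. -/
lemma IsExact.isLan {p : C →o A} {w : A →o B} {q : C →o E} {x : E →o B} (H : IsExact p w q x)
    (h : w.comp p = x.comp q) {Z : D.Dia I A} {Y : D.Dia I B} {η : Z ⟶ (D.pull I w).obj Y}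
    (hη : IsLan (D.pull I w) η) :
    IsLan (D.pull I q) ((D.pull I p).map η ≫ (D.pullSquare I h).hom.app Y) := by
  let α : timesId I p ≫ timesId I w ⟶ timesId I q ≫ timesId I x := timesCell I h.le
  refine D.isLan_of_goodCones α (fun e ↦ ?_) hη
  obtain ⟨L, _, c, h₁, h₂⟩ := H (AsSmall.down.obj e.1)
  refine ⟨_, _, Functor.prod (shapeMap.{u} c).toFunctor (Functor.fromPUnit.{u} e.2),
    fun y ↦ (shapeArrow (h₁.1 (AsSmall.down.obj y.1)), 𝟙 _),
    h₁.isGoodCone.prod (𝟭 I) e.2 (isGoodCone_id (Functor.fromPUnit.{u} e.2) (fun _ ↦ 𝟙 _)), ?_⟩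
  refine (h₂.isGoodCone.prod (𝟭 I) e.2 (isGoodCone_id (Functor.fromPUnit.{u} e.2)
    (fun _ ↦ 𝟙 _))).congr fun y ↦ ?_
  exact Prod.hom_ext (Subsingleton.elim _ _) (Category.comp_id (𝟙 e.2)).symm

lemma IsExact.isRan {p : C →o A} {w : A →o B} {q : C →o E} {x : E →o B} (H : IsExact p w q x)
    (h : w.comp p = x.comp q) {Z : D.Dia I E} {Y : D.Dia I B} {θ : (D.pull I x).obj Y ⟶ Z}
    (hθ : IsRan (D.pull I x) θ) :
    IsRan (D.pull I p) ((D.pullSquare I h).hom.app Y ≫ (D.pull I q).map θ) :=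
  IsRan.map_app_comp (D.pullSquare I h).hom (fun hη ↦ H.isLan h hη) hθ

end

variable {D I}

/-- The left Kan extension of the restriction of `X` along `u` is `X`. -/
def LanProp (u : P →o Q) (X : D.Dia I Q) : Prop := IsLan (D.pull I u) (𝟙 ((D.pull I u).obj X))

/-- The right Kan extension of the restriction of `X` along `u` is `X`. -/
def RanProp (u : P →o Q) (X : D.Dia I Q) : Prop := IsRan (D.pull I u) (𝟙 ((D.pull I u).obj X))

variable [D.IsDerivator]

namespace LanProp
variable {u : P →o Q} {X X' : D.Dia I Q}

lemma of_isLan {Z : D.Dia I P} {η : Z ⟶ (D.pull I u).obj X} [IsIso η]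
    (h : IsLan (D.pull I u) η) : LanProp u X :=
  .of_comp_iso_left η (by rwa [Category.comp_id])

lemma of_iso (h : LanProp u X) (e : X ≅ X') : LanProp u X' :=
  of_isLan (IsLan.comp_map h e.hom)

lemma bijective (h : LanProp u X) (Y : D.Dia I Q) :
    Function.Bijective fun f : X ⟶ Y ↦ (D.pull I u).map f := by
  simpa using h Y

lemma isIso (h : LanProp u X) (h' : LanProp u X') (f : X ⟶ X') [IsIso ((D.pull I u).map f)] :
    IsIso f := by
  obtain ⟨g, hg⟩ := (h'.bijective X).2 (inv ((D.pull I u).map f))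
  dsimp only at hg
  exact ⟨g, (h.bijective X).1 (by simp [hg]), (h'.bijective X').1 (by simp [hg])⟩

/-- Base change: in an exact square, restriction along `x` takes diagrams extended along `w` to
diagrams extended along `q`. The cell that appears is invertible because the square commutes
strictly, so it can be normalized to the identity. -/
lemma exact {p : C →o A} {w : A →o B} {q : C →o E} {x : E →o B} (H : IsExact p w q x)
    (h : w.comp p = x.comp q) {Y : D.Dia I B} (hY : LanProp w Y) :
    LanProp q ((D.pull I x).obj Y) := by
  have := H.isLan h hY
  rw [CategoryTheory.Functor.map_id, Category.id_comp] at this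
  have : IsIso ((D.pullSquare I h).hom.app Y) := ((D.pullSquare I h).app Y).isIso_hom
  exact .of_isLan (η := (D.pullSquare I h).hom.app Y) ‹_›

end LanProp

namespace RanProp
variable {u : P →o Q} {X X' : D.Dia I Q}

lemma of_isRan {Z : D.Dia I P} {θ : (D.pull I u).obj X ⟶ Z} [IsIso θ]
    (h : IsRan (D.pull I u) θ) : RanProp u X := by
  have h' := h.comp_iso_right (inv θ)
  rwa [IsIso.hom_inv_id] at h'

lemma of_iso (h : RanProp u X) (e : X ≅ X') : RanProp u X' := by
  refine of_isRan (θ := (D.pull I u).map e.inv) fun Y ↦ ?_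
  have h' := h Y
  have : (fun f : Y ⟶ X' ↦ (D.pull I u).map f ≫ (D.pull I u).map e.inv) =
      (fun f : Y ⟶ X ↦ (D.pull I u).map f ≫ 𝟙 _) ∘ (fun f : Y ⟶ X' ↦ f ≫ e.inv) := by
    ext; simp
  rw [this]
  exact h'.comp ⟨fun _ _ h ↦ (cancel_mono _).1 h, fun g ↦ ⟨g ≫ e.hom, by simp⟩⟩

lemma bijective (h : RanProp u X) (Y : D.Dia I Q) :
    Function.Bijective fun f : Y ⟶ X ↦ (D.pull I u).map f := by
  simpa using h Y

lemma isIso (h : RanProp u X) (h' : RanProp u X') (f : X ⟶ X') [IsIso ((D.pull I u).map f)] :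
    IsIso f := by
  obtain ⟨g, hg⟩ := (h.bijective X').2 (inv ((D.pull I u).map f))
  dsimp only at hg
  exact ⟨g, (h.bijective X).1 (by simp [hg]), (h'.bijective X').1 (by simp [hg])⟩

lemma exact {p : C →o A} {w : A →o B} {q : C →o E} {x : E →o B} (H : IsExact p w q x)
    (h : w.comp p = x.comp q) {Y : D.Dia I B} (hY : RanProp x Y) :
    RanProp p ((D.pull I w).obj Y) := by
  have := H.isRan h hY
  rw [CategoryTheory.Functor.map_id] at this
  erw [Category.comp_id] at this
  have : IsIso ((D.pullSquare I h).hom.app Y) := ((D.pullSquare I h).app Y).isIso_hom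
  exact .of_isRan (θ := (D.pullSquare I h).hom.app Y) ‹_›

end RanProp

/-! ### Embeddings -/

section embedding
variable {u : P →o Q} (hu : ∀ a b, u a ≤ u b → a ≤ b)
include hu

lemma isExact_of_embedding : IsExact (OrderHom.id : P →o P) u OrderHom.id u := fun e ↦
  ⟨_, _, _, isGoodSlice_point (le_refl e) fun _ h ↦ h,
    isGoodSlice_point (le_refl (u e)) fun a h ↦ hu a e h⟩

/-- The square with two identity sides is exact for an embedding, so `η` becomes, up to isomorphism,
a universal arrow for the identity functor. -/
lemma isIso_of_isLan {Z : D.Dia I P} {Y : D.Dia I Q} {η : Z ⟶ (D.pull I u).obj Y}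
    (h : IsLan (D.pull I u) η) : IsIso η := by
  have h' := IsLan.isIso_of_natIso (D.pullId I P) ((isExact_of_embedding hu).isLan rfl h)
  have : IsIso ((D.pullSquare I (rfl : u.comp OrderHom.id = _)).hom.app Y) :=
    ((D.pullSquare I _).app Y).isIso_hom
  have h'' : IsIso ((D.pull I OrderHom.id).map η) :=
    IsIso.of_isIso_comp_right _ ((D.pullSquare I (rfl : u.comp OrderHom.id = _)).hom.app Y)
  exact (NatIso.isIso_map_iff (D.pullId I P) η).1 h''

lemma isIso_of_isRan {Z : D.Dia I P} {Y : D.Dia I Q} {θ : (D.pull I u).obj Y ⟶ Z}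
    (h : IsRan (D.pull I u) θ) : IsIso θ := by
  have h' := IsRan.isIso_of_natIso (D.pullId I P) ((isExact_of_embedding hu).isRan rfl h)
  have : IsIso ((D.pullSquare I (rfl : u.comp OrderHom.id = _)).hom.app Y) :=
    ((D.pullSquare I _).app Y).isIso_hom
  have h'' : IsIso ((D.pull I OrderHom.id).map θ) :=
    IsIso.of_isIso_comp_left ((D.pullSquare I (rfl : u.comp OrderHom.id = _)).hom.app Y) _
  exact (NatIso.isIso_map_iff (D.pullId I P) θ).1 h''

lemma exists_lanProp (Z : D.Dia I P) :
    ∃ Y : D.Dia I Q, LanProp u Y ∧ Nonempty ((D.pull I u).obj Y ≅ Z) := by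
  have h := isLan_unit (Adjunction.ofIsRightAdjoint (D.pull I u)) Z
  have := isIso_of_isLan hu h
  exact ⟨_, .of_isLan h, ⟨(@asIso _ _ _ _ _ this).symm⟩⟩

lemma exists_ranProp (Z : D.Dia I P) :
    ∃ Y : D.Dia I Q, RanProp u Y ∧ Nonempty ((D.pull I u).obj Y ≅ Z) := by
  have h := isRan_counit (Adjunction.ofIsLeftAdjoint (D.pull I u)) Z
  have := isIso_of_isRan hu h
  exact ⟨_, .of_isRan h, ⟨@asIso _ _ _ _ _ this⟩⟩

end embedding

section universal
variable {C₁ C₂ C₃ : Type*} [Category C₁] [Category C₂] [Category C₃]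

lemma IsLan.nonempty_iso {F : C₁ ⥤ C₂} {Z : C₂} {Y Y' : C₁} {η : Z ⟶ F.obj Y} {η' : Z ⟶ F.obj Y'}
    (h : IsLan F η) (h' : IsLan F η') : Nonempty (Y ≅ Y') := by
  obtain ⟨f, rfl⟩ := (h Y').2 η'
  have := h.isIso h'
  exact ⟨asIso f⟩

lemma IsRan.isIso {F : C₁ ⥤ C₂} {Z : C₂} {Y Y' : C₁} {θ : F.obj Y ⟶ Z} {f : Y' ⟶ Y}
    (h : IsRan F θ) (h' : IsRan F (F.map f ≫ θ)) : IsIso f := by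
  obtain ⟨g, hg⟩ := (h' Y).2 θ
  dsimp only at hg
  have h₁ : g ≫ f = 𝟙 Y := (h Y).1 (by simpa using hg)
  refine ⟨g, (h' Y').1 ?_, h₁⟩
  dsimp only
  rw [F.map_comp, Category.assoc, hg]
  simp

lemma IsRan.nonempty_iso {F : C₁ ⥤ C₂} {Z : C₂} {Y Y' : C₁} {θ : F.obj Y ⟶ Z} {θ' : F.obj Y' ⟶ Z}
    (h : IsRan F θ) (h' : IsRan F θ') : Nonempty (Y ≅ Y') := by
  obtain ⟨f, rfl⟩ := (h' Y).2 θ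
  have := h'.isIso h
  exact ⟨asIso f⟩

lemma IsRan.comp {F : C₁ ⥤ C₂} {S : C₂ ⥤ C₃} {Y : C₁} {Z : C₂} {W : C₃} {θ : F.obj Y ⟶ Z}
    {ζ : S.obj Z ⟶ W} (h : IsRan S ζ) (h' : IsRan F θ) : IsRan (F ⋙ S) (S.map θ ≫ ζ) := fun V ↦ by
  have : (fun g : V ⟶ Y ↦ (F ⋙ S).map g ≫ S.map θ ≫ ζ) =
      (fun g : F.obj V ⟶ Z ↦ S.map g ≫ ζ) ∘ (fun g : V ⟶ Y ↦ F.map g ≫ θ) := by ext; simp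
  rw [this]
  exact (h _).comp (h' V)
lemma IsRan.map_comp {F : C₁ ⥤ C₂} {Z : C₂} {Y Y' : C₁} {θ : F.obj Y ⟶ Z} (h : IsRan F θ)
    (f : Y' ⟶ Y) [IsIso f] : IsRan F (F.map f ≫ θ) := fun V ↦ by
  have : (fun g : V ⟶ Y' ↦ F.map g ≫ F.map f ≫ θ) =
      (fun g : V ⟶ Y ↦ F.map g ≫ θ) ∘ (fun g : V ⟶ Y' ↦ g ≫ f) := by ext; simp
  rw [this]
  exact (h V).comp ⟨fun _ _ h ↦ (cancel_mono f).1 h, fun g ↦ ⟨g ≫ inv f, by simp⟩⟩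
end universal

/-- Extending first along `u` and then along `t` gives the extension along the composite, which is
`X` by uniqueness. This permits enlarging the source of an extension, in particular to the
complement of a point. -/
lemma LanProp.of_comp {u : P →o Q} {t : Q →o R} (ht : ∀ a b, t a ≤ t b → a ≤ b) {X : D.Dia I R}
    (h : LanProp (t.comp u) X) : LanProp t X := by
  have h₁ := isLan_unit (Adjunction.ofIsRightAdjoint (D.pull I u)) ((D.pull I (t.comp u)).obj X)
  obtain ⟨Y, hY, ⟨e⟩⟩ := exists_lanProp (D := D) (I := I) ht
    ((D.pull I u).leftAdjoint.obj ((D.pull I (t.comp u)).obj X))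
  have h₂ := ((h₁.comp_map e.inv).comp hY).of_natIso (D.pullComp I u t).symm
  exact hY.of_iso (h₂.nonempty_iso h).some

lemma RanProp.of_comp {u : P →o Q} {t : Q →o R} (ht : ∀ a b, t a ≤ t b → a ≤ b) {X : D.Dia I R}
    (h : RanProp (t.comp u) X) : RanProp t X := by
  have h₁ := isRan_counit (Adjunction.ofIsLeftAdjoint (D.pull I u)) ((D.pull I (t.comp u)).obj X)
  obtain ⟨Y, hY, ⟨e⟩⟩ := exists_ranProp (D := D) (I := I) ht
    ((D.pull I u).rightAdjoint.obj ((D.pull I (t.comp u)).obj X))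
  have h₂ := ((h₁.map_comp e.hom).comp hY).of_natIso (D.pullComp I u t).symm
  exact hY.of_iso (h₂.nonempty_iso h).some

/-- The inclusion of a point. -/
def ptMap (p : P) : Unit →o P := ⟨fun _ ↦ p, fun _ _ _ ↦ le_rfl⟩

/-- (Der2) with parameters: every object `(p, i)` factors through the slice `{p} × I`. -/
lemma isIso_of_pull_ptMap {X Y : D.Dia I P} (f : X ⟶ Y)
    (h : ∀ p, IsIso ((D.pull I (ptMap p)).map f)) : IsIso f := by
  refine IsDerivator.der2 _ f fun ⟨p, i⟩ ↦ ?_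
  let c : pt.{u} ⟶ Cat.of (shape.{u} Unit × I) := const (shapePt (), i)
  have e : (const (p, i) : pt.{u} ⟶ Cat.of (shape.{u} P × I)) =
    c ≫ timesId I (ptMap (AsSmall.down.obj p)) := by
    refine congrArg Functor.toCatHom (CategoryTheory.Functor.ext (fun _ ↦ rfl) (fun _ _ _ ↦ ?_))
    refine Prod.hom_ext (Subsingleton.elim _ _) ?_
    exact ((Category.id_comp _).trans (Category.id_comp _)).symm
  rw [e]
  have := h (AsSmall.down.obj p)
  refine (NatIso.isIso_map_iff (D.resComp c (timesId I (ptMap (AsSmall.down.obj p)))) f).2 ?_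
  exact inferInstanceAs (IsIso ((D.res c).map ((D.pull I (ptMap (AsSmall.down.obj p))).map f)))

end posets
lemma isZero_obj {C₁ C₂ : Type*} [Category C₁] [Category C₂] (F : C₁ ⥤ C₂) [F.IsLeftAdjoint]
    [F.IsRightAdjoint] {Z : C₁} (h : Limits.IsZero Z) : Limits.IsZero (F.obj Z) where
  unique_to Y := by
    have := (h.unique_to ((F.rightAdjoint).obj Y)).some
    exact ⟨((CategoryTheory.Adjunction.ofIsLeftAdjoint F).homEquiv Z Y).unique⟩
  unique_from Y := by
    have := (h.unique_from ((F.leftAdjoint).obj Y)).some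
    exact ⟨((CategoryTheory.Adjunction.ofIsRightAdjoint F).homEquiv Y Z).symm.unique⟩

/-! ### Evaluation at a parameter, stability and zero objects with parameters -/

section cones
variable {C A B I : Type*} [Category C] [Category A] [Category B] [Category I]

lemma IsGoodCone.sectL {w : A ⥤ B} {b : B} {c : C ⥤ A} {γ : ∀ y, w.obj (c.obj y) ⟶ b}
    (h : IsGoodCone w b c γ) (i : I) :
    IsGoodCone (Functor.prod w (𝟭 I)) (b, i) (c ⋙ Prod.sectL A i) (fun y ↦ (γ y, 𝟙 i)) := by
  refine ⟨fun y y' f ↦ Prod.hom_ext (h.1 f) (Category.comp_id _), fun a g ↦ ?_⟩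
  obtain ⟨y, k, hk, hk'⟩ := h.2 a.1 g.1
  refine ⟨y, (k, g.2), Prod.hom_ext hk (Category.comp_id _), fun y' h' e ↦ ?_⟩
  obtain ⟨m, hm, hm'⟩ := hk' y' h'.1 (congrArg (·.1) e)
  have e₂ : h'.2 = g.2 := (Category.comp_id h'.2).symm.trans (congrArg (·.2) e)
  exact ⟨m, Prod.hom_ext hm ((Category.comp_id _).trans e₂.symm),
    fun n hn ↦ hm' n (congrArg (·.1) hn)⟩

/-- The slice at `(b, i')` is the product of the slice of `B` over `b` with the discrete category of
maps `i ⟶ i'`. The terminal objects of its copies of the slice over `b` form a cofinal discrete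
category. -/
lemma isGoodCone_sectL {b : B} {i i' : I} (c : Discrete (i ⟶ i') ⥤ B) (δ : ∀ y, c.obj y ⟶ b)
    [∀ y, IsIso (δ y)] :
    IsGoodCone (Prod.sectL B i) (b, i') c (fun y ↦ (δ y, y.as)) := by
  have key (y y') (f : y ⟶ y') : c.map f ≫ δ y' = δ y := by
    obtain rfl := Discrete.ext (Discrete.eq_of_hom f)
    rw [Subsingleton.elim f (𝟙 _), c.map_id, Category.id_comp]
  have h₁ {a} (x : a ⟶ b) (y) : (x ≫ inv (δ y)) ≫ δ y = x := by simp
  have h₂ {a} (y) (x : a ⟶ c.obj y) : (x ≫ δ y) ≫ inv (δ y) = x := by simp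
  refine ⟨fun y y' f ↦ Prod.hom_ext (key _ _ f) ?_, fun a g ↦ ⟨⟨g.2⟩, g.1 ≫ inv (δ _), ?_,
    fun y' h' e ↦ ?_⟩⟩
  · exact (Category.id_comp _).trans (Discrete.eq_of_hom f).symm
  · exact Prod.hom_ext (h₁ g.1 _) (Category.id_comp _)
  · have e₂ : y'.as = g.2 := (Category.id_comp _).symm.trans (congrArg (·.2) e)
    have e₁ : h' ≫ δ y' = g.1 := congrArg (·.1) e
    obtain rfl : y' = ⟨g.2⟩ := Discrete.ext e₂
    refine ⟨𝟙 _, ?_, fun _ _ ↦ Subsingleton.elim _ _⟩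
    change (g.1 ≫ inv (δ _)) ≫ c.map (𝟙 _) = h'
    rw [← e₁, c.map_id]
    exact (Category.comp_id _).trans (h₂ _ h')

lemma isGoodCone_of_fullyFaithful (k : A ⥤ B) [k.Full] [k.Faithful] (e : A) :
    IsGoodCone k (k.obj e) (Functor.fromPUnit.{u} e) (fun _ ↦ 𝟙 (k.obj e)) := by
  refine ⟨fun _ _ _ ↦ by simp, fun a g ↦ ⟨⟨⟨⟩⟩, k.preimage g, by simp, fun y' h' hh ↦
    ⟨⟨⟨Subsingleton.elim _ _⟩⟩, ?_, fun _ _ ↦ Subsingleton.elim (α := ULift (PLift _)) _ _⟩⟩⟩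
  change k.preimage g ≫ 𝟙 e = h'
  rw [Category.comp_id]
  refine k.map_injective ?_
  rw [k.map_preimage, ← hh]
  simp
end cones

section
variable (D : Prederivator.{u, v, w}) {A B C : Cat.{u, u}}

lemma res_isEquivalence (e : A ⟶ B) (e' : B ⟶ A) (h : e ≫ e' ≅ 𝟙 A) (h' : e' ≫ e ≅ 𝟙 B) :
    (D.res e).IsEquivalence := by
  have i₁ : IsIso (D.resMap h.hom) := NatIso.isIso_of_isIso_app _
  have i₂ : IsIso (D.resMap h'.hom) := NatIso.isIso_of_isIso_app _
  exact (CategoryTheory.Equivalence.mk (D.res e) (D.res e')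
    ((D.resId B).symm ≪≫ (asIso (D.resMap h'.hom)).symm ≪≫ D.resComp e' e)
    ((D.resComp e e').symm ≪≫ asIso (D.resMap h.hom) ≪≫ D.resId A)).isEquivalence_functor

variable [D.IsDerivator]

/-- (Der1) for the empty family makes `𝒟(∅)` equivalent to the terminal category. An arbitrary empty
category is isomorphic to the empty coproduct `S`. -/
lemma nonempty_unique_hom [IsEmpty A] (X Y : D.obj (op A)) : Nonempty (Unique (X ⟶ Y)) := by
  let S : Cat.{u, u} := Cat.of (Σ i : PEmpty.{u + 1}, (PEmpty.elim i : Cat.{u, u}))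
  have hS : IsEmpty S := ⟨fun x ↦ x.1.elim⟩
  let e : A ⟶ S := Functor.toCatHom
    { obj a := (IsEmpty.false a).elim, map {a _} _ := (IsEmpty.false a).elim,
      map_id a := (IsEmpty.false a).elim, map_comp {a _ _} _ _ := (IsEmpty.false a).elim }
  let e' : S ⟶ A := Functor.toCatHom
    { obj a := (IsEmpty.false a).elim, map {a _} _ := (IsEmpty.false a).elim,
      map_id a := (IsEmpty.false a).elim, map_comp {a _ _} _ _ := (IsEmpty.false a).elim }
  have h₁ : e ≫ e' = 𝟙 A := congrArg Functor.toCatHom (CategoryTheory.Functor.ext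
    (fun a ↦ (IsEmpty.false a).elim) (fun a ↦ (IsEmpty.false a).elim))
  have h₂ : e' ≫ e = 𝟙 S := congrArg Functor.toCatHom (CategoryTheory.Functor.ext
    (fun a ↦ (IsEmpty.false a).elim) (fun a ↦ (IsEmpty.false a).elim))
  have := D.res_isEquivalence e' e (eqToIso h₂) (eqToIso h₁)
  have h := IsDerivator.der1 (D := D) PEmpty.{u + 1} (fun i ↦ PEmpty.elim i)
  let F := (Functor.pi' fun i ↦ D.res (Sigma.incl (C := fun i ↦
    ((fun i : PEmpty.{u + 1} ↦ (PEmpty.elim i : Cat.{u, u})) i)) i).toCatHom)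
  have : F.IsEquivalence := h
  let G := D.res e' ⋙ F
  have : G.IsEquivalence := inferInstance
  have : Unique (G.obj X ⟶ G.obj Y) := ⟨⟨fun i ↦ i.elim⟩, fun _ ↦ funext fun i ↦ i.elim⟩
  exact ⟨(Functor.FullyFaithful.ofFullyFaithful G).homEquiv.unique⟩

lemma isLan_fullyFaithful (k : A ⟶ B) [k.toFunctor.Full] [k.toFunctor.Faithful]
    {Z : D.obj (op A)} {Y : D.obj (op B)} {η : Z ⟶ (D.res k).obj Y} (h : IsLan (D.res k) η) :
    IsLan (D.res (𝟙 A)) ((D.res (𝟙 A)).map η ≫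
      (D.resCell (𝟙 (𝟙 A ≫ k) : 𝟙 A ≫ k ⟶ 𝟙 A ≫ k)).app Y) := by
  refine D.isLan_of_goodCones (𝟙 (𝟙 A ≫ k) : 𝟙 A ≫ k ⟶ 𝟙 A ≫ k) (fun e ↦
    ⟨_, _, Functor.fromPUnit.{u} e, fun _ ↦ 𝟙 e, isGoodCone_id _ _, ?_⟩) h
  refine (isGoodCone_of_fullyFaithful k.toFunctor e).congr fun y ↦ ?_
  exact ((Category.id_comp _).trans (k.toFunctor.map_id e)).symm

instance resCell_isIso {E : Cat.{u, u}} {p : C ⟶ A} {w : A ⟶ B} {q : C ⟶ E} {x : E ⟶ B}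
    (α : p ≫ w ⟶ q ≫ x) [IsIso α] (Y : D.obj (op B)) : IsIso ((D.resCell α).app Y) := by
  rw [resCell_app]
  have : IsIso ((D.resMap α).app Y) := D.resMap_isIso _ Y
  exact IsIso.comp_isIso' inferInstance (IsIso.comp_isIso' this ((D.resComp _ _).app _).isIso_hom)

lemma isIso_of_isLan_fullyFaithful (k : A ⟶ B) [k.toFunctor.Full] [k.toFunctor.Faithful]
    {Z : D.obj (op A)} {Y : D.obj (op B)} {η : Z ⟶ (D.res k).obj Y} (h : IsLan (D.res k) η) :
    IsIso η := by
  have h' := (D.isLan_fullyFaithful k h).isIso_of_natIso (D.resId A)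
  have := D.resCell_isIso (𝟙 (𝟙 A ≫ k) : 𝟙 A ≫ k ⟶ 𝟙 A ≫ k) Y
  have h'' : IsIso ((D.res (𝟙 A)).map η) := IsIso.of_isIso_comp_right _ ((D.resCell (𝟙 (𝟙 A ≫ k) : 𝟙 A ≫ k ⟶ 𝟙 A ≫ k)).app Y)
  exact (NatIso.isIso_map_iff (D.resId A) η).1 h''

lemma isIso_of_isRan_fullyFaithful (k : A ⟶ B) [k.toFunctor.Full] [k.toFunctor.Faithful]
    {Z : D.obj (op A)} {Y : D.obj (op B)} {θ : (D.res k).obj Y ⟶ Z} (h : IsRan (D.res k) θ) :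
    IsIso θ := by
  have h₁ := IsRan.map_app_comp (D.resCell (𝟙 (𝟙 A ≫ k) : 𝟙 A ≫ k ⟶ 𝟙 A ≫ k))
    (fun hη ↦ D.isLan_fullyFaithful k hη) h
  have h' := h₁.isIso_of_natIso (D.resId A)
  have := D.resCell_isIso (𝟙 (𝟙 A ≫ k) : 𝟙 A ≫ k ⟶ 𝟙 A ≫ k) Y
  have h'' : IsIso ((D.res (𝟙 A)).map θ) := IsIso.of_isIso_comp_left ((D.resCell (𝟙 (𝟙 A ≫ k) : 𝟙 A ≫ k ⟶ 𝟙 A ≫ k)).app Y) _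
  exact (NatIso.isIso_map_iff (D.resId A) θ).1 h''

end

section image
variable {C₁ C₂ : Type*} [Category C₁] [Category C₂]

/-- The passage from the essential images in the definitions to universal arrows: when the unit is
invertible it can be normalized to an identity. -/
lemma essImage_leftAdjoint_iff {L : C₂ ⥤ C₁} {F : C₁ ⥤ C₂} (adj : L ⊣ F)
    (h : ∀ Z, IsIso (adj.unit.app Z)) (Y : C₁) :
    L.essImage Y ↔ IsLan F (𝟙 (F.obj Y)) := by
  refine ⟨fun ⟨Z, ⟨e⟩⟩ ↦ ?_, fun hY ↦ ?_⟩
  · have h' := (isLan_unit adj Z).comp_map e.hom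
    have := h Z
    exact .of_comp_iso_left (adj.unit.app Z ≫ F.map e.hom) (by rwa [Category.comp_id])
  · exact ⟨F.obj Y, (isLan_unit adj _).nonempty_iso hY⟩

lemma essImage_rightAdjoint_iff {G : C₂ ⥤ C₁} {F : C₁ ⥤ C₂} (adj : F ⊣ G)
    (h : ∀ Z, IsIso (adj.counit.app Z)) (Y : C₁) :
    G.essImage Y ↔ IsRan F (𝟙 (F.obj Y)) := by
  refine ⟨fun ⟨Z, ⟨e⟩⟩ ↦ ?_, fun hY ↦ ?_⟩
  · have h' := (isRan_counit adj Z).map_comp e.inv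
    have := h Z
    have h'' := h'.comp_iso_right (inv (F.map e.inv ≫ adj.counit.app Z))
    rwa [IsIso.hom_inv_id] at h''
  · exact ⟨F.obj Y, (isRan_counit adj _).nonempty_iso hY⟩
end image

section
variable {D : Prederivator.{u, v, w}} [D.IsDerivator] {I : Cat.{u, u}}
  {P Q : Type} [Preorder P] [Preorder Q]

/-- The inclusion of the span into the square. -/
abbrev spanMap : SqUL →o Sq := OrderHom.Subtype.val _
/-- The inclusion of the cospan into the square. -/
abbrev cospanMap : SqLR →o Sq := OrderHom.Subtype.val _

lemma lan_essImage_iff {u : P →o Q} (hu : ∀ a b, u a ≤ u b → a ≤ b) (I : (Cat.{u, u})ᵒᵖ)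
    (Y : D.Dia I.unop Q) :
    ((D.lan (shapeMap u)).app I).toFunctor.essImage Y ↔ LanProp u Y :=
  essImage_leftAdjoint_iff (adjApp (Bicategory.Adjunction.ofIsRightAdjoint (D.restr (shapeMap u))) I)
    (fun Z ↦ isIso_of_isLan (D := D) (I := I.unop) hu (isLan_unit _ Z)) Y

lemma liesInImage_iff {R : Type} [Preorder R] {u : P →o Q} (hu : ∀ a b, u a ≤ u b → a ≤ b)
    (f : Q →o R) (I : (Cat.{u, u})ᵒᵖ) (X : D.Dia I.unop R) :
    D.LiesInImage (shapeMap u) (shapeMap f) I X ↔ LanProp u ((D.pull I.unop f).obj X) :=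
  lan_essImage_iff hu I _

section sections
/-- The functor `A ⟶ A × I` given by an object `i` of `I`. -/
def sectHom (A : Cat.{u, u}) (i : I) : A ⟶ Cat.of (A × I) := (Prod.sectL A i).toCatHom

variable (D) in
/-- The restriction functor `𝒟(A × I) ⥤ 𝒟(A)` given by an object `i` of `I`. -/
def atParam (A : Cat.{u, u}) (i : I) : D.obj (op (Cat.of (A × I))) ⥤ D.obj (op A) :=
  D.res (sectHom A i)

/-- The compatibility of `atParam` with restrictions. -/
def sectCell (u : P →o Q) (i : I) :
    sectHom (shape.{u} P) i ≫ timesId I u ⟶ shapeMap.{u} u ≫ sectHom (shape.{u} Q) i :=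
  𝟙 (sectHom (shape.{u} P) i ≫ timesId I u)

/-- The inverse of `sectCell`. -/
def sectCell' (u : P →o Q) (i : I) :
    shapeMap.{u} u ≫ sectHom (shape.{u} Q) i ⟶ sectHom (shape.{u} P) i ≫ timesId I u :=
  𝟙 (sectHom (shape.{u} P) i ≫ timesId I u)

instance (u : P →o Q) (i : I) : IsIso (sectCell u i) :=
  ⟨sectCell' u i, Category.id_comp _, Category.id_comp _⟩

instance (u : P →o Q) (i : I) : IsIso (sectCell' u i) :=
  ⟨sectCell u i, Category.id_comp _, Category.id_comp _⟩

variable (D) in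
/-- Restriction and evaluation at `i` commute. -/
noncomputable def atParamIso (u : P →o Q) (i : I) :
    D.pull I u ⋙ D.atParam _ i ≅ D.atParam _ i ⋙ D.res (shapeMap u) :=
  NatIso.ofComponents (fun X ↦ @asIso _ _ _ _ ((D.resCell (sectCell u i)).app X)
    (D.resCell_isIso (sectCell u i) X)) fun f ↦ (D.resCell (sectCell u i)).naturality f

/-- Evaluation at `i` is exact: the slice of `u` at an element is cofinal in the slice of `u × id`
at the corresponding object over `i`. -/
lemma isLan_atParam {u : P →o Q} (i : I) {Z : D.Dia I P} {Y : D.Dia I Q}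
    {η : Z ⟶ (D.pull I u).obj Y} (h : IsLan (D.pull I u) η) :
    IsLan (D.res (shapeMap u)) ((D.atParam _ i).map η ≫ (D.resCell (sectCell u i)).app Y) := by
  refine D.isLan_of_goodCones (sectCell u i) (fun e ↦ ?_) h
  have hc := (isGoodSlice_self u (AsSmall.down.obj e)).isGoodCone
  refine ⟨_, _, _, _, hc, (hc.sectL i).congr fun y ↦ ?_⟩
  exact Prod.hom_ext (Subsingleton.elim _ _) (Category.comp_id (𝟙 i)).symm

/-- `isLan_atParam`, with the square transposed. -/
lemma isLan_sectL {u : P →o Q} (i : I) {Z : D.obj (op (shape.{u} Q))} {Y : D.Dia I Q}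
    {η : Z ⟶ (D.atParam _ i).obj Y} (h : IsLan (D.atParam _ i) η) :
    IsLan (D.atParam _ i) ((D.res (shapeMap u)).map η ≫
      (D.resCell (sectCell' u i)).app Y) := by
  refine D.isLan_of_goodCones (sectCell' u i) (fun e ↦ ?_) h
  refine ⟨_, inferInstance, (Functor.const (Discrete (i ⟶ e.2))).obj e.1, _,
    isGoodCone_sectL _ (fun _ ↦ 𝟙 _), ?_⟩
  have : IsGoodCone (Prod.sectL (shape.{u} Q) i) ((shapeMap u).toFunctor.obj e.1, e.2)
    ((Functor.const (Discrete (i ⟶ e.2))).obj e.1 ⋙ (shapeMap u).toFunctor) _ :=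
    isGoodCone_sectL _ (fun _ ↦ 𝟙 _)
  refine this.congr fun y ↦ Prod.hom_ext (Subsingleton.elim _ _) ?_
  exact (Category.id_comp (y.as)).symm

lemma isRan_atParam {u : P →o Q} (i : I) {Z : D.Dia I P} {Y : D.Dia I Q}
    {θ : (D.pull I u).obj Y ⟶ Z} (h : IsRan (D.pull I u) θ) :
    IsRan (D.res (shapeMap u)) ((D.resCell (sectCell' u i)).app Y ≫ (D.atParam _ i).map θ) :=
  IsRan.map_app_comp (D.resCell (sectCell' u i)) (fun hη ↦ isLan_sectL i hη) h

lemma isIso_of_atParam {X Y : D.Dia I P} (f : X ⟶ Y)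
    (h : ∀ i, IsIso ((D.atParam _ i).map f)) : IsIso f := by
  refine IsDerivator.der2 _ f fun ⟨p, i⟩ ↦ ?_
  have := h i
  refine (NatIso.isIso_map_iff (D.resComp (const p) (sectHom (shape.{u} P) i)) f).2 ?_
  exact inferInstanceAs (IsIso ((D.res (const p)).map ((D.atParam _ i).map f)))

lemma isRan_id_of_isIso {C₁ C₂ : Type*} [Category C₁] [Category C₂] {F : C₁ ⥤ C₂} {Y : C₁} {Z : C₂}
    {θ : F.obj Y ⟶ Z} (hθ : IsIso θ) (h : IsRan F θ) : IsRan F (𝟙 (F.obj Y)) := by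
  simpa using h.comp_iso_right (inv θ)

lemma isIso_of_isLan_id {C₁ C₂ : Type*} [Category C₁] [Category C₂] {F : C₁ ⥤ C₂} {X Y : C₁}
    (h : IsLan F (𝟙 (F.obj X))) (h' : IsLan F (𝟙 (F.obj Y))) (f : X ⟶ Y) [IsIso (F.map f)] :
    IsIso f := by
  refine h.isIso (.of_comp_iso_left (inv (F.map f)) ?_)
  simpa using h'

lemma isIso_of_isRan_id {C₁ C₂ : Type*} [Category C₁] [Category C₂] {F : C₁ ⥤ C₂} {X Y : C₁}
    (h : IsRan F (𝟙 (F.obj X))) (h' : IsRan F (𝟙 (F.obj Y))) (f : X ⟶ Y) [IsIso (F.map f)] :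
    IsIso f := by
  refine h'.isIso ?_
  have := h.comp_iso_right (F.map f)
  simpa using this

omit [D.IsDerivator] in
lemma isIso_res_atParam {u : P →o Q} (i : I) {X Y : D.Dia I Q} (f : X ⟶ Y)
    [h : IsIso ((D.pull I u).map f)] : IsIso ((D.res (shapeMap u)).map ((D.atParam _ i).map f)) := by
  refine (NatIso.isIso_map_iff (D.atParamIso u i) f).1 ?_
  exact inferInstanceAs (IsIso ((D.atParam _ i).map ((D.pull I u).map f)))

/-- Extensions are preserved by evaluation at `i`. For the converse, the restriction of `X` is
extended to a diagram `Y`; by uniqueness the comparison `Y ⟶ X` is invertible at every `i`, hence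
invertible. -/
lemma lanProp_iff_atParam {u : P →o Q} (hu : ∀ a b, u a ≤ u b → a ≤ b) (X : D.Dia I Q) :
    LanProp u X ↔ ∀ i, IsLan (D.res (shapeMap u)) (𝟙 ((D.res (shapeMap u)).obj
      ((D.atParam _ i).obj X))) := by
  have key (X : D.Dia I Q) (hX : LanProp u X) (i : I) : IsLan (D.res (shapeMap u))
      (𝟙 ((D.res (shapeMap u)).obj ((D.atParam _ i).obj X))) := by
    have h : IsLan (D.res (shapeMap u)) ((D.atParam _ i).map (𝟙 ((D.pull I u).obj X)) ≫
      (D.atParamIso u i).hom.app X) := isLan_atParam i hX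
    rw [CategoryTheory.Functor.map_id, Category.id_comp] at h
    exact .of_comp_iso_left ((D.atParamIso u i).hom.app X) (by erw [Category.comp_id]; exact h)
  refine ⟨key X, fun h ↦ ?_⟩
  obtain ⟨Y, hY, ⟨e⟩⟩ := exists_lanProp (D := D) (I := I) hu ((D.pull I u).obj X)
  obtain ⟨f, hf⟩ := (hY.bijective X).2 e.hom
  dsimp only at hf
  have h₁ : IsIso ((D.pull I u).map f) := hf ▸ inferInstance
  have : IsIso f := isIso_of_atParam f fun i ↦ by
    have := isIso_res_atParam (u := u) i f
    exact isIso_of_isLan_id (key Y hY i) (h i) _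
  exact hY.of_iso (asIso f)

lemma ranProp_iff_atParam {u : P →o Q} (hu : ∀ a b, u a ≤ u b → a ≤ b) (X : D.Dia I Q) :
    RanProp u X ↔ ∀ i, IsRan (D.res (shapeMap u)) (𝟙 ((D.res (shapeMap u)).obj
      ((D.atParam _ i).obj X))) := by
  have key (X : D.Dia I Q) (hX : RanProp u X) (i : I) : IsRan (D.res (shapeMap u))
      (𝟙 ((D.res (shapeMap u)).obj ((D.atParam _ i).obj X))) := by
    have h := isRan_atParam i hX
    have h₁ := D.resCell_isIso (sectCell' u i) X
    have h₂ : IsIso ((D.atParam _ i).map (𝟙 ((D.pull I u).obj X))) := inferInstance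
    have h₃ := IsIso.comp_isIso' h₁ h₂
    exact isRan_id_of_isIso h₃ h
  refine ⟨key X, fun h ↦ ?_⟩
  obtain ⟨Y, hY, ⟨e⟩⟩ := exists_ranProp (D := D) (I := I) hu ((D.pull I u).obj X)
  obtain ⟨f, hf⟩ := (hY.bijective X).2 e.inv
  dsimp only at hf
  have h₁ : IsIso ((D.pull I u).map f) := hf ▸ inferInstance
  have : IsIso f := isIso_of_atParam f fun i ↦ by
    have := isIso_res_atParam (u := u) i f
    exact isIso_of_isRan_id (h i) (key Y hY i) _
  exact hY.of_iso (@asIso _ _ _ _ f this).symm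
end sections

lemma shapeMap_full {u : P →o Q} (hu : ∀ a b, u a ≤ u b → a ≤ b) :
    (shapeMap.{u} u).toFunctor.Full where
  map_surjective {a b} f := ⟨shapeArrow (hu (AsSmall.down.obj a) (AsSmall.down.obj b) (le_of_shapeArrow f)), Subsingleton.elim _ _⟩

lemma shapeMap_faithful (u : P →o Q) : (shapeMap.{u} u).toFunctor.Faithful where
  map_injective _ := Subsingleton.elim _ _

/-- The stability axiom concerns `𝒟(□)` only; evaluation at all parameters extends it to `𝒟(□ × I)`.
-/
lemma lanProp_span_iff [D.IsStable] (X : D.Dia I Sq) :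
    LanProp spanMap X ↔ RanProp cospanMap X := by
  rw [lanProp_iff_atParam (fun _ _ h ↦ h), ranProp_iff_atParam (fun _ _ h ↦ h)]
  refine forall_congr' fun i ↦ ?_
  have h := IsStable.isCocartesian_iff (D := D) ((D.atParam _ i).obj X)
  have : sqUL.{u}.toFunctor.Full := shapeMap_full (u := spanMap) (fun _ _ h ↦ h)
  have : sqUL.{u}.toFunctor.Faithful := shapeMap_faithful spanMap
  have : sqLR.{u}.toFunctor.Full := shapeMap_full (u := cospanMap) (fun _ _ h ↦ h)
  have : sqLR.{u}.toFunctor.Faithful := shapeMap_faithful cospanMap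
  have h₁ := essImage_leftAdjoint_iff (CategoryTheory.Adjunction.ofIsRightAdjoint (D.res sqUL))
    (fun Z ↦ D.isIso_of_isLan_fullyFaithful sqUL (isLan_unit _ Z)) ((D.atParam _ i).obj X)
  have h₂ := essImage_rightAdjoint_iff (CategoryTheory.Adjunction.ofIsLeftAdjoint (D.res sqLR))
    (fun Z ↦ D.isIso_of_isRan_fullyFaithful sqLR (isRan_counit _ Z)) ((D.atParam _ i).obj X)
  exact h₁.symm.trans (h.trans h₂)

section zero
variable [D.IsStable]

lemma exists_isZero (A : Cat.{u, u}) : ∃ O : D.obj (op A), Limits.IsZero O := by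
  obtain ⟨O, hO⟩ := (IsStable.pointed (D := D)).zero
  let π : A ⟶ pt := (Functor.star A).toCatHom
  exact ⟨(D.res π).obj O, isZero_obj _ hO⟩

lemma isZero_of_unique {A : Cat.{u, u}} {X : D.obj (op A)}
    (h : ∀ Y, Nonempty (Unique (X ⟶ Y))) : Limits.IsZero X := by
  obtain ⟨O, hO⟩ := exists_isZero (D := D) A
  have hX : Limits.IsInitial X := Limits.IsInitial.ofUnique (h := fun Y ↦ (h Y).some)
  exact hO.of_iso (hX.uniqueUpToIso hO.isInitial)

/-- The left Kan extension from `∅ × I` is initial because `𝒟(∅ × I)` is trivial, hence it is zero.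
The rest exchanges the category `e` with the one-point poset. -/
lemma vanishesAt_iff (x : P) (I : (Cat.{u, u})ᵒᵖ) (X : D.Dia I.unop P) :
    D.VanishesAt (shapePt x) I X ↔ Limits.IsZero ((D.pull I.unop (ptMap x)).obj X) := by
  let c : Cat.of (pt.{u} × I.unop) ⟶ Cat.of (shape.{u} P × I.unop) :=
    (Functor.prod (const (shapePt x)).toFunctor (𝟭 I.unop)).toCatHom
  have h₁ : D.VanishesAt (shapePt x) I X ↔ Limits.IsZero ((D.res c).obj X) := by
    let adj := adjApp (Bicategory.Adjunction.ofIsRightAdjoint (D.restr (fromEmpty pt.{u}))) I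
    have hZ : ∀ Z, Limits.IsZero (((D.lan (fromEmpty pt.{u})).app I).toFunctor.obj Z) := fun Z ↦ by
      refine isZero_of_unique (D := D) fun Y ↦ ?_
      have : IsEmpty (Cat.of (Cat.of (Discrete PEmpty.{u + 1}) × I.unop)) :=
        ⟨fun a ↦ a.1.as.elim⟩
      have := (D.nonempty_unique_hom (A := Cat.of (Cat.of (Discrete PEmpty.{u + 1}) × I.unop))
        Z (((D.restr (fromEmpty pt.{u})).app I).toFunctor.obj Y)).some
      exact ⟨@Equiv.unique _ _ this (adj.homEquiv Z Y)⟩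
    constructor
    · rintro ⟨Z, ⟨e⟩⟩
      exact (hZ Z).of_iso e.symm
    · intro h
      exact ⟨((D.restr (fromEmpty pt.{u})).app I).toFunctor.obj ((D.res c).obj X),
        ⟨(hZ _).iso h⟩⟩
  rw [h₁]
  let s : Cat.of (pt.{u} × I.unop) ⟶ Cat.of (shape.{u} Unit × I.unop) :=
    (Functor.prod (const (shapePt ())).toFunctor (𝟭 I.unop)).toCatHom
  let t : Cat.of (shape.{u} Unit × I.unop) ⟶ Cat.of (pt.{u} × I.unop) :=
    (Functor.prod (Functor.star _) (𝟭 I.unop)).toCatHom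
  have e₁ : s ≫ timesId I.unop (ptMap x) = c := by
    refine congrArg Functor.toCatHom (CategoryTheory.Functor.ext (fun _ ↦ rfl) (fun _ _ _ ↦ ?_))
    refine Prod.hom_ext (Subsingleton.elim _ _) ?_
    exact ((Category.id_comp _).trans (Category.comp_id _)).symm
  have e₂ : t ≫ c = timesId I.unop (ptMap x) := by
    refine congrArg Functor.toCatHom (CategoryTheory.Functor.ext (fun _ ↦ rfl) (fun _ _ _ ↦ ?_))
    refine Prod.hom_ext (Subsingleton.elim _ _) ?_
    exact ((Category.id_comp _).trans (Category.comp_id _)).symm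
  constructor
  · intro h
    have h' := (isZero_obj (D.res t) h).of_iso ((D.resComp t c).app X)
    rw [e₂] at h'
    exact h'
  · intro h
    have h' := (isZero_obj (D.res s) h).of_iso ((D.resComp s (timesId I.unop (ptMap x))).app X)
    rw [e₁] at h'
    exact h'

end zero
end
-- Local criteria for Kan extensions: corner squares
section squares

/-- The square with the given corners. -/
def mkSq {P : Type} [Preorder P] (a b c d : P) (hab : a ≤ b) (hac : a ≤ c) (hbd : b ≤ d)
    (hcd : c ≤ d) : Sq →o P where
  toFun x := if x.1 = 0 then (if x.2 = 0 then a else c) else (if x.2 = 0 then b else d)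
  monotone' := by
    have had := hab.trans hbd
    rintro ⟨x, y⟩ ⟨z, w⟩ ⟨h₁, h₂⟩
    fin_cases x <;> fin_cases y <;> fin_cases z <;> fin_cases w <;> simp_all

variable {P Q : Type} [PartialOrder P] [PartialOrder Q]

/-- The square `sq` computes the value at `p` of left Kan extensions from subposets
without `p`. -/
structure PushoutCorner (p : P) (sq : Sq →o P) : Prop where
  corner : sq (1, 1) = p
  ne : ∀ y, y ≠ (1, 1) → sq y ≠ p
  least : ∀ a, a ≤ p → a ≠ p →
    ∃ y, y ≠ (1, 1) ∧ a ≤ sq y ∧ ∀ y', y' ≠ (1, 1) → a ≤ sq y' → y ≤ y'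

/-- The square `sq` computes the value at `p` of right Kan extensions from subposets
without `p`. -/
structure PullbackCorner (p : P) (sq : Sq →o P) : Prop where
  corner : sq (0, 0) = p
  ne : ∀ y, y ≠ (0, 0) → sq y ≠ p
  greatest : ∀ a, p ≤ a → a ≠ p →
    ∃ y, y ≠ (0, 0) ∧ sq y ≤ a ∧ ∀ y', y' ≠ (0, 0) → sq y' ≤ a → y' ≤ y

lemma Sq.cases (y : Sq) : y = (0, 0) ∨ y = (1, 0) ∨ y = (0, 1) ∨ y = (1, 1) := by
  revert y
  decide

/-- By `h`, the elements strictly below `d` are those below `b` or below `c`, and those below both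
are below `a`. This makes the span cofinal among them. -/
lemma pushoutCorner_mkSq {a b c d : P} (hab : a ≤ b) (hac : a ≤ c) (hbd : b ≤ d)
    (hcd : c ≤ d) (hb : b ≠ d) (hc : c ≠ d)
    (h : ∀ x, x ≤ d → x ≠ d → (x ≤ b ∨ x ≤ c) ∧ (x ≤ b → x ≤ c → x ≤ a)) :
    PushoutCorner d (mkSq a b c d hab hac hbd hcd) where
  corner := rfl
  ne y hy := by
    rcases Sq.cases y with rfl | rfl | rfl | rfl
    · rintro (rfl : a = d)
      exact hb (le_antisymm hbd hab)
    · exact hb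
    · exact hc
    · exact (hy rfl).elim
  least x hx hx' := by
    obtain ⟨h₁, h₂⟩ := h x hx hx'
    by_cases ha : x ≤ a
    · exact ⟨(0, 0), by decide, ha, fun y' _ _ ↦ ⟨Fin.zero_le _, Fin.zero_le _⟩⟩
    rcases h₁ with h₁ | h₁
    · refine ⟨(1, 0), by decide, h₁, fun y' hy' h' ↦ ?_⟩
      rcases Sq.cases y' with rfl | rfl | rfl | rfl
      · exact (ha h').elim
      · exact le_rfl
      · exact (ha (h₂ h₁ h')).elim
      · exact (hy' rfl).elim
    · refine ⟨(0, 1), by decide, h₁, fun y' hy' h' ↦ ?_⟩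
      rcases Sq.cases y' with rfl | rfl | rfl | rfl
      · exact (ha h').elim
      · exact (ha (h₂ h' h₁)).elim
      · exact le_rfl
      · exact (hy' rfl).elim

lemma pullbackCorner_mkSq {a b c d : P} (hab : a ≤ b) (hac : a ≤ c) (hbd : b ≤ d)
    (hcd : c ≤ d) (hb : b ≠ a) (hc : c ≠ a)
    (h : ∀ x, a ≤ x → x ≠ a → (b ≤ x ∨ c ≤ x) ∧ (b ≤ x → c ≤ x → d ≤ x)) :
    PullbackCorner a (mkSq a b c d hab hac hbd hcd) where
  corner := rfl
  ne y hy := by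
    rcases Sq.cases y with rfl | rfl | rfl | rfl
    · exact (hy rfl).elim
    · exact hb
    · exact hc
    · rintro (rfl : d = a)
      exact hb (le_antisymm hbd hab)
  greatest x hx hx' := by
    obtain ⟨h₁, h₂⟩ := h x hx hx'
    by_cases ha : d ≤ x
    · exact ⟨(1, 1), by decide, ha, fun y' _ _ ↦ ⟨Fin.le_last _, Fin.le_last _⟩⟩
    rcases h₁ with h₁ | h₁
    · refine ⟨(1, 0), by decide, h₁, fun y' hy' h' ↦ ?_⟩
      rcases Sq.cases y' with rfl | rfl | rfl | rfl
      · exact (hy' rfl).elim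
      · exact le_rfl
      · exact (ha (h₂ h₁ h')).elim
      · exact (ha h').elim
    · refine ⟨(0, 1), by decide, h₁, fun y' hy' h' ↦ ?_⟩
      rcases Sq.cases y' with rfl | rfl | rfl | rfl
      · exact (hy' rfl).elim
      · exact (ha (h₂ h' h₁)).elim
      · exact le_rfl
      · exact (ha h').elim

end squares

section
variable {D : Prederivator.{u, v, w}} {I : Cat.{u, u}}

/-- `X` vanishes at `p`. -/
def IsZeroAt {P : Type} [Preorder P] (X : D.Dia I P) (p : P) : Prop :=
  Limits.IsZero ((D.pull I (ptMap p)).obj X)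

/-- The square `sq^* X` is cocartesian. -/
def SqProp {P : Type} [Preorder P] (sq : Sq →o P) (X : D.Dia I P) : Prop :=
  LanProp spanMap ((D.pull I sq).obj X)

section
variable {P Q R : Type} [Preorder P] [Preorder Q] [Preorder R]

lemma isIso_pull_comp {f : P →o Q} {g : Q →o R} {X Y : D.Dia I R} (φ : X ⟶ Y) :
    IsIso ((D.pull I f).map ((D.pull I g).map φ)) ↔ IsIso ((D.pull I (g.comp f)).map φ) :=
  (NatIso.isIso_map_iff (D.pullComp I f g) φ).symm

variable [D.IsDerivator]

lemma isZeroAt_pull (f : P →o Q) (X : D.Dia I Q) (p : P) :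
    IsZeroAt ((D.pull I f).obj X) p ↔ IsZeroAt X (f p) :=
  ⟨fun h ↦ Limits.IsZero.of_iso h ((D.pullComp I (ptMap p) f).app X),
    fun h ↦ Limits.IsZero.of_iso h ((D.pullComp I (ptMap p) f).app X).symm⟩

lemma IsZeroAt.of_iso {X Y : D.Dia I P} {p : P} (h : IsZeroAt X p) (e : X ≅ Y) : IsZeroAt Y p :=
  Limits.IsZero.of_iso h ((D.pull I (ptMap p)).mapIso e.symm)

lemma sqProp_pull (f : P →o Q) (X : D.Dia I Q) (sq : Sq →o P) :
    SqProp sq ((D.pull I f).obj X) ↔ SqProp (f.comp sq) X :=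
  ⟨fun h ↦ LanProp.of_iso h ((D.pullComp I sq f).app X).symm,
    fun h ↦ LanProp.of_iso h ((D.pullComp I sq f).app X)⟩

lemma SqProp.of_iso {X Y : D.Dia I P} {sq : Sq →o P} (h : SqProp sq X) (e : X ≅ Y) :
    SqProp sq Y := LanProp.of_iso h ((D.pull I sq).mapIso e)

lemma IsZeroAt.isIso {X Y : D.Dia I P} {p : P} (hX : IsZeroAt X p) (hY : IsZeroAt Y p)
    (f : X ⟶ Y) : IsIso ((D.pull I (ptMap p)).map f) :=
  ⟨(hX.iso hY).inv, hX.eq_of_src _ _, hY.eq_of_src _ _⟩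

variable [D.IsStable]

lemma isZero_of_unique_to {A : Cat.{u, u}} {X : D.obj (op A)}
    (h : ∀ Y, Nonempty (Unique (Y ⟶ X))) : Limits.IsZero X := by
  obtain ⟨O, hO⟩ := exists_isZero (D := D) A
  have hX : Limits.IsTerminal X := Limits.IsTerminal.ofUnique (h := fun Y ↦ (h Y).some)
  exact hO.of_iso (hX.uniqueUpToIso hO.isTerminal)

/-- The map from the empty poset. -/
def emptyMap (P : Type) [Preorder P] : Empty →o P := ⟨fun x ↦ x.elim, fun x ↦ x.elim⟩

lemma isEmpty_times_empty : IsEmpty (Cat.of (shape.{u} Empty × I)) :=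
  ⟨fun x ↦ (AsSmall.down.obj x.1 : Empty).elim⟩

/-- The slice at `p` is empty, so the value is initial, which in the pointed case means zero. -/
lemma LanProp.isZeroAt {S : Type} [Preorder S] {u : S →o P} {Y : D.Dia I P} (h : LanProp u Y)
    {p : P} (hp : ∀ s, ¬ u s ≤ p) : IsZeroAt Y p := by
  have H : IsExact (emptyMap S) u (emptyMap Unit) (ptMap p) := fun e ↦
    ⟨Empty, _, OrderHom.id, isGoodSlice_empty (fun a ↦ a.elim) _, isGoodSlice_empty hp _⟩
  have h' := h.exact H (OrderHom.ext _ _ (funext fun x ↦ x.elim))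
  have := isEmpty_times_empty (I := I)
  refine isZero_of_unique (D := D) fun Y' ↦ ?_
  have := (D.nonempty_unique_hom ((D.pull I (emptyMap Unit)).obj ((D.pull I (ptMap p)).obj Y))
    ((D.pull I (emptyMap Unit)).obj Y')).some
  exact ⟨(Equiv.ofBijective _ (h'.bijective Y')).unique⟩

lemma RanProp.isZeroAt {S : Type} [Preorder S] {u : S →o P} {Y : D.Dia I P} (h : RanProp u Y)
    {p : P} (hp : ∀ s, ¬ p ≤ u s) : IsZeroAt Y p := by
  have H : IsExact (emptyMap Unit) (ptMap p) (emptyMap S) u := fun e ↦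
    ⟨Empty, _, OrderHom.id, isGoodSlice_empty (fun a ↦ a.elim) _,
      isGoodSlice_empty (fun _ ↦ hp e) _⟩
  have h' := h.exact H (OrderHom.ext _ _ (funext fun x ↦ x.elim))
  have := isEmpty_times_empty (I := I)
  refine isZero_of_unique_to (D := D) fun Y' ↦ ?_
  have := (D.nonempty_unique_hom ((D.pull I (emptyMap Unit)).obj Y')
    ((D.pull I (emptyMap Unit)).obj ((D.pull I (ptMap p)).obj Y))).some
  exact ⟨(Equiv.ofBijective _ (h'.bijective Y')).unique⟩

end

section
variable {P S : Type} [PartialOrder P] [Preorder S] {u : S →o P} [D.IsDerivator]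

/-- The complement of a point. -/
abbrev coPt (p : P) : {x : P // x ≠ p} →o P := OrderHom.Subtype.val _

/-- By `LanProp.of_comp` the diagram is also extended from the complement of `p`, and for this
extension the span is cofinal in the slice at `p`. -/
lemma LanProp.sqProp {Y : D.Dia I P} (h : LanProp u Y) {p : P} (hp : ∀ s, u s ≠ p)
    {sq : Sq →o P} (hsq : PushoutCorner p sq) : SqProp sq Y := by
  let u' : S →o {x : P // x ≠ p} := ⟨fun s ↦ ⟨u s, hp s⟩, fun _ _ h ↦ u.monotone h⟩
  have h₁ : LanProp (coPt p) Y := LanProp.of_comp (u := u') (t := coPt p) (fun _ _ h ↦ h) h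
  let sq' : SqUL →o {x : P // x ≠ p} :=
    ⟨fun y ↦ ⟨sq y.1, hsq.ne y.1 y.2⟩, fun _ _ h ↦ sq.monotone h⟩
  have H : IsExact sq' (coPt p) spanMap sq := fun e ↦ by
    refine ⟨_, _, _, isGoodSlice_self _ e, fun y ↦ sq.monotone y.2, fun a ha ↦ ?_⟩
    have hle : sq e ≤ p := by
      rw [← hsq.corner]
      exact sq.monotone ⟨Fin.le_last _, Fin.le_last _⟩
    obtain ⟨y, hy, hy', hy''⟩ := hsq.least a.1 (le_trans ha hle) a.2
    refine ⟨⟨⟨y, hy⟩, ?_⟩, hy', fun z hz ↦ hy'' z.1.1 z.1.2 hz⟩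
    by_cases he : e = (1, 1)
    · rw [he]
      exact ⟨Fin.le_last _, Fin.le_last _⟩
    · exact hy'' e he ha
  exact h₁.exact H rfl

lemma RanProp.ranProp_cospan {Y : D.Dia I P} (h : RanProp u Y) {p : P} (hp : ∀ s, u s ≠ p)
    {sq : Sq →o P} (hsq : PullbackCorner p sq) : RanProp cospanMap ((D.pull I sq).obj Y) := by
  let u' : S →o {x : P // x ≠ p} := ⟨fun s ↦ ⟨u s, hp s⟩, fun _ _ h ↦ u.monotone h⟩
  have h₁ : RanProp (coPt p) Y := RanProp.of_comp (u := u') (t := coPt p) (fun _ _ h ↦ h) h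
  let sq' : SqLR →o {x : P // x ≠ p} :=
    ⟨fun y ↦ ⟨sq y.1, hsq.ne y.1 y.2⟩, fun _ _ h ↦ sq.monotone h⟩
  have H : IsExact cospanMap sq sq' (coPt p) := fun e ↦ by
    -- Right extensions are tested on slices below the elements `e ≠ p`. If `p ≤ e`, both slices
    -- have the same greatest element; otherwise both are empty.
    by_cases he : p ≤ e.1
    · obtain ⟨y, hy, hy', hy''⟩ := hsq.greatest e.1 he e.2
      refine ⟨Unit, inferInstance, ⟨fun _ ↦ ⟨y, hy⟩, fun _ _ _ ↦ le_rfl⟩,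
        ⟨fun _ ↦ hy', fun z hz ↦ ⟨(), hy'' z.1 z.2 hz, fun _ _ ↦ le_rfl⟩⟩,
        ⟨fun _ ↦ hy', fun z hz ↦ ⟨(), ?_, fun _ _ ↦ le_rfl⟩⟩⟩
      by_cases hz' : z = (0, 0)
      · rw [hz']
        exact ⟨Fin.zero_le _, Fin.zero_le _⟩
      · exact hy'' z hz' hz
    · have he' : ∀ a, ¬ sq a ≤ e.1 := fun a ha ↦ he
        ((hsq.corner.symm.le.trans (sq.monotone ⟨Fin.zero_le _, Fin.zero_le _⟩)).trans ha)
      exact ⟨Empty, _, emptyMap _, isGoodSlice_empty (fun a ↦ he' a.1) _,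
        isGoodSlice_empty he' _⟩
  exact h₁.exact H rfl

lemma RanProp.sqProp [D.IsStable] {Y : D.Dia I P} (h : RanProp u Y) {p : P} (hp : ∀ s, u s ≠ p)
    {sq : Sq →o P} (hsq : PullbackCorner p sq) : SqProp sq Y :=
  (lanProp_span_iff _).2 (h.ranProp_cospan hp hsq)

variable [D.IsStable]

/-- A pointwise criterion for a diagram to be a left Kan extension. -/
theorem lanProp_of_local (hu : ∀ a b, u a ≤ u b → a ≤ b) (μ : P → ℕ) {X : D.Dia I P}
    (h : ∀ p, (∀ s, u s ≠ p) → (IsZeroAt X p ∧ ∀ s, ¬ u s ≤ p) ∨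
      ∃ sq : Sq →o P, PushoutCorner p sq ∧ SqProp sq X ∧
        ∀ y, y ≠ (1, 1) → (∃ s, u s = sq y) ∨ μ (sq y) < μ p) : LanProp u X := by
  obtain ⟨Y, hY, ⟨e⟩⟩ := exists_lanProp (D := D) (I := I) hu ((D.pull I u).obj X)
  obtain ⟨f, hf⟩ := (hY.bijective X).2 e.hom
  dsimp only at hf
  have h₁ : IsIso ((D.pull I u).map f) := hf ▸ inferInstance
  have hS (s : S) : IsIso ((D.pull I (ptMap (u s))).map f) :=
    (isIso_pull_comp (f := ptMap s) (g := u) f).1 inferInstance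
  -- Induction on `μ`. On the span the comparison `f` is invertible, because each value lies in the
  -- image of `u` or has smaller measure. Both squares are cocartesian, so `f` is also invertible at
  -- the last corner.
  have key (n : ℕ) : ∀ p, μ p = n → IsIso ((D.pull I (ptMap p)).map f) := by
    induction n using Nat.strong_induction_on with
    | _ n ih =>
      intro p hn
      by_cases hp : ∃ s, u s = p
      · obtain ⟨s, rfl⟩ := hp
        exact hS s
      push Not at hp
      rcases h p hp with ⟨h₂, h₃⟩ | ⟨sq, h₂, h₃, h₄⟩
      · exact IsZeroAt.isIso (hY.isZeroAt h₃) h₂ f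
      · have h₅ : IsIso ((D.pull I spanMap).map ((D.pull I sq).map f)) :=
          isIso_of_pull_ptMap _ fun y ↦ by
            rw [isIso_pull_comp, isIso_pull_comp]
            rcases h₄ y.1 y.2 with ⟨s, hs⟩ | hs
            · have := hS s
              rw [hs] at this
              exact this
            · exact ih _ (hn ▸ hs) (sq y.1) rfl
        have h₆ : IsIso ((D.pull I sq).map f) := (hY.sqProp hp h₂).isIso h₃ _
        have h₇ := (isIso_pull_comp (f := ptMap (1, 1)) (g := sq) f).1 inferInstance
        obtain rfl := h₂.corner
        exact h₇
  have : IsIso f := isIso_of_pull_ptMap f fun p ↦ key _ p rfl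
  exact hY.of_iso (asIso f)

/-- A pointwise criterion for a diagram to be a right Kan extension. -/
theorem ranProp_of_local (hu : ∀ a b, u a ≤ u b → a ≤ b) (μ : P → ℕ) {X : D.Dia I P}
    (h : ∀ p, (∀ s, u s ≠ p) → (IsZeroAt X p ∧ ∀ s, ¬ p ≤ u s) ∨
      ∃ sq : Sq →o P, PullbackCorner p sq ∧ SqProp sq X ∧
        ∀ y, y ≠ (0, 0) → (∃ s, u s = sq y) ∨ μ (sq y) < μ p) : RanProp u X := by
  obtain ⟨Y, hY, ⟨e⟩⟩ := exists_ranProp (D := D) (I := I) hu ((D.pull I u).obj X)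
  obtain ⟨f, hf⟩ := (hY.bijective X).2 e.inv
  dsimp only at hf
  have h₁ : IsIso ((D.pull I u).map f) := hf ▸ inferInstance
  have hS (s : S) : IsIso ((D.pull I (ptMap (u s))).map f) :=
    (isIso_pull_comp (f := ptMap s) (g := u) f).1 inferInstance
  -- The same induction with cospans; stability turns the hypothesis on `X` into cartesianness.
  have key (n : ℕ) : ∀ p, μ p = n → IsIso ((D.pull I (ptMap p)).map f) := by
    induction n using Nat.strong_induction_on with
    | _ n ih =>
      intro p hn
      by_cases hp : ∃ s, u s = p
      · obtain ⟨s, rfl⟩ := hp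
        exact hS s
      push Not at hp
      rcases h p hp with ⟨h₂, h₃⟩ | ⟨sq, h₂, h₃, h₄⟩
      · exact IsZeroAt.isIso h₂ (hY.isZeroAt h₃) f
      · have h₅ : IsIso ((D.pull I cospanMap).map ((D.pull I sq).map f)) :=
          isIso_of_pull_ptMap _ fun y ↦ by
            rw [isIso_pull_comp, isIso_pull_comp]
            rcases h₄ y.1 y.2 with ⟨s, hs⟩ | hs
            · have := hS s
              rw [hs] at this
              exact this
            · exact ih _ (hn ▸ hs) (sq y.1) rfl
        have h₆ : IsIso ((D.pull I sq).map f) :=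
          RanProp.isIso ((lanProp_span_iff _).1 h₃) (hY.ranProp_cospan hp h₂) _
        have h₇ := (isIso_pull_comp (f := ptMap (0, 0)) (g := sq) f).1 inferInstance
        obtain rfl := h₂.corner
        exact h₇
  have : IsIso f := isIso_of_pull_ptMap f fun p ↦ key _ p rfl
  exact hY.of_iso (asIso f).symm

end
end
lemma Mesh.le_iff {n : ℕ} (a b : Mesh n) : a ≤ b ↔ a.k ≤ b.k ∧ a.k + a.l ≤ b.k + b.l := Iff.rfl

lemma OrderHom.sq_ext {P : Type} [Preorder P] {f g : Sq →o P} (h₁ : f (0, 0) = g (0, 0))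
    (h₂ : f (1, 0) = g (1, 0)) (h₃ : f (0, 1) = g (0, 1)) (h₄ : f (1, 1) = g (1, 1)) : f = g := by
  refine OrderHom.ext _ _ (funext fun y ↦ ?_)
  rcases Sq.cases y with rfl | rfl | rfl | rfl <;> assumption

section
variable {D : Prederivator.{u, v, w}} {I : Cat.{u, u}} [D.IsDerivator] {P Q R : Type}
  [Preorder P] [Preorder Q] [Preorder R]

/-- The restriction `f^*` is bijective on morphisms `X ⟶ Y`. -/
def BijOn (f : P →o Q) (X Y : D.Dia I Q) : Prop :=
  Function.Bijective fun φ : X ⟶ Y ↦ (D.pull I f).map φ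

lemma BijOn.comp {f : P →o Q} {g : Q →o R} {X Y : D.Dia I R} (h : BijOn g X Y)
    (h' : BijOn f ((D.pull I g).obj X) ((D.pull I g).obj Y)) : BijOn (g.comp f) X Y := by
  have h₁ : Function.Bijective fun φ : X ⟶ Y ↦ (D.pull I f).map ((D.pull I g).map φ) :=
    Function.Bijective.comp h' h
  let e := D.pullComp I f g
  have h₂ : (fun φ : X ⟶ Y ↦ (D.pull I (g.comp f)).map φ) =
      fun φ ↦ e.hom.app X ≫ (D.pull I f).map ((D.pull I g).map φ) ≫ e.inv.app Y :=
    funext fun φ ↦ (NatIso.naturality_2 e φ).symm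
  have h₃ : Function.Bijective fun t : (D.pull I f).obj ((D.pull I g).obj X) ⟶
      (D.pull I f).obj ((D.pull I g).obj Y) ↦ e.hom.app X ≫ t ≫ e.inv.app Y :=
    ((e.app X).symm.homCongr (e.app Y).symm).bijective
  rw [BijOn, h₂]
  exact Function.Bijective.comp (g := fun t ↦ e.hom.app X ≫ t ≫ e.inv.app Y) h₃ h₁

lemma LanProp.bijOn {f : P →o Q} {X : D.Dia I Q} (h : LanProp f X) (Y : D.Dia I Q) :
    BijOn f X Y := h.bijective Y

lemma RanProp.bijOn {f : P →o Q} {Y : D.Dia I Q} (h : RanProp f Y) (X : D.Dia I Q) :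
    BijOn f X Y := h.bijective X

end

/-! ### The mesh category -/

section mesh
variable (n : ℕ)

/-- The objects `(k,l)` of the mesh category with `k ≥ 0`, and the zero positions. -/
abbrev MeshUpper : Type := {x : Mesh n // 0 ≤ x.k ∨ x.l = 0 ∨ x.l = n + 1}

/-- The image of `A_n` in the mesh category, and the zero positions to the right of it. -/
abbrev MeshSlice : Type :=
  {x : MeshUpper n // (x.1.k = 0 ∧ 1 ≤ x.1.l) ∨ (x.1.l = 0 ∧ 1 ≤ x.1.k) ∨
    (x.1.l = n + 1 ∧ 0 ≤ x.1.k)}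

/-- The inclusion of `MeshUpper` into the mesh category. -/
abbrev meshUpperIncl : MeshUpper n →o Mesh n := OrderHom.Subtype.val _

/-- The inclusion of `MeshSlice` into `MeshUpper`. -/
abbrev meshSliceIncl : MeshSlice n →o MeshUpper n := OrderHom.Subtype.val _

/-- The inclusion of `A_n` into `MeshSlice`. -/
def anIncl : An n →o MeshSlice n where
  toFun i := ⟨⟨iMap n i, Or.inl le_rfl⟩, Or.inl ⟨rfl, Int.ofNat_le.2 i.2.1⟩⟩
  monotone' _ _ h := (iMap n).monotone h

variable {n}

lemma iMap_k (i : An n) : (iMap n i).k = 0 := rfl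
lemma iMap_l (i : An n) : (iMap n i).l = i.1 := rfl
lemma square_k (k l : ℤ) (h : 1 ≤ l ∧ l ≤ n) (y : Sq) :
    (Mesh.square n k l h y).k = k + (y.2 : ℕ) := rfl
lemma square_l (k l : ℤ) (h : 1 ≤ l ∧ l ≤ n) (y : Sq) :
    (Mesh.square n k l h y).l = l + (y.1 : ℕ) - (y.2 : ℕ) := rfl

lemma anIncl_le {a b : An n} (h : anIncl n a ≤ anIncl n b) : a ≤ b := by
  have h' : iMap n a ≤ iMap n b := h
  have := h'.2
  simp only [iMap_k, iMap_l] at this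
  exact Subtype.coe_le_coe.1 (by lia)

lemma meshSlice_cases (p : MeshSlice n) (hp : ∀ s, anIncl n s ≠ p) :
    (p.1.1.l = 0 ∧ 1 ≤ p.1.1.k) ∨ (p.1.1.l = n + 1 ∧ 0 ≤ p.1.1.k) := by
  obtain ⟨⟨⟨k, l, h₀, h₁⟩, h₂⟩, h₃⟩ := p
  dsimp only at *
  rcases h₃ with ⟨h₃, h₄⟩ | h₃ | h₃
  · right
    by_contra h
    refine hp ⟨l.toNat, by lia, by lia⟩ (Subtype.ext (Subtype.ext (Mesh.ext h₃.symm ?_)))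
    exact Int.toNat_of_nonneg h₀
  · exact Or.inl h₃
  · exact Or.inr h₃

/-- The zeros of `MeshSlice` lie to the right of the image of `A_n`; this is why they are filled in
by a right Kan extension. -/
lemma not_le_anIncl (p : MeshSlice n) (hp : (p.1.1.l = 0 ∧ 1 ≤ p.1.1.k) ∨
    (p.1.1.l = n + 1 ∧ 0 ≤ p.1.1.k)) (s : An n) : ¬ p ≤ anIncl n s := by
  intro h
  have h' : p.1.1 ≤ iMap n s := h
  have h₁ := h'.1
  have h₂ := h'.2
  have := s.2.2
  simp only [iMap_k, iMap_l] at *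
  lia

lemma meshSliceIncl_ne (p : MeshUpper n) (hp : ∀ s, meshSliceIncl n s ≠ p) :
    (1 ≤ p.1.k ∧ 1 ≤ p.1.l ∧ p.1.l ≤ n) ∨ (p.1.k ≤ 0 ∧ p.1.l = 0) ∨ (p.1.k < 0 ∧ p.1.l = n + 1) := by
  have h : ¬ ((p.1.k = 0 ∧ 1 ≤ p.1.l) ∨ (p.1.l = 0 ∧ 1 ≤ p.1.k) ∨ (p.1.l = n + 1 ∧ 0 ≤ p.1.k)) :=
    fun h ↦ hp ⟨p, h⟩ rfl
  have h₁ := p.2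
  have h₂ := p.1.l_nonneg
  have h₃ := p.1.l_le
  lia

/-- The zeros of `MeshUpper` outside of the slice lie to its left, so a left Kan extension vanishes
there. -/
lemma not_meshSliceIncl_le (p : MeshUpper n) (hp : (p.1.k ≤ 0 ∧ p.1.l = 0) ∨
    (p.1.k < 0 ∧ p.1.l = n + 1)) (s : MeshSlice n) : ¬ meshSliceIncl n s ≤ p := by
  intro h
  have h' : s.1.1 ≤ p.1 := h
  have h₁ := h'.1
  have h₂ := h'.2
  have h₃ := s.2
  have h₄ := s.1.1.l_nonneg
  lia

/-- The mesh squares with `k ≥ 0`. -/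
def upperSquare (k l : ℤ) (h : 1 ≤ l ∧ l ≤ n) (hk : 0 ≤ k) : Sq →o MeshUpper n where
  toFun y := ⟨Mesh.square n k l h y, Or.inl (by
    rw [square_k]
    lia)⟩
  monotone' _ _ h' := (Mesh.square n k l h).monotone h'

lemma upperSquare_coe (k l : ℤ) (h : 1 ≤ l ∧ l ≤ n) (hk : 0 ≤ k) (y : Sq) :
    (upperSquare k l h hk y).1 = Mesh.square n k l h y := rfl

lemma pushoutCorner_upperSquare (p : MeshUpper n) (hp : 1 ≤ p.1.k ∧ 1 ≤ p.1.l ∧ p.1.l ≤ n) :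
    PushoutCorner p (upperSquare (p.1.k - 1) p.1.l hp.2 (by lia)) := by
  set sq := upperSquare (p.1.k - 1) p.1.l hp.2 (by lia) with hsq
  have e : sq = mkSq (sq (0, 0)) (sq (1, 0)) (sq (0, 1)) (sq (1, 1)) (sq.monotone (by decide))
      (sq.monotone (by decide)) (sq.monotone (by decide)) (sq.monotone (by decide)) :=
    OrderHom.sq_ext rfl rfl rfl rfl
  have e' : sq (1, 1) = p := by
    refine Subtype.ext (Mesh.ext ?_ ?_) <;>
      simp [hsq, upperSquare_coe, square_k, square_l]
  rw [e]
  conv =>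
    enter [1]
    rw [← e']
  refine pushoutCorner_mkSq _ _ _ _ ?_ ?_ ?_
  · intro h
    have := congrArg (fun x ↦ x.1.k) h
    simp [hsq, upperSquare_coe, square_k, square_l] at this
  · intro h
    have := congrArg (fun x ↦ x.1.l) h
    simp [hsq, upperSquare_coe, square_k, square_l] at this
  · intro x hx hx'
    simp only [← Subtype.coe_le_coe, Mesh.le_iff, ne_eq, Subtype.ext_iff, Mesh.ext_iff] at *
    simp only [hsq, upperSquare_coe, square_k, square_l, Fin.isValue, Fin.val_zero,
      Fin.val_one] at *
    lia

lemma pullbackCorner_square (p : Mesh n) (hp : 1 ≤ p.l ∧ p.l ≤ n) :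
    PullbackCorner p (Mesh.square n p.k p.l hp) := by
  set sq := Mesh.square n p.k p.l hp with hsq
  have e : sq = mkSq (sq (0, 0)) (sq (1, 0)) (sq (0, 1)) (sq (1, 1)) (sq.monotone (by decide))
      (sq.monotone (by decide)) (sq.monotone (by decide)) (sq.monotone (by decide)) :=
    OrderHom.sq_ext rfl rfl rfl rfl
  have e' : sq (0, 0) = p := by
    refine Mesh.ext ?_ ?_ <;> simp [hsq, square_k, square_l]
  rw [e]
  conv =>
    enter [1]
    rw [← e']
  refine pullbackCorner_mkSq _ _ _ _ ?_ ?_ ?_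
  · intro h
    have := congrArg (fun x ↦ x.l) h
    simp [hsq, square_k, square_l] at this
  · intro h
    have := congrArg (fun x ↦ x.k) h
    simp [hsq, square_k, square_l] at this
  · intro x hx hx'
    simp only [Mesh.le_iff, ne_eq, Mesh.ext_iff] at *
    simp only [hsq, square_k, square_l, Fin.isValue, Fin.val_zero, Fin.val_one] at *
    lia

variable {D : Prederivator.{u, v, w}} {I : Cat.{u, u}} [D.IsDerivator] [D.IsStable]

/-- The condition defining `𝒟^{M_n,ex}`. -/
def IsMeshExact (X : D.Dia I (Mesh n)) : Prop :=
  (∀ x : Mesh n, x.l = 0 ∨ x.l = n + 1 → IsZeroAt X x) ∧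
    ∀ (k l : ℤ) (h : 1 ≤ l ∧ l ≤ n), SqProp (Mesh.square n k l h) X

lemma meshEx_iff (I : (Cat.{u, u})ᵒᵖ) (X : D.Dia I.unop (Mesh n)) :
    (D.meshEx n).prop I X ↔ IsMeshExact X :=
  and_congr (forall₂_congr fun x _ ↦ vanishesAt_iff x I X)
    (forall₃_congr fun k l h ↦ liesInImage_iff (u := spanMap) (fun _ _ h ↦ h) _ I X)

namespace IsMeshExact
variable {X : D.Dia I (Mesh n)} (hX : IsMeshExact X)
include hX

lemma ranProp : RanProp (meshUpperIncl n) X := by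
  -- Along both generating arrows `2k + l` grows by one. For `k < 0` and `l ≤ n` it is less than `n
  -- + 1`, so the truncation to `ℕ` keeps the measure strictly decreasing.
  refine ranProp_of_local (fun _ _ h ↦ h) (fun p ↦ ((n : ℤ) + 1 - 2 * p.k - p.l).toNat) fun p hp ↦ ?_
  have hp' : ¬ (0 ≤ p.k ∨ p.l = 0 ∨ p.l = n + 1) := fun h ↦ hp ⟨p, h⟩ rfl
  have h₀ := p.l_nonneg
  have h₁ := p.l_le
  have hl : 1 ≤ p.l ∧ p.l ≤ n := by lia
  refine Or.inr ⟨_, pullbackCorner_square p hl, hX.2 _ _ _, fun y hy ↦ Or.inr ?_⟩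
  simp only [square_k, square_l]
  rcases Sq.cases y with rfl | rfl | rfl | rfl
  · exact (hy rfl).elim
  all_goals simp only [Fin.isValue, Fin.val_zero, Fin.val_one] at *; lia

/-- For `k ≥ 1` and `1 ≤ l ≤ n` the mesh square ending at `(k,l)` stays in the part `k ≥ 0` and is
cocartesian. The other missing objects are zeros with empty slice. -/
lemma lanProp : LanProp (meshSliceIncl n) ((D.pull I (meshUpperIncl n)).obj X) := by
  refine lanProp_of_local (fun _ _ h ↦ h) (fun p ↦ (2 * p.1.k + p.1.l).toNat) fun p hp ↦ ?_
  rcases meshSliceIncl_ne p hp with h | h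
  · refine Or.inr ⟨_, pushoutCorner_upperSquare p h, ?_, fun y hy ↦ Or.inr ?_⟩
    · rw [sqProp_pull]
      exact hX.2 _ _ h.2
    · simp only [upperSquare_coe, square_k, square_l]
      rcases Sq.cases y with rfl | rfl | rfl | rfl
      case _ => simp only [Fin.isValue, Fin.val_zero, Fin.val_one] at *; lia
      case _ => simp only [Fin.isValue, Fin.val_zero, Fin.val_one] at *; lia
      case _ => simp only [Fin.isValue, Fin.val_zero, Fin.val_one] at *; lia
      exact (hy rfl).elim
  · refine Or.inl ⟨?_, not_meshSliceIncl_le p h⟩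
    rw [isZeroAt_pull]
    exact hX.1 _ (h.imp (fun h ↦ h.2) fun h ↦ h.2)

lemma ranProp_anIncl : RanProp (anIncl n)
    ((D.pull I (meshSliceIncl n)).obj ((D.pull I (meshUpperIncl n)).obj X)) := by
  refine ranProp_of_local (fun _ _ h ↦ anIncl_le h) (fun _ ↦ 0) fun p hp ↦ Or.inl ?_
  have h := meshSlice_cases p hp
  refine ⟨?_, not_le_anIncl p h⟩
  rw [isZeroAt_pull, isZeroAt_pull]
  exact hX.1 _ (h.imp (fun h ↦ h.1) fun h ↦ h.1)

/-- Of the three restrictions, the first and the last are bijective because `Y` is right extended,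
the middle one because `X` is left extended. -/
lemma bijOn_iMap {Y : D.Dia I (Mesh n)} (hY : IsMeshExact Y) : BijOn (iMap n) X Y := by
  have h₁ := (hX.lanProp.bijOn ((D.pull I (meshUpperIncl n)).obj Y)).comp
    (hY.ranProp_anIncl.bijOn _)
  have h₂ := (hY.ranProp.bijOn X).comp h₁
  have e : (meshUpperIncl n).comp ((meshSliceIncl n).comp (anIncl n)) = iMap n :=
    OrderHom.ext _ _ (funext fun _ ↦ Mesh.ext rfl rfl)
  exact e ▸ h₂

end IsMeshExact

/-- Extension by zero to the right, then pushouts for `k ≥ 0`, then pullbacks for `k < 0`. Each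
extension is along an embedding, so the earlier values persist. -/
lemma exists_isMeshExact (Z : D.Dia I (An n)) :
    ∃ X : D.Dia I (Mesh n), IsMeshExact X ∧ Nonempty ((D.pull I (iMap n)).obj X ≅ Z) := by
  obtain ⟨Z₁, h₁, ⟨e₁⟩⟩ := exists_ranProp (D := D) (I := I) (fun _ _ h ↦ anIncl_le h) Z
  obtain ⟨Z₂, h₂, ⟨e₂⟩⟩ := exists_lanProp (D := D) (I := I) (u := meshSliceIncl n) (fun _ _ h ↦ h) Z₁
  obtain ⟨X, h₃, ⟨e₃⟩⟩ := exists_ranProp (D := D) (I := I) (u := meshUpperIncl n) (fun _ _ h ↦ h) Z₂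
  refine ⟨X, ⟨fun x hx ↦ ?_, fun k l h ↦ ?_⟩, ⟨?_⟩⟩
  · refine (isZeroAt_pull (meshUpperIncl n) X ⟨x, Or.inr hx⟩).1 (IsZeroAt.of_iso ?_ e₃.symm)
    -- All zero positions belong to `MeshUpper`, so the last extension does not touch them. Those in
    -- `MeshSlice` are zero by the first extension, the others by the second.
    by_cases hx' : ∃ s, meshSliceIncl n s = ⟨x, Or.inr hx⟩
    · obtain ⟨s, hs⟩ := hx'
      rw [← hs]
      refine (isZeroAt_pull (meshSliceIncl n) Z₂ s).1 (IsZeroAt.of_iso ?_ e₂.symm)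
      refine h₁.isZeroAt (not_le_anIncl s ?_)
      have hs' : s.1.1 = x := congrArg Subtype.val hs
      have := s.2
      rw [hs'] at this ⊢
      lia
    · push Not at hx'
      have := meshSliceIncl_ne _ hx'
      dsimp only at this
      exact h₂.isZeroAt (not_meshSliceIncl_le _ (by dsimp only; lia))
  -- For `k ≥ 0` the last corner of the square is new in the left extension. For `k < 0` the first
  -- corner is new in the right extension, and stability makes that square cocartesian.
  · by_cases hk : 0 ≤ k
    · refine (sqProp_pull (meshUpperIncl n) X (upperSquare k l h hk)).1 (SqProp.of_iso ?_ e₃.symm)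
      let p : MeshUpper n := ⟨⟨k + 1, l, by lia, by lia⟩, Or.inl (by dsimp only; lia)⟩
      have h₄ := pushoutCorner_upperSquare p (by dsimp only [p]; lia)
      have h₅ : upperSquare (p.1.k - 1) p.1.l (by dsimp only [p]; lia) (by dsimp only [p]; lia) =
          upperSquare (n := n) k l h hk := by
        congr 1
        dsimp only [p]
        lia
      rw [h₅] at h₄
      refine h₂.sqProp (fun s hs ↦ ?_) h₄
      have h₆ := s.2
      have h₇ : s.1 = p := hs
      rw [h₇] at h₆
      dsimp only [p] at h₆
      lia
    · refine h₃.sqProp (fun s hs ↦ ?_) (pullbackCorner_square ⟨k, l, by lia, by lia⟩ h)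
      have h₆ := s.2
      have h₇ : s.1 = _ := hs
      rw [h₇] at h₆
      dsimp only at h₆
      lia
  · refine (D.pullComp I (anIncl n) ((meshUpperIncl n).comp (meshSliceIncl n))).app X ≪≫
      (D.pull I (anIncl n)).mapIso ((D.pullComp I (meshSliceIncl n) (meshUpperIncl n)).app X ≪≫ ?_) ≪≫
        e₁
    exact (D.pull I (meshSliceIncl n)).mapIso e₃ ≪≫ e₂

theorem iRes_isEquivalence (I : (Cat.{u, u})ᵒᵖ) :
    ((D.iRes n).app I).toFunctor.IsEquivalence := by
  have key (X Y : (D.meshEx n).fullsubcategory.obj I) :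
      Function.Bijective fun φ : X ⟶ Y ↦ ((D.iRes n).app I).toFunctor.map φ := by
    have h := ((meshEx_iff I X.1).1 X.2).bijOn_iMap ((meshEx_iff I Y.1).1 Y.2)
    refine Function.Bijective.comp (g := fun φ ↦ (D.pull I.unop (iMap n)).map φ) h (⟨fun _ _ h ↦ ObjectProperty.hom_ext _ h,
      fun f ↦ ⟨ObjectProperty.homMk f, rfl⟩⟩ : Function.Bijective fun φ : X ⟶ Y ↦ φ.hom)
  refine ⟨⟨fun h ↦ (key _ _).1 h⟩, ⟨fun f ↦ (key _ _).2 f⟩, ⟨fun Z ↦ ?_⟩⟩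
  obtain ⟨X, hX, ⟨e⟩⟩ := exists_isMeshExact (D := D) (I := I.unop) Z
  exact ⟨⟨X, (meshEx_iff I X).2 hX⟩, ⟨e⟩⟩

end mesh
-- Reflections, coreflections and invertible arrows
section sections
variable {D : Prederivator.{u, v, w}} {I : Cat.{u, u}} [D.IsDerivator] {P Q R : Type}
  [Preorder P] [Preorder Q] [Preorder R]

lemma lanProp_id (X : D.Dia I P) : LanProp OrderHom.id X :=
  isLan_of_isIso (D.pullId I P) (𝟙 ((D.pull I OrderHom.id).obj X))

lemma ranProp_id (X : D.Dia I P) : RanProp OrderHom.id X := fun Y ↦ by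
  have := (lanProp_id Y).bijOn X
  simpa [BijOn] using this

lemma BijOn.congr {f g : P →o Q} (h : f = g) {X Y : D.Dia I Q} (hf : BijOn f X Y) :
    BijOn g X Y := h ▸ hf

lemma BijOn.of_comp {f : P →o Q} {g : Q →o R} {X Y : D.Dia I R}
    (h : BijOn f ((D.pull I g).obj X) ((D.pull I g).obj Y)) (h' : BijOn (g.comp f) X Y) :
    BijOn g X Y := by
  let e := D.pullComp I f g
  have h₂ : (fun φ : X ⟶ Y ↦ (D.pull I (g.comp f)).map φ) =
      (fun t ↦ e.hom.app X ≫ t ≫ e.inv.app Y) ∘ (fun t ↦ (D.pull I f).map t) ∘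
        fun φ : X ⟶ Y ↦ (D.pull I g).map φ :=
    funext fun φ ↦ (NatIso.naturality_2 e φ).symm
  have h₃ : Function.Bijective fun t : (D.pull I f).obj ((D.pull I g).obj X) ⟶
      (D.pull I f).obj ((D.pull I g).obj Y) ↦ e.hom.app X ≫ t ≫ e.inv.app Y :=
    ((e.app X).symm.homCongr (e.app Y).symm).bijective
  rw [BijOn, h₂] at h'
  exact (Function.Bijective.of_comp_iff' h _).1 ((Function.Bijective.of_comp_iff' h₃ _).1 h')

section
variable {s : Q →o P} {k : P →o Q} (hks : ∀ q, k (s q) = q)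
include hks

lemma comp_eq_id : k.comp s = OrderHom.id := OrderHom.ext _ _ (funext hks)

/-- As `s` is left adjoint to `k`, the slice of `s` at `p` has the greatest element `k p`; so
extension along `s` is restriction along `k`. -/
lemma lanProp_of_coreflection (h : ∀ q p, s q ≤ p ↔ q ≤ k p) (X : D.Dia I Q) :
    LanProp s ((D.pull I k).obj X) := by
  have H : IsExact (OrderHom.id : Q →o Q) OrderHom.id s k := fun e ↦
    ⟨Unit, inferInstance, ⟨fun _ ↦ k e, fun _ _ _ ↦ le_rfl⟩,
      ⟨fun _ ↦ (h _ _).2 le_rfl, fun a ha ↦ ⟨(), (h _ _).1 ha, fun _ _ ↦ le_rfl⟩⟩,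
      ⟨fun _ ↦ le_rfl, fun a ha ↦ ⟨(), ha, fun _ _ ↦ le_rfl⟩⟩⟩
  exact (lanProp_id X).exact H (comp_eq_id hks).symm

lemma ranProp_of_reflection (h : ∀ p q, k p ≤ q ↔ p ≤ s q) (X : D.Dia I Q) :
    RanProp s ((D.pull I k).obj X) := by
  have H : IsExact s k (OrderHom.id : Q →o Q) OrderHom.id := fun e ↦
    ⟨Unit, inferInstance, ⟨fun _ ↦ e, fun _ _ _ ↦ le_rfl⟩,
      ⟨fun _ ↦ le_rfl, fun a ha ↦ ⟨(), ha, fun _ _ ↦ le_rfl⟩⟩,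
      ⟨fun _ ↦ (hks e).le, fun a ha ↦ ⟨(), (h _ _).1 ha, fun _ _ ↦ le_rfl⟩⟩⟩
  exact (ranProp_id X).exact H (comp_eq_id hks)

/-- Full faithfulness of `k^*`: the restriction along `s` is bijective on maps out of `k^* X`, and
the composite restriction is along the identity. -/
lemma bijOn_of_coreflection (h : ∀ q p, s q ≤ p ↔ q ≤ k p) (X Y : D.Dia I Q) : BijOn k X Y :=
  .of_comp ((lanProp_of_coreflection hks h X).bijOn _)
    (((lanProp_id X).bijOn Y).congr (comp_eq_id hks).symm)

lemma bijOn_of_reflection (h : ∀ p q, k p ≤ q ↔ p ≤ s q) (X Y : D.Dia I Q) : BijOn k X Y :=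
  .of_comp ((ranProp_of_reflection hks h Y).bijOn _)
    (((lanProp_id X).bijOn Y).congr (comp_eq_id hks).symm)

/-- Restricting to the section and back. -/
noncomputable def sectionIso (X : D.Dia I P) :
    (D.pull I s).obj ((D.pull I k).obj ((D.pull I s).obj X)) ≅ (D.pull I s).obj X :=
  ((D.pullComp I s k).symm ≪≫ D.pullEq I (comp_eq_id hks) ≪≫ D.pullId I Q).app _

end

/-- The map to the one-element poset. -/
def toUnit (P : Type) [Preorder P] : P →o Unit := ⟨fun _ ↦ (), fun _ _ _ ↦ le_rfl⟩

/-- The map `[1] ⟶ P` given by an inequality. -/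
def edgeMap {a b : P} (h : a ≤ b) : Fin 2 →o P where
  toFun i := if i = 0 then a else b
  monotone' i j hij := by
    fin_cases i <;> fin_cases j <;> simp_all

/-- The arrow of `X` given by an inequality is invertible. -/
def EdgeIso (X : D.Dia I P) {a b : P} (h : a ≤ b) : Prop :=
  (D.pull I (toUnit (Fin 2))).essImage ((D.pull I (edgeMap h)).obj X)

lemma edgeIso_pull (f : P →o Q) (X : D.Dia I Q) {a b : P} (h : a ≤ b) :
    EdgeIso ((D.pull I f).obj X) h ↔ EdgeIso X (f.monotone h) := by
  have e : f.comp (edgeMap h) = edgeMap (f.monotone h) :=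
    OrderHom.ext _ _ (funext fun i ↦ by fin_cases i <;> rfl)
  have e' := (D.pullComp I (edgeMap h) f).symm.app X ≪≫ (D.pullEq I e).app X
  exact ⟨fun h ↦ h.ofIso e', fun h ↦ h.ofIso e'.symm⟩

lemma EdgeIso.of_iso {X Y : D.Dia I P} {a b : P} {h : a ≤ b} (hX : EdgeIso X h) (e : X ≅ Y) :
    EdgeIso Y h := hX.ofIso ((D.pull I (edgeMap h)).mapIso e)

lemma edgeIso_of_eq (X : D.Dia I P) {a b : P} (h : a ≤ b) (hab : a = b) : EdgeIso X h := by
  subst hab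
  have e : edgeMap h = (ptMap a).comp (toUnit (Fin 2)) :=
    OrderHom.ext _ _ (funext fun i ↦ by fin_cases i <;> rfl)
  exact ⟨(D.pull I (ptMap a)).obj X,
    ⟨((D.pullEq I e) ≪≫ D.pullComp I (toUnit (Fin 2)) (ptMap a)).symm.app X⟩⟩

/-- A constant arrow is extended from its source, which is least in `[1]`; dually it is extended
from its target. Maps between such arrows are thus detected at either end. -/
lemma EdgeIso.lanProp {X : D.Dia I P} {a b : P} {h : a ≤ b} (hX : EdgeIso X h) :
    LanProp (ptMap (0 : Fin 2)) ((D.pull I (edgeMap h)).obj X) := by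
  obtain ⟨W, ⟨e⟩⟩ := hX
  exact (lanProp_of_coreflection (s := ptMap (0 : Fin 2)) (k := toUnit (Fin 2)) (fun _ ↦ rfl)
    (fun _ p ↦ ⟨fun _ ↦ le_rfl, fun _ ↦ Fin.zero_le p⟩) W).of_iso e

lemma EdgeIso.ranProp {X : D.Dia I P} {a b : P} {h : a ≤ b} (hX : EdgeIso X h) :
    RanProp (ptMap (1 : Fin 2)) ((D.pull I (edgeMap h)).obj X) := by
  obtain ⟨W, ⟨e⟩⟩ := hX
  exact (ranProp_of_reflection (s := ptMap (1 : Fin 2)) (k := toUnit (Fin 2)) (fun _ ↦ rfl)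
    (fun p _ ↦ ⟨fun _ ↦ Fin.le_last p, fun _ ↦ le_rfl⟩) W).of_iso e

lemma EdgeIso.isIso_target {X Y : D.Dia I P} {a b : P} {h : a ≤ b} (hX : EdgeIso X h)
    (hY : EdgeIso Y h) (f : X ⟶ Y) (ha : IsIso ((D.pull I (ptMap a)).map f)) :
    IsIso ((D.pull I (ptMap b)).map f) := by
  have : IsIso ((D.pull I (ptMap (0 : Fin 2))).map ((D.pull I (edgeMap h)).map f)) :=
    (isIso_pull_comp (f := ptMap (0 : Fin 2)) (g := edgeMap h) f).2 ha
  have := hX.lanProp.isIso hY.lanProp ((D.pull I (edgeMap h)).map f)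
  exact (isIso_pull_comp (f := ptMap (1 : Fin 2)) (g := edgeMap h) f).1 inferInstance

lemma EdgeIso.isIso_source {X Y : D.Dia I P} {a b : P} {h : a ≤ b} (hX : EdgeIso X h)
    (hY : EdgeIso Y h) (f : X ⟶ Y) (hb : IsIso ((D.pull I (ptMap b)).map f)) :
    IsIso ((D.pull I (ptMap a)).map f) := by
  have : IsIso ((D.pull I (ptMap (1 : Fin 2))).map ((D.pull I (edgeMap h)).map f)) :=
    (isIso_pull_comp (f := ptMap (1 : Fin 2)) (g := edgeMap h) f).2 hb
  have := hX.ranProp.isIso hY.ranProp ((D.pull I (edgeMap h)).map f)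
  exact (isIso_pull_comp (f := ptMap (0 : Fin 2)) (g := edgeMap h) f).1 inferInstance

section
variable {s : Q →o P} {k : P →o Q} (hks : ∀ q, k (s q) = q)
include hks

/-- A diagram that inverts the arrows `s (k p) ⟶ p` is pulled back along `k`. -/
lemma essImage_of_coreflection (h : ∀ q p, s q ≤ p ↔ q ≤ k p) (X : D.Dia I P)
    (hX : ∀ p, EdgeIso X ((h _ _).2 le_rfl : s (k p) ≤ p)) : (D.pull I k).essImage X := by
  -- The comparison `k^* s^* X ⟶ X` is invertible on the image of `s`. The inverted arrows `s (k p)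
  -- ≤ p` carry this to every `p`.
  obtain ⟨f, hf⟩ := ((lanProp_of_coreflection hks h ((D.pull I s).obj X)).bijective X).2
    (sectionIso hks X).hom
  dsimp only at hf
  have h₁ : IsIso ((D.pull I s).map f) := hf ▸ inferInstance
  have : IsIso f := isIso_of_pull_ptMap f fun p ↦ by
    refine EdgeIso.isIso_target (h := (h _ _).2 le_rfl) ?_ (hX p) f
      ((isIso_pull_comp (f := ptMap (k p)) (g := s) f).1 inferInstance)
    rw [edgeIso_pull]
    exact edgeIso_of_eq _ _ (hks _)
  exact ⟨_, ⟨asIso f⟩⟩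

/-- A diagram that inverts the arrows `p ⟶ s (k p)` is pulled back along `k`. -/
lemma essImage_of_reflection (h : ∀ p q, k p ≤ q ↔ p ≤ s q) (X : D.Dia I P)
    (hX : ∀ p, EdgeIso X ((h _ _).1 le_rfl : p ≤ s (k p))) : (D.pull I k).essImage X := by
  obtain ⟨f, hf⟩ := ((ranProp_of_reflection hks h ((D.pull I s).obj X)).bijective X).2
    (sectionIso hks X).inv
  dsimp only at hf
  have h₁ : IsIso ((D.pull I s).map f) := hf ▸ inferInstance
  have : IsIso f := isIso_of_pull_ptMap f fun p ↦ by
    refine EdgeIso.isIso_source (h := (h _ _).1 le_rfl) (hX p) ?_ f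
      ((isIso_pull_comp (f := ptMap (k p)) (g := s) f).1 inferInstance)
    rw [edgeIso_pull]
    exact edgeIso_of_eq _ _ (hks _).symm
  exact ⟨_, ⟨(asIso f).symm⟩⟩

end

/-- Outer squares of left Kan extensions. -/
lemma LanProp.sqProp_of_least {S : Type} [Preorder S] {u : S →o P} {Y : D.Dia I P}
    (h : LanProp u Y) (sq : Sq →o P) (c : SqUL →o S) (hc : ∀ y, u (c y) = sq y.1)
    (least : ∀ a, u a ≤ sq (1, 1) →
      ∃ y : SqUL, a ≤ c y ∧ ∀ y' : Sq, u a ≤ sq y' → y.1 ≤ y') : SqProp sq Y := by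
  have H : IsExact c u spanMap sq := fun e ↦ by
    refine ⟨_, _, _, isGoodSlice_self _ e,
      fun y ↦ (hc y.1).le.trans (sq.monotone y.2), fun a ha ↦ ?_⟩
    obtain ⟨y, hy, hy'⟩ := least a (ha.trans (sq.monotone ⟨Fin.le_last _, Fin.le_last _⟩))
    exact ⟨⟨y, hy' e ha⟩, hy, fun z hz ↦ hy' z.1.1 ((u.monotone hz).trans (hc _).le)⟩
  exact h.exact H (OrderHom.ext _ _ (funext hc))

end sections
-- Squares whose other corners lie in the source of the extension
section
variable {P S : Type} [PartialOrder P] [Preorder S]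

/-- The square `sq` computes left Kan extensions along `u` at its last corner. -/
structure IsPushoutSquare (u : S →o P) (sq : Sq →o P) : Prop where
  lift : ∀ y, y ≠ (1, 1) → ∃ s, u s = sq y
  least : ∀ a, u a ≤ sq (1, 1) →
    ∃ y, y ≠ (1, 1) ∧ u a ≤ sq y ∧ ∀ y', u a ≤ sq y' → y ≤ y'

/-- The square `sq` computes right Kan extensions along `u` at its first corner. -/
structure IsPullbackSquare (u : S →o P) (sq : Sq →o P) : Prop where
  lift : ∀ y, y ≠ (0, 0) → ∃ s, u s = sq y
  greatest : ∀ a, sq (0, 0) ≤ u a →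
    ∃ y, y ≠ (0, 0) ∧ sq y ≤ u a ∧ ∀ y', sq y' ≤ u a → y' ≤ y

variable {u : S →o P}

lemma isPushoutSquare_mkSq {a b c d : P} (hab : a ≤ b) (hac : a ≤ c) (hbd : b ≤ d) (hcd : c ≤ d)
    (ha : ∃ s, u s = a) (hb : ∃ s, u s = b) (hc : ∃ s, u s = c)
    (h : ∀ s, u s ≤ d → (u s ≤ b ∨ u s ≤ c) ∧ (u s ≤ b → u s ≤ c → u s ≤ a)) :
    IsPushoutSquare u (mkSq a b c d hab hac hbd hcd) where
  lift y hy := by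
    rcases Sq.cases y with rfl | rfl | rfl | rfl
    exacts [ha, hb, hc, (hy rfl).elim]
  least s hs := by
    obtain ⟨h₁, h₂⟩ := h s hs
    by_cases ha : u s ≤ a
    · exact ⟨(0, 0), by decide, ha, fun y' _ ↦ ⟨Fin.zero_le _, Fin.zero_le _⟩⟩
    rcases h₁ with h₁ | h₁
    · refine ⟨(1, 0), by decide, h₁, fun y' h' ↦ ?_⟩
      rcases Sq.cases y' with rfl | rfl | rfl | rfl
      · exact (ha h').elim
      · exact le_rfl
      · exact (ha (h₂ h₁ h')).elim
      · decide
    · refine ⟨(0, 1), by decide, h₁, fun y' h' ↦ ?_⟩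
      rcases Sq.cases y' with rfl | rfl | rfl | rfl
      · exact (ha h').elim
      · exact (ha (h₂ h' h₁)).elim
      · exact le_rfl
      · decide

lemma isPullbackSquare_mkSq {a b c d : P} (hab : a ≤ b) (hac : a ≤ c) (hbd : b ≤ d) (hcd : c ≤ d)
    (hb : ∃ s, u s = b) (hc : ∃ s, u s = c) (hd : ∃ s, u s = d)
    (h : ∀ s, a ≤ u s → (b ≤ u s ∨ c ≤ u s) ∧ (b ≤ u s → c ≤ u s → d ≤ u s)) :
    IsPullbackSquare u (mkSq a b c d hab hac hbd hcd) where
  lift y hy := by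
    rcases Sq.cases y with rfl | rfl | rfl | rfl
    exacts [(hy rfl).elim, hb, hc, hd]
  greatest s hs := by
    obtain ⟨h₁, h₂⟩ := h s hs
    by_cases hd : d ≤ u s
    · exact ⟨(1, 1), by decide, hd, fun y' _ ↦ ⟨Fin.le_last _, Fin.le_last _⟩⟩
    rcases h₁ with h₁ | h₁
    · refine ⟨(1, 0), by decide, h₁, fun y' h' ↦ ?_⟩
      rcases Sq.cases y' with rfl | rfl | rfl | rfl
      · decide
      · exact le_rfl
      · exact (hd (h₂ h₁ h')).elim
      · exact (hd h').elim
    · refine ⟨(0, 1), by decide, h₁, fun y' h' ↦ ?_⟩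
      rcases Sq.cases y' with rfl | rfl | rfl | rfl
      · decide
      · exact (hd (h₂ h' h₁)).elim
      · exact le_rfl
      · exact (hd h').elim

variable {D : Prederivator.{u, v, w}} {I : Cat.{u, u}} [D.IsDerivator]
  (hu : ∀ a b, u a ≤ u b → a ≤ b)
include hu

lemma IsPushoutSquare.sqProp {sq : Sq →o P} (hsq : IsPushoutSquare u sq) {Y : D.Dia I P}
    (h : LanProp u Y) : SqProp sq Y := by
  choose c hc using fun y : SqUL ↦ hsq.lift y.1 y.2
  refine h.sqProp_of_least sq ⟨c, fun y y' hy ↦ hu _ _ ?_⟩ hc fun a ha ↦ ?_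
  · rw [hc, hc]
    exact sq.monotone hy
  · obtain ⟨y, hy, hy', hy''⟩ := hsq.least a ha
    exact ⟨⟨y, hy⟩, hu _ _ (hy'.trans (hc ⟨y, hy⟩).ge), hy''⟩

lemma IsPullbackSquare.ranProp {sq : Sq →o P} (hsq : IsPullbackSquare u sq) {Y : D.Dia I P}
    (h : RanProp u Y) : RanProp cospanMap ((D.pull I sq).obj Y) := by
  choose c hc using fun y : SqLR ↦ hsq.lift y.1 y.2
  let c' : SqLR →o S := ⟨c, fun y y' hy ↦ hu _ _ (by
    rw [hc, hc]
    exact sq.monotone hy)⟩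
  have H : IsExact cospanMap sq c' u := fun e ↦ by
    by_cases he : sq (0, 0) ≤ u e
    · obtain ⟨y, hy, hy', hy''⟩ := hsq.greatest e he
      exact ⟨Unit, inferInstance, ⟨fun _ ↦ ⟨y, hy⟩, fun _ _ _ ↦ le_rfl⟩,
        ⟨fun _ ↦ hu _ _ ((hc ⟨y, hy⟩).le.trans hy'),
          fun z hz ↦ ⟨(), hy'' z.1 ((hc z).ge.trans (u.monotone hz)), fun _ _ ↦ le_rfl⟩⟩,
        ⟨fun _ ↦ hy', fun z hz ↦ ⟨(), hy'' z hz, fun _ _ ↦ le_rfl⟩⟩⟩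
    · have he' : ∀ a, ¬ sq a ≤ u e := fun a ha ↦ he
        ((sq.monotone ⟨Fin.zero_le _, Fin.zero_le _⟩).trans ha)
      exact ⟨Empty, _, emptyMap _,
        isGoodSlice_empty (fun a ha ↦ he' a.1 ((hc a).ge.trans (u.monotone ha))) _,
        isGoodSlice_empty he' _⟩
  exact h.exact H (OrderHom.ext _ _ (funext fun y ↦ (hc y).symm))

variable [D.IsStable]

/-- Here the span is compared with the slice of `u` itself instead of all elements below `p`. This
is needed for the stages: below a missing object `(1,1,z)` there are other missing objects of
smaller height. As the span lies in the image of `u`, no induction is required. -/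
lemma lanProp_of_squares {X : D.Dia I P} (h : ∀ p, (∀ s, u s ≠ p) →
    (IsZeroAt X p ∧ ∀ s, ¬ u s ≤ p) ∨
      ∃ sq : Sq →o P, sq (1, 1) = p ∧ IsPushoutSquare u sq ∧ SqProp sq X) : LanProp u X := by
  obtain ⟨Y, hY, ⟨e⟩⟩ := exists_lanProp (D := D) (I := I) hu ((D.pull I u).obj X)
  obtain ⟨f, hf⟩ := (hY.bijective X).2 e.hom
  dsimp only at hf
  have h₁ : IsIso ((D.pull I u).map f) := hf ▸ inferInstance
  have hS (p : P) (hp : ∃ s, u s = p) : IsIso ((D.pull I (ptMap p)).map f) := by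
    obtain ⟨s, rfl⟩ := hp
    exact (isIso_pull_comp (f := ptMap s) (g := u) f).1 inferInstance
  have : IsIso f := isIso_of_pull_ptMap f fun p ↦ by
    by_cases hp : ∃ s, u s = p
    · exact hS p hp
    push Not at hp
    rcases h p hp with ⟨h₂, h₃⟩ | ⟨sq, rfl, h₂, h₃⟩
    · exact IsZeroAt.isIso (hY.isZeroAt h₃) h₂ f
    · have h₅ : IsIso ((D.pull I spanMap).map ((D.pull I sq).map f)) :=
        isIso_of_pull_ptMap _ fun y ↦ by
          rw [isIso_pull_comp, isIso_pull_comp]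
          exact hS _ (h₂.lift y.1 y.2)
      have h₆ : IsIso ((D.pull I sq).map f) := (h₂.sqProp hu hY).isIso h₃ _
      exact (isIso_pull_comp (f := ptMap (1, 1)) (g := sq) f).1 inferInstance
  exact hY.of_iso (asIso f)

lemma ranProp_of_squares {X : D.Dia I P} (h : ∀ p, (∀ s, u s ≠ p) →
    (IsZeroAt X p ∧ ∀ s, ¬ p ≤ u s) ∨
      ∃ sq : Sq →o P, sq (0, 0) = p ∧ IsPullbackSquare u sq ∧ SqProp sq X) : RanProp u X := by
  obtain ⟨Y, hY, ⟨e⟩⟩ := exists_ranProp (D := D) (I := I) hu ((D.pull I u).obj X)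
  obtain ⟨f, hf⟩ := (hY.bijective X).2 e.inv
  dsimp only at hf
  have h₁ : IsIso ((D.pull I u).map f) := hf ▸ inferInstance
  have hS (p : P) (hp : ∃ s, u s = p) : IsIso ((D.pull I (ptMap p)).map f) := by
    obtain ⟨s, rfl⟩ := hp
    exact (isIso_pull_comp (f := ptMap s) (g := u) f).1 inferInstance
  have : IsIso f := isIso_of_pull_ptMap f fun p ↦ by
    by_cases hp : ∃ s, u s = p
    · exact hS p hp
    push Not at hp
    rcases h p hp with ⟨h₂, h₃⟩ | ⟨sq, rfl, h₂, h₃⟩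
    · exact IsZeroAt.isIso h₂ (hY.isZeroAt h₃) f
    · have h₅ : IsIso ((D.pull I cospanMap).map ((D.pull I sq).map f)) :=
        isIso_of_pull_ptMap _ fun y ↦ by
          rw [isIso_pull_comp, isIso_pull_comp]
          exact hS _ (h₂.lift y.1 y.2)
      have h₆ : IsIso ((D.pull I sq).map f) :=
        RanProp.isIso ((lanProp_span_iff _).1 h₃) (h₂.ranProp hu hY) _
      exact (isIso_pull_comp (f := ptMap (0, 0)) (g := sq) f).1 inferInstance
  exact hY.of_iso (asIso f).symm

end

/-! ### The posets of the stages -/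

section stages
variable {N l : ℕ}

lemma memAT_iff {a b : ℕ} : MemAT N (a, b) ↔ (a = 0 ∧ b = 0) ∨ (a = b + 1 ∧ a + 2 ≤ N) ∨
    (b = a + 1 ∧ b + 2 ≤ N) ∨ (a + 2 = N ∧ b + 2 = N) := by
  simp only [MemAT, IsZeroPos, Prod.mk.injEq]

lemma topK_eq (N : ℕ) : topK N = (if N = 3 then 2 else N - 2, if N = 3 then 1 else N - 2) := by
  unfold topK
  split_ifs <;> rfl

lemma memK2_iff {a b c : ℕ} : MemK2 N l ((a, b), c) ↔ ((a = 0 ∧ b = 0) ∨ (a = 1 ∧ b = 1) ∨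
    (a = b + 1 ∧ a + 2 ≤ N) ∨ (b = a + 1 ∧ b + 2 ≤ N) ∨ (N = 3 ∧ a = 2 ∧ b = 1) ∨
    (N ≠ 3 ∧ a = N - 2 ∧ b = N - 2)) ∧ c < l := by
  simp only [MemK2, IsZeroPos, Prod.mk.injEq, topK_eq]
  split_ifs <;> omega

lemma memK3_iff {a b c : ℕ} : MemK3 N l ((a, b), c) ↔ ((a = 1 ∧ b = 1) ∨
    (a = b + 1 ∧ a + 2 ≤ N) ∨ (b = a + 1 ∧ b + 2 ≤ N) ∨ (N = 3 ∧ a = 2 ∧ b = 1) ∨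
    (N ≠ 3 ∧ a = N - 2 ∧ b = N - 2 ∧ 2 < N)) ∧ c < l := by
  simp only [MemK3, memK2_iff, ne_eq, Prod.mk.injEq]
  omega

lemma memK4_iff {a b c : ℕ} : MemK4 N l ((a, b), c) ↔ ((a = 1 ∧ b = 1) ∨
    (a = b + 1 ∧ a + 2 ≤ N) ∨ (b = a + 1 ∧ b + 2 ≤ N ∧ 0 < a) ∨ (N = 3 ∧ a = 2 ∧ b = 1) ∨
    (N ≠ 3 ∧ a = N - 2 ∧ b = N - 2 ∧ 2 < N)) ∧ c < l := by
  simp only [MemK4, memK3_iff, ne_eq, Prod.mk.injEq]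
  omega

lemma memK5_iff {a b c : ℕ} : MemK5 N l ((a, b), c) ↔ ((a = 1 ∧ b = 1) ∨
    (a = b + 1 ∧ a + 2 ≤ N ∧ (b = 0 → c = 0)) ∨ (b = a + 1 ∧ b + 2 ≤ N ∧ 0 < a) ∨
    (N = 3 ∧ a = 2 ∧ b = 1) ∨ (N ≠ 3 ∧ a = N - 2 ∧ b = N - 2 ∧ 2 < N)) ∧ c < l := by
  simp only [MemK5, memK4_iff, Prod.mk.injEq]
  omega

lemma k1_coe (hN : 3 ≤ N) (x : K1 N l) :
    (k1 N l hN x).1 = (if x.1.1 = (N - 2, N - 2) then topK N else x.1.1, x.1.2) := rfl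

lemma k1_le (hN : 3 ≤ N) {x y : K1 N l} (h : k1 N l hN x ≤ k1 N l hN y) : x ≤ y := by
  have h' : (k1 N l hN x).1 ≤ (k1 N l hN y).1 := h
  obtain ⟨⟨⟨a, b⟩, c⟩, hx, hc⟩ := x
  obtain ⟨⟨⟨a', b'⟩, c'⟩, hy, hc'⟩ := y
  rw [k1_coe, k1_coe] at h'
  rw [memAT_iff] at hx hy
  refine Subtype.mk_le_mk.2 ?_
  simp only [topK_eq, Prod.mk.injEq] at h'
  split_ifs at h' <;> simp only [Prod.mk_le_mk] at * <;> omega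

lemma exists_k1 (hN : 3 ≤ N) (p : K2 N l) (hp : p.1.1 ≠ (1, 1)) : ∃ s, k1 N l hN s = p := by
  obtain ⟨⟨⟨a, b⟩, c⟩, h⟩ := p
  have h' := memK2_iff.1 h
  simp only [ne_eq, Prod.mk.injEq] at hp
  by_cases ht : (a, b) = topK N
  · refine ⟨⟨((N - 2, N - 2), c), memAT_iff.2 (by omega), h'.2⟩, Subtype.ext ?_⟩
    rw [k1_coe, if_pos rfl]
    exact Prod.ext ht.symm rfl
  · have ht' := ht
    simp only [topK_eq, Prod.mk.injEq] at ht'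
    refine ⟨⟨((a, b), c), memAT_iff.2 ?_, h'.2⟩, Subtype.ext ?_⟩
    · split_ifs at ht' <;> omega
    · rw [k1_coe, if_neg]
      simp only [Prod.mk.injEq]
      split_ifs at ht' <;> omega

/-- The square of `K2` at the height `z`. -/
def stageSquare (hN : 3 ≤ N) (z : ℕ) (hz : z < l) : Sq →o K2 N l :=
  mkSq ⟨((0, 0), z), memK2_iff.2 (by omega)⟩ ⟨((1, 0), z), memK2_iff.2 (by omega)⟩
    ⟨((0, 1), z), memK2_iff.2 (by omega)⟩ ⟨((1, 1), z), memK2_iff.2 (by omega)⟩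
    (Subtype.mk_le_mk.2 (by simp)) (Subtype.mk_le_mk.2 (by simp)) (Subtype.mk_le_mk.2 (by simp))
    (Subtype.mk_le_mk.2 (by simp))

lemma isPushoutSquare_stageSquare (hN : 3 ≤ N) (z : ℕ) (hz : z < l) :
    IsPushoutSquare (k1 N l hN) (stageSquare hN z hz) := by
  refine isPushoutSquare_mkSq _ _ _ _ (exists_k1 hN _ (by simp)) (exists_k1 hN _ (by simp))
    (exists_k1 hN _ (by simp)) fun s hs ↦ ?_
  obtain ⟨⟨⟨a, b⟩, c⟩, h, hc⟩ := s
  rw [memAT_iff] at h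
  simp only [← Subtype.coe_le_coe, k1_coe] at hs ⊢
  simp only [topK_eq, Prod.mk.injEq, Prod.le_def] at hs ⊢
  split_ifs at * <;> dsimp only at * <;> omega

lemma k2_coe (x : K3 N l) : (k2 N l x).1 = x.1 := rfl

lemma exists_k2 (p : K2 N l) (hp : p.1.1 ≠ (0, 0)) : ∃ s, k2 N l s = p := ⟨⟨p.1, p.2, hp⟩, rfl⟩

/-- The square that computes the new column `(1,1)` also computes the column `(0,0)` from the rest.
Via stability this allows the latter to be dropped. -/
lemma isPullbackSquare_stageSquare (hN : 3 ≤ N) (z : ℕ) (hz : z < l) :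
    IsPullbackSquare (k2 N l) (stageSquare hN z hz) := by
  refine isPullbackSquare_mkSq _ _ _ _ (exists_k2 _ (by simp)) (exists_k2 _ (by simp))
    (exists_k2 _ (by simp)) fun s hs ↦ ?_
  obtain ⟨⟨⟨a, b⟩, c⟩, h⟩ := s
  have h' := memK3_iff.1 h
  simp only [← Subtype.coe_le_coe, k2_coe] at hs ⊢
  simp only [Prod.le_def] at hs ⊢
  omega

lemma k2_ne (p : K2 N l) (hp : ∀ s, k2 N l s ≠ p) : p.1.1 = (0, 0) := by
  by_contra h
  obtain ⟨s, hs⟩ := exists_k2 p h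
  exact hp s hs

lemma k1_ne (hN : 3 ≤ N) (p : K2 N l) (hp : ∀ s, k1 N l hN s ≠ p) : p.1.1 = (1, 1) := by
  by_contra h
  obtain ⟨s, hs⟩ := exists_k1 hN p h
  exact hp s hs

lemma k3_ne (p : K3 N l) (hp : ∀ s, k3 N l s ≠ p) : p.1.1 = (0, 1) := by
  by_contra h
  exact hp ⟨p.1, p.2, h⟩ rfl

/-- The section of `k4`. -/
def s4 (N l : ℕ) : K5 N l →o K4 N l where
  toFun x := ⟨x.1, x.2.1⟩
  monotone' _ _ h := h

lemma k4_coe (x : K4 N l) : (k4 N l x).1 = (x.1.1, if x.1.1 = (1, 0) then 0 else x.1.2) := rfl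

lemma s4_coe (x : K5 N l) : (s4 N l x).1 = x.1 := rfl

lemma k4_s4 (x : K5 N l) : k4 N l (s4 N l x) = x := by
  refine Subtype.ext ?_
  rw [k4_coe, s4_coe]
  split_ifs with h
  · exact Prod.ext rfl (x.2.2 h).symm
  · rfl

lemma s4_le_iff (q : K5 N l) (p : K4 N l) : s4 N l q ≤ p ↔ q ≤ k4 N l p := by
  simp only [← Subtype.coe_le_coe, s4_coe, k4_coe]
  obtain ⟨⟨⟨a, b⟩, c⟩, h⟩ := q
  obtain ⟨⟨⟨a', b'⟩, c'⟩, h'⟩ := p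
  rw [memK5_iff] at h
  rw [memK4_iff] at h'
  simp only [Prod.mk.injEq, Prod.le_def] at *
  split_ifs <;> omega

lemma k5_coe (hN : 3 ≤ N) (hl : 1 ≤ l) (x : K1 N (l + 1)) :
    (k5 N l hN hl x).1 = if x.1.2 = 0 then
      if x.1.1 = (0, 0) then ((1, 0), 0) else ((x.1.1.1 + 1, x.1.1.2 + 1), 0)
    else ((x.1.1.1 + 1, x.1.1.2 + 1), x.1.2 - 1) := rfl

/-- The section of `k5`. -/
def s5 (N l : ℕ) (hN : 3 ≤ N) : K5 (N + 1) l →o K1 N (l + 1) where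
  -- The right adjoint of `k5` takes the greatest element of each fibre: over `(a,b,0)` away from
  -- `(1,0)` both heights `0` and `1` occur when the shifted column is not `(0,0)`, and height `1`
  -- is taken.
  toFun x := ⟨if x.1.1 = (1, 0) then ((0, 0), 0) else ((x.1.1.1 - 1, x.1.1.2 - 1), x.1.2 + 1), by
    obtain ⟨⟨⟨a, b⟩, c⟩, h⟩ := x
    rw [memK5_iff] at h
    dsimp only
    split_ifs with h₁ <;> simp only [Prod.mk.injEq] at h₁
    · exact ⟨memAT_iff.2 (by omega), by dsimp only; omega⟩
    · exact ⟨memAT_iff.2 (by omega), by dsimp only; omega⟩⟩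
  monotone' := by
    rintro ⟨⟨⟨a, b⟩, c⟩, h⟩ ⟨⟨⟨a', b'⟩, c'⟩, h'⟩ hle
    have h₄ : a ≤ a' := hle.1.1
    have h₅ : b ≤ b' := hle.1.2
    have h₆ : c ≤ c' := hle.2
    rw [memK5_iff] at h h'
    refine Subtype.mk_le_mk.2 ?_
    simp only [Prod.mk.injEq]
    split_ifs <;> simp only [Prod.mk_le_mk] <;> omega

lemma s5_coe (hN : 3 ≤ N) (x : K5 (N + 1) l) : (s5 N l hN x).1 =
    if x.1.1 = (1, 0) then ((0, 0), 0) else ((x.1.1.1 - 1, x.1.1.2 - 1), x.1.2 + 1) := rfl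

lemma k5_s5 (hN : 3 ≤ N) (hl : 1 ≤ l) (x : K5 (N + 1) l) :
    k5 N l hN hl (s5 N l hN x) = x := by
  refine Subtype.ext ?_
  rw [k5_coe, s5_coe]
  obtain ⟨⟨⟨a, b⟩, c⟩, h⟩ := x
  rw [memK5_iff] at h
  simp only [Prod.mk.injEq]
  by_cases h₁ : a = 1 ∧ b = 0
  · simp only [if_pos h₁, and_self, if_true, Prod.mk.injEq]
    omega
  · simp only [if_neg h₁, Nat.add_eq_zero_iff, one_ne_zero, and_false, if_false, Prod.mk.injEq]
    omega

lemma k5_le_iff (hN : 3 ≤ N) (hl : 1 ≤ l) (p : K1 N (l + 1)) (q : K5 (N + 1) l) :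
    k5 N l hN hl p ≤ q ↔ p ≤ s5 N l hN q := by
  simp only [← Subtype.coe_le_coe, s5_coe, k5_coe]
  obtain ⟨⟨⟨a, b⟩, c⟩, h⟩ := q
  obtain ⟨⟨⟨a', b'⟩, c'⟩, h', hc'⟩ := p
  rw [memK5_iff] at h
  rw [memAT_iff] at h'
  simp only [Prod.mk.injEq]
  split_ifs <;> simp only [Prod.mk_le_mk] <;> omega

lemma kEnd_coe {n : ℕ} (h : l + 2 = n) (x : K5 3 l) : (kEnd n l h x).1 =
    if x.1.1 = (1, 0) then 1 else if x.1.1 = (1, 1) then x.1.2 + 2 else n := rfl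

/-- The section of `kEnd`. -/
def sEnd (n l : ℕ) (h : l + 2 = n) (hl : 1 ≤ l) : An n →o K5 3 l where
  -- The right adjoint of `kEnd` takes the greatest element of each fibre, which over `n` is the top
  -- of the column `(2,1)`.
  toFun i := ⟨if i.1 = 1 then ((1, 0), 0) else if i.1 = n then ((2, 1), l - 1)
    else ((1, 1), i.1 - 2), by
    obtain ⟨i, h₁, h₂⟩ := i
    dsimp only
    split_ifs
    · exact memK5_iff.2 (by omega)
    · exact memK5_iff.2 (by omega)
    · exact memK5_iff.2 (by omega)⟩
  monotone' := by
    rintro ⟨i, h₁, h₂⟩ ⟨j, h₃, h₄⟩ hij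
    have : i ≤ j := hij
    refine Subtype.mk_le_mk.2 ?_
    dsimp only
    split_ifs <;> simp only [Prod.mk_le_mk] <;> omega

lemma sEnd_coe {n : ℕ} (h : l + 2 = n) (hl : 1 ≤ l) (i : An n) : (sEnd n l h hl i).1 =
    if i.1 = 1 then ((1, 0), 0) else if i.1 = n then ((2, 1), l - 1) else ((1, 1), i.1 - 2) := rfl

lemma kEnd_sEnd {n : ℕ} (h : l + 2 = n) (hl : 1 ≤ l) (i : An n) :
    kEnd n l h (sEnd n l h hl i) = i := by
  refine Subtype.ext ?_
  rw [kEnd_coe, sEnd_coe]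
  obtain ⟨i, h₁, h₂⟩ := i
  dsimp only
  by_cases h₃ : i = 1
  · simp [h₃]
  · by_cases h₄ : i = n
    · simp [h₄, h₄ ▸ h₃]
    · simp [h₃, h₄]
      omega

lemma kEnd_le_iff {n : ℕ} (h : l + 2 = n) (hl : 1 ≤ l) (p : K5 3 l) (i : An n) :
    kEnd n l h p ≤ i ↔ p ≤ sEnd n l h hl i := by
  simp only [← Subtype.coe_le_coe, sEnd_coe, kEnd_coe]
  obtain ⟨⟨⟨a, b⟩, c⟩, h'⟩ := p
  obtain ⟨i, h₄, h₅⟩ := i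
  rw [memK5_iff] at h'
  simp only [Prod.mk.injEq]
  split_ifs <;> simp only [Prod.mk_le_mk] <;> omega

end stages
-- Full faithfulness of the stages
section
variable {N l : ℕ}

lemma k1_of_ne (hN : 3 ≤ N) (x : K1 N l) (h : x.1.1 ≠ (N - 2, N - 2)) :
    (k1 N l hN x).1 = x.1 := by
  rw [k1_coe, if_neg h]

lemma k1_of_eq (hN : 3 ≤ N) (x : K1 N l) (h : x.1.1 = (N - 2, N - 2)) :
    (k1 N l hN x).1 = (topK N, x.1.2) := by
  rw [k1_coe, if_pos h]

lemma k5_of_ne (hN : 3 ≤ N) (hl : 1 ≤ l) (x : K1 N (l + 1)) (h : x.1.1 ≠ (0, 0)) :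
    (k5 N l hN hl x).1 = ((x.1.1.1 + 1, x.1.1.2 + 1), x.1.2 - 1) := by
  rw [k5_coe, if_neg h]
  split_ifs with h'
  · rw [h']
  · rfl

/-- The inclusion of `K5` into `K2`. -/
def k52 (N l : ℕ) : K5 N l →o K2 N l := ((k2 N l).comp (k3 N l)).comp (s4 N l)

lemma k52_coe (x : K5 N l) : (k52 N l x).1 = x.1 := rfl

variable {D : Prederivator.{u, v, w}} {I : Cat.{u, u}} [D.IsDerivator]

lemma EdgeIso.congr {P : Type} [Preorder P] {X : D.Dia I P} {a b a' b' : P} {h : a ≤ b}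
    (hX : EdgeIso X h) (ha : a = a') (hb : b = b') (h' : a' ≤ b') : EdgeIso X h' := by
  subst ha hb
  exact hX

/-- The properties of the diagrams of shape `K1` at which the stages are evaluated. -/
structure IsStage (X : D.Dia I (K1 N l)) : Prop where
  zero (x : K1 N l) : IsZeroPos N x.1.1 → IsZeroAt X x
  -- The arrows over `(1,0)` are inverted so that `k4` can collapse them. The columns `(p,p-1)` with
  -- `p > 1` are moved towards `(1,0)` by later stages, and the last column is collapsed by `kEnd`.
  edge {x y : K1 N l} (h : x ≤ y) : x.1.1 = y.1.1 →
    (x.1.1.1 = x.1.1.2 + 1 ∨ x.1.1 = (N - 2, N - 2)) → EdgeIso X h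

lemma IsStage.of_iso {X Y : D.Dia I (K1 N l)} (h : IsStage X) (e : X ≅ Y) : IsStage Y :=
  ⟨fun x hx ↦ (h.zero x hx).of_iso e, fun h₁ h₂ h₃ ↦ (h.edge h₁ h₂ h₃).of_iso e⟩

variable [D.IsStable] {hN : 3 ≤ N} {W : D.Dia I (K2 N l)}

/-- At every height the square is cocartesian because `W` is extended along `k1`, hence cartesian,
and it computes the right extension from `K3`. -/
lemma ranProp_k2 (hW : LanProp (k1 N l hN) W) : RanProp (k2 N l) W := by
  refine ranProp_of_squares (fun _ _ h ↦ h) fun p hp ↦ Or.inr ⟨stageSquare hN p.1.2 p.2.2, ?_,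
    isPullbackSquare_stageSquare hN _ _,
    (isPushoutSquare_stageSquare hN _ _).sqProp (fun _ _ h ↦ k1_le hN h) hW⟩
  exact Subtype.ext (Prod.ext (k2_ne p hp).symm rfl)

namespace IsStage
variable (hX : IsStage ((D.pull I (k1 N l hN)).obj W))
include hX

/-- The objects `(0,1,z)` carry zeros, and no object of `K4` lies below them. -/
lemma lanProp_k3 : LanProp (k3 N l) ((D.pull I (k2 N l)).obj W) := by
  refine lanProp_of_squares (fun _ _ h ↦ h) fun p hp ↦ Or.inl ?_
  have h₁ := k3_ne p hp
  refine ⟨?_, fun s hs ↦ ?_⟩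
  · rw [isZeroAt_pull]
    have h₂ : MemK1 N l ((0, 1), p.1.2) := ⟨memAT_iff.2 (by omega), p.2.1.2⟩
    have h₃ : k1 N l hN ⟨_, h₂⟩ = k2 N l p := by
      refine Subtype.ext ?_
      rw [k1_of_ne _ _ (by simp only [ne_eq, Prod.mk.injEq]; omega), k2_coe]
      exact Prod.ext h₁.symm rfl
    rw [← h₃, ← isZeroAt_pull]
    exact hX.zero _ ⟨rfl, hN⟩
  · have h₂ : s.1 ≤ p.1 := hs
    have h₃ := h₂.1
    rw [h₁] at h₃
    obtain ⟨⟨⟨a, b⟩, c⟩, h⟩ := s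
    have h' := memK4_iff.1 h
    simp only [Prod.mk_le_mk] at h₃
    omega

/-- The only arrows to be inverted are those from `(1,0,0)` to `(1,0,z)`. -/
lemma essImage_k4 : (D.pull I (k4 N l)).essImage
    ((D.pull I (k3 N l)).obj ((D.pull I (k2 N l)).obj W)) := by
  refine essImage_of_coreflection k4_s4 s4_le_iff _ fun p ↦ ?_
  by_cases hp : p.1.1 = (1, 0)
  · rw [edgeIso_pull, edgeIso_pull]
    have hz := p.2.1.1.2
    have h₁ : MemK1 N l ((1, 0), 0) := ⟨memAT_iff.2 (by omega), by dsimp only; omega⟩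
    have h₂ : MemK1 N l ((1, 0), p.1.2) := ⟨memAT_iff.2 (by omega), hz⟩
    have h₃ : (⟨_, h₁⟩ : K1 N l) ≤ ⟨_, h₂⟩ := Subtype.mk_le_mk.2 (by simp)
    have h₄ := hX.edge h₃ rfl (Or.inl rfl)
    rw [edgeIso_pull] at h₄
    refine h₄.congr (Subtype.ext ?_) (Subtype.ext ?_) _
    · rw [k1_of_ne _ _ (by simp only [ne_eq, Prod.mk.injEq]; omega)]
      exact Prod.ext hp.symm (if_pos hp).symm
    · rw [k1_of_ne _ _ (by simp only [ne_eq, Prod.mk.injEq]; omega)]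
      exact Prod.ext hp.symm rfl
  · exact edgeIso_of_eq _ _ (Subtype.ext (Prod.ext rfl (if_neg hp)))

-- The only arrows to be inverted are those from `(2,1,z)` to the top of the column, which come from
-- the last column of `K1`.
omit hX in
lemma essImage_kEnd {n : ℕ} {l : ℕ} {W : D.Dia I (K2 3 l)} (h : l + 2 = n) (hl : 1 ≤ l)
    (hX : IsStage ((D.pull I (k1 3 l le_rfl)).obj W)) :
    (D.pull I (kEnd n l h)).essImage ((D.pull I (k52 3 l)).obj W) := by
  refine essImage_of_reflection (kEnd_sEnd h hl) (kEnd_le_iff h hl) _ fun p ↦ ?_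
  by_cases hp : p.1.1 = (2, 1)
  · rw [edgeIso_pull]
    have hz := p.2.1.1.1.2
    have h₁ : MemK1 3 l ((1, 1), p.1.2) := ⟨memAT_iff.2 (by omega), hz⟩
    have h₂ : MemK1 3 l ((1, 1), l - 1) := ⟨memAT_iff.2 (by omega), by dsimp only; omega⟩
    have h₃ : (⟨_, h₁⟩ : K1 3 l) ≤ ⟨_, h₂⟩ := Subtype.mk_le_mk.2 (by simp; omega)
    have h₄ := hX.edge h₃ rfl (Or.inr rfl)
    rw [edgeIso_pull] at h₄
    refine h₄.congr (Subtype.ext ?_) (Subtype.ext ?_) _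
    · rw [k1_of_eq _ _ rfl, k52_coe]
      exact Prod.ext hp.symm rfl
    · rw [k1_of_eq _ _ rfl, k52_coe, sEnd_coe, kEnd_coe, hp]
      have h₅ : ¬ n = 1 := by omega
      simp [h₅, topK]
  · refine edgeIso_of_eq _ _ (Subtype.ext ?_)
    rw [sEnd_coe, kEnd_coe]
    obtain ⟨⟨⟨a, b⟩, c⟩, h'⟩ := p
    rw [memK5_iff] at h'
    simp only [Prod.mk.injEq] at hp ⊢
    by_cases h₁ : a = 1 ∧ b = 0
    · simp [h₁]
      omega
    · by_cases h₂ : a = 1 ∧ b = 1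
      · have h₃ : ¬ c + 2 = n := by omega
        simp [h₂, h₃]
      · omega

-- All objects concerned lie outside of the column `(0,0)`. Their images under `k5` therefore avoid
-- the new column `(1,1)` and come from `K1` of the present stage (`key`), where the conditions are
-- already known.
omit hX in
lemma next {N : ℕ} {hN : 3 ≤ N + 1} {W : D.Dia I (K2 (N + 1) l)} (hN' : 3 ≤ N) (hl : 1 ≤ l)
    (hX : IsStage ((D.pull I (k1 (N + 1) l hN)).obj W)) :
    IsStage ((D.pull I (k5 N l hN' hl)).obj ((D.pull I (k52 (N + 1) l)).obj W)) := by
  have key (x : K1 N (l + 1)) (hx : IsZeroPos N x.1.1 ∨ x.1.1.1 = x.1.1.2 + 1 ∨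
      x.1.1 = (N - 2, N - 2)) : ∃ s : K1 (N + 1) l,
        s.1 = ((x.1.1.1 + 1, x.1.1.2 + 1), x.1.2 - 1) ∧
        k1 (N + 1) l hN s = k52 (N + 1) l (k5 N l hN' hl x) := by
    obtain ⟨⟨⟨a, b⟩, c⟩, h, hc⟩ := x
    rw [memAT_iff] at h
    simp only [IsZeroPos, Prod.mk.injEq] at hx hc
    refine ⟨⟨((a + 1, b + 1), c - 1), memAT_iff.2 (by omega), by dsimp only; omega⟩, rfl,
      Subtype.ext ?_⟩
    rw [k52_coe, k5_of_ne _ _ _ (by simp only [ne_eq, Prod.mk.injEq]; omega), k1_coe]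
    have : N + 1 ≠ 3 := by omega
    simp only [topK, if_neg this]
    split_ifs with h₁
    · rw [h₁]
    · rfl
  refine ⟨fun x hx ↦ ?_, fun {x y} h hxy hx ↦ ?_⟩
  · rw [isZeroAt_pull, isZeroAt_pull]
    obtain ⟨s, hs, hs'⟩ := key x (Or.inl hx)
    rw [← hs', ← isZeroAt_pull]
    refine hX.zero s ?_
    rw [hs]
    simp only [IsZeroPos] at hx ⊢
    omega
  · rw [edgeIso_pull, edgeIso_pull]
    obtain ⟨s, hs, hs'⟩ := key x (Or.inr hx)
    obtain ⟨t, ht, ht'⟩ := key y (Or.inr (by rwa [← hxy]))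
    have hst : s ≤ t := by
      refine Subtype.coe_le_coe.1 ?_
      rw [hs, ht, hxy]
      exact ⟨le_rfl, Nat.sub_le_sub_right h.2 1⟩
    have h₁ := hX.edge hst (by rw [hs, ht, hxy]) (by
      rw [hs]
      refine hx.imp (fun h ↦ by dsimp only; omega) fun h ↦ ?_
      rw [h]
      simp only [Prod.mk.injEq]
      omega)
    rw [edgeIso_pull] at h₁
    exact h₁.congr hs' ht' _

end IsStage

section stage

lemma bijective_leftAdjoint_map {C₁ C₂ : Type*} [Category C₁] [Category C₂] {L : C₁ ⥤ C₂}
    {R : C₂ ⥤ C₁} (adj : L ⊣ R) {X Y : C₁} (h : IsIso (adj.unit.app Y)) :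
    Function.Bijective fun φ : X ⟶ Y ↦ L.map φ := by
  have e : (fun φ : X ⟶ Y ↦ L.map φ) =
      (adj.homEquiv X (L.obj Y)).symm ∘ fun φ : X ⟶ Y ↦ φ ≫ adj.unit.app Y := by
    funext φ
    simp [Adjunction.homEquiv_counit]
  rw [e]
  exact (Equiv.bijective _).comp ⟨fun _ _ h ↦ (cancel_mono _).1 h,
    fun g ↦ ⟨g ≫ inv (adj.unit.app Y), by simp⟩⟩

lemma isIso_unit_of_bijOn {P Q : Type} [Preorder P] [Preorder Q] {k : P →o Q}
    (hk : ∀ X Y : D.Dia I Q, BijOn k X Y) {L : D.Dia I P ⥤ D.Dia I Q} (adj : L ⊣ D.pull I k)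
    {Y : D.Dia I P} (h : (D.pull I k).essImage Y) : IsIso (adj.unit.app Y) := by
  have : (D.pull I k).Faithful := ⟨fun h ↦ (hk _ _).1 h⟩
  have : (D.pull I k).Full := ⟨fun f ↦ (hk _ _).2 f⟩
  obtain ⟨V, ⟨e⟩⟩ := h
  exact adj.isIso_unit_app_of_iso e.symm

variable (D) in
/-- The adjunction of the left Kan extension and the restriction, objectwise. -/
noncomputable def lanPullAdj {P Q : Type} [Preorder P] [Preorder Q] (k : P →o Q)
    (I : (Cat.{u, u})ᵒᵖ) : ((D.lan (shapeMap k)).app I).toFunctor ⊣ D.pull I.unop k :=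
  adjApp (Bicategory.Adjunction.ofIsRightAdjoint (D.restr (shapeMap k))) I

variable {I : (Cat.{u, u})ᵒᵖ}

/-- On such diagrams the extension along `k4` inverts `k4^*`, so it agrees with restriction along
the section `s4`. The whole stage is then the restriction to `K5` of the extension `W` to `K2`. -/
lemma stage_spec {X : D.Dia I.unop (K1 N l)} (hX : IsStage X) :
    ∃ W : D.Dia I.unop (K2 N l), LanProp (k1 N l hN) W ∧
      IsStage ((D.pull I.unop (k1 N l hN)).obj W) ∧
      ((D.lan (shapeMap (k1 N l hN))).app I).toFunctor.obj X = W ∧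
      Nonempty (((D.stage N l hN).app I).toFunctor.obj X ≅ (D.pull I.unop (k52 N l)).obj W) := by
  let adj := D.lanPullAdj (k1 N l hN) I
  have h₁ : IsIso (adj.unit.app X) := isIso_of_isLan (fun _ _ h ↦ k1_le hN h) (isLan_unit adj X)
  let W := ((D.lan (shapeMap (k1 N l hN))).app I).toFunctor.obj X
  have h₂ : LanProp (k1 N l hN) W :=
    @LanProp.of_isLan _ _ _ _ _ _ _ _ _ _ _ h₁ (isLan_unit adj X)
  have h₃ : IsStage ((D.pull I.unop (k1 N l hN)).obj W) :=
    hX.of_iso (@asIso _ _ _ _ (adj.unit.app X) h₁)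
  let adj' := D.lanPullAdj (k4 N l) I
  have h₄ : IsIso (adj'.unit.app ((D.pull I.unop (k3 N l)).obj ((D.pull I.unop (k2 N l)).obj W))) :=
    isIso_unit_of_bijOn (bijOn_of_coreflection k4_s4 s4_le_iff) adj' h₃.essImage_k4
  refine ⟨W, h₂, h₃, rfl, ⟨?_⟩⟩
  let V := ((D.lan (shapeMap (k4 N l))).app I).toFunctor.obj
    ((D.pull I.unop (k3 N l)).obj ((D.pull I.unop (k2 N l)).obj W))
  let e₁ : (D.pull I.unop (s4 N l)).obj ((D.pull I.unop (k4 N l)).obj V) ≅ V :=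
    ((D.pullComp I.unop (s4 N l) (k4 N l)).symm ≪≫ D.pullEq I.unop (comp_eq_id k4_s4) ≪≫
      D.pullId I.unop (K5 N l)).app V
  let e₂ := (D.pull I.unop (s4 N l)).mapIso (@asIso _ _ _ _ (adj'.unit.app
    ((D.pull I.unop (k3 N l)).obj ((D.pull I.unop (k2 N l)).obj W))) h₄)
  let e₃ := (D.pullComp I.unop (s4 N l) ((k2 N l).comp (k3 N l)) ≪≫
    Functor.isoWhiskerRight (D.pullComp I.unop (k3 N l) (k2 N l)) (D.pull I.unop (s4 N l))).app W
  exact (e₃ ≪≫ e₂ ≪≫ e₁).symm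

/-- Four bijections: the unit at `Y` along the embedding `k1` is invertible, the extension of `Y` is
right extended along `k2`, that of `X` is left extended along `k3`, and the unit along `k4` is
invertible at the diagram obtained from `Y`. -/
lemma bijective_stage {X Y : D.Dia I.unop (K1 N l)} (hX : IsStage X) (hY : IsStage Y) :
    Function.Bijective fun φ : X ⟶ Y ↦ ((D.stage N l hN).app I).toFunctor.map φ := by
  obtain ⟨W, -, h₂, rfl, -⟩ := stage_spec (hN := hN) hX
  obtain ⟨W', h₁', h₂', rfl, -⟩ := stage_spec (hN := hN) hY
  have b₁ := bijective_leftAdjoint_map (D.lanPullAdj (k1 N l hN) I) (X := X) (Y := Y)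
    (isIso_of_isLan (fun _ _ h ↦ k1_le hN h) (isLan_unit _ Y))
  have b₂ := (ranProp_k2 h₁').bijOn (((D.lan (shapeMap (k1 N l hN))).app I).toFunctor.obj X)
  have b₃ := h₂.lanProp_k3.bijOn ((D.pull I.unop (k2 N l)).obj
    (((D.lan (shapeMap (k1 N l hN))).app I).toFunctor.obj Y))
  have b₄ := bijective_leftAdjoint_map (D.lanPullAdj (k4 N l) I)
    (X := (D.pull I.unop (k3 N l)).obj ((D.pull I.unop (k2 N l)).obj
      (((D.lan (shapeMap (k1 N l hN))).app I).toFunctor.obj X)))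
    (isIso_unit_of_bijOn (bijOn_of_coreflection k4_s4 s4_le_iff) (D.lanPullAdj (k4 N l) I)
      h₂'.essImage_k4)
  exact (Function.Bijective.comp b₄ (Function.Bijective.comp b₃ (Function.Bijective.comp b₂ b₁)) :)

lemma bijective_fromStage {n : ℕ} (r : ℕ) : ∀ (l : ℕ) (hl : 1 ≤ l) (h : l + r + 2 = n)
    {X Y : D.Dia I.unop (K1 (r + 3) l)} (_ : IsStage X) (_ : IsStage Y),
    Function.Bijective fun φ : X ⟶ Y ↦ ((D.fromStage n r l hl h).app I).toFunctor.map φ := by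
  induction r with
  | zero =>
    intro l hl h X Y hX hY
    obtain ⟨W, -, h₂, -, ⟨e⟩⟩ := stage_spec (hN := le_rfl) hY
    have b := bijective_leftAdjoint_map (D.lanPullAdj (kEnd n l h) I)
      (X := ((D.stage 3 l le_rfl).app I).toFunctor.obj X)
      (isIso_unit_of_bijOn (bijOn_of_reflection (kEnd_sEnd h hl) (kEnd_le_iff h hl))
        (D.lanPullAdj (kEnd n l h) I) ((IsStage.essImage_kEnd h hl h₂).ofIso e.symm))
    exact (Function.Bijective.comp b (bijective_stage (hN := le_rfl) hX hY) :)
  | succ r ih =>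
    intro l hl h X Y hX hY
    have hN : 3 ≤ r + 3 := by omega
    obtain ⟨W, -, h₂, -, ⟨e⟩⟩ := stage_spec (N := r + 3 + 1) (hN := by omega) hX
    obtain ⟨W', -, h₂', -, ⟨e'⟩⟩ := stage_spec (N := r + 3 + 1) (hN := by omega) hY
    have b := bijOn_of_reflection (D := D) (I := I.unop) (k5_s5 hN hl) (k5_le_iff hN hl)
      (((D.stage (r + 4) l (by omega)).app I).toFunctor.obj X)
      (((D.stage (r + 4) l (by omega)).app I).toFunctor.obj Y)
    have b' := ih (l + 1) (by omega) (by omega)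
      ((h₂.next hN hl).of_iso ((D.pull I.unop (k5 (r + 3) l hN hl)).mapIso e.symm))
      ((h₂'.next hN hl).of_iso ((D.pull I.unop (k5 (r + 3) l hN hl)).mapIso e'.symm))
    exact (Function.Bijective.comp b' (Function.Bijective.comp b
      (bijective_stage (N := r + 4) (hN := by omega) hX hY)) :)

/-- The inverse of `kStart`. -/
def sStart (m n : ℕ) (h : m = n) : AT n →o K1 m 1 where
  toFun x := ⟨(x.1, 0), h ▸ x.2, zero_lt_one⟩
  monotone' _ _ h := ⟨h, le_rfl⟩

lemma sStart_le_iff (m n : ℕ) (h : m = n) (q : AT n) (p : K1 m 1) :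
    sStart m n h q ≤ p ↔ q ≤ kStart m n h p :=
  ⟨fun h ↦ h.1, fun h ↦ ⟨h, Nat.zero_le _⟩⟩

lemma anTwo_iff (n : ℕ) (X : D.Dia I.unop (AT n)) :
    (D.anTwo n).prop I X ↔ ∀ x : AT n, IsZeroPos n x.1 → IsZeroAt X x :=
  forall₂_congr fun x _ ↦ vanishesAt_iff x I X

lemma isStage_start {m n : ℕ} (h : m = n) {X : D.Dia I.unop (AT n)}
    (hX : (D.anTwo n).prop I X) : IsStage ((D.pull I.unop (kStart m n h)).obj X) := by
  rw [anTwo_iff] at hX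
  subst h
  refine ⟨fun x hx ↦ ?_, fun {x y} _ h' _ ↦ ?_⟩
  · rw [isZeroAt_pull]
    exact hX _ hx
  · rw [edgeIso_pull]
    exact edgeIso_of_eq _ _ (Subtype.ext h')

theorem bijective_mainMorphism (n : ℕ) (hn : 3 ≤ n) (X Y : (D.DA2 n).obj I) :
    Function.Bijective fun φ : X ⟶ Y ↦ ((D.mainMorphism n hn).app I).toFunctor.map φ := by
  have h : n - 3 + 3 = n := by omega
  have b := bijOn_of_coreflection (D := D) (I := I.unop) (s := sStart _ n h) (k := kStart _ n h)
    (fun _ ↦ rfl) (sStart_le_iff _ _ h) X.1 Y.1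
  have b' := bijective_fromStage (D := D) (n := n) (I := I) (n - 3) 1 le_rfl (by omega)
    (isStage_start h X.2) (isStage_start h Y.2)
  have b'' : Function.Bijective fun φ : X ⟶ Y ↦ φ.hom := ⟨fun _ _ h ↦ ObjectProperty.hom_ext _ h,
      fun f ↦ ⟨ObjectProperty.homMk f, rfl⟩⟩
  exact (Function.Bijective.comp b' (Function.Bijective.comp b b'') :)

end stage
end
/-- A modification given by its components, with the inverse naturality constraints. -/
def modMkInv {B : Type*} [Bicategory B] {F G : Pseudofunctor B Cat.{v, w}} {η θ : F ⟶ G}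
    (app : ∀ (a : B) (X : F.obj a), (η.app a).toFunctor.obj X ⟶ (θ.app a).toFunctor.obj X)
    (h₁ : ∀ {a : B} {X Y : F.obj a} (g : X ⟶ Y),
      (η.app a).toFunctor.map g ≫ app a Y = app a X ≫ (θ.app a).toFunctor.map g)
    (h₂ : ∀ {a b : B} (f : a ⟶ b) (X : F.obj a),
      (natCell η f X).inv ≫ app b ((F.map f).toFunctor.obj X) =
        (G.map f).toFunctor.map (app a X) ≫ (natCell θ f X).inv) : η ⟶ θ :=
  modMk app h₁ fun f X ↦ by
    rw [← Iso.eq_comp_inv, Category.assoc]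
    exact ((Iso.inv_comp_eq _).1 (h₂ f X))

/-! ### Monotone maps and their inequalities as morphisms and modifications -/

section modifications
variable (D : Prederivator.{u, v, w}) {A B C : Cat.{u, u}}

lemma resCell_whisker {A A' B B' : Cat.{u, u}} {a : A' ⟶ A} {k k' : A ⟶ B} {l l' : A' ⟶ B'}
    {b : B' ⟶ B} (α : a ≫ k ⟶ l ≫ b) (α' : a ≫ k' ⟶ l' ≫ b) (τ : k ⟶ k') (σ : l ⟶ l')
    (h : α ≫ σ ▷ b = a ◁ τ ≫ α') (X : D.obj (op B)) :
    (D.resCell α).app X ≫ (D.resMap σ).app ((D.res b).obj X) =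
      (D.res a).map ((D.resMap τ).app X) ≫ (D.resCell α').app X := by
  have h' := congrArg (fun z ↦ (D.resMap z).app X) h
  simp only [resMap_comp, NatTrans.comp_app] at h'
  rw [resCell_app, resCell_app, resMap_app_res, res_map_resMap]
  simp only [Category.assoc, Iso.inv_hom_id_app_assoc, Iso.hom_inv_id_app_assoc]
  rw [reassoc_of% h']

lemma resCell_comp {A A' B B' C C' : Cat.{u, u}} {a : A' ⟶ A} {b : B' ⟶ B} {c : C' ⟶ C}
    {k : A ⟶ B} {l : B ⟶ C} {k' : A' ⟶ B'} {l' : B' ⟶ C'} (α : a ≫ k ⟶ k' ≫ b)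
    (β : b ≫ l ⟶ l' ≫ c) (γ : a ≫ k ≫ l ⟶ (k' ≫ l') ≫ c)
    (h : γ = (α_ a k l).inv ≫ α ▷ l ≫ (α_ k' b l).hom ≫ k' ◁ β ≫ (α_ k' l' c).inv)
    (X : D.obj (op C)) :
    (D.resCell γ).app X ≫ (D.resComp k' l').hom.app ((D.res c).obj X) =
      (D.res a).map ((D.resComp k l).hom.app X) ≫ (D.resCell α).app ((D.res l).obj X) ≫
        (D.res k').map ((D.resCell β).app X) := by
  have h₁ : D.resMap γ = D.resMap (α ▷ l) ≫ D.resMap (k' ◁ β) := by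
    rw [← resMap_comp, h]
    congr 1
    ext x
    simp
  have e₁ := D.resComp_assoc k' b l X
  have e₂ := D.resComp_assoc k' l' c X
  have e₃ := D.resComp_assoc a k l X
  simp only [resCell_app, Functor.map_comp, Category.assoc]
  rw [h₁, res_map_resComp_hom, resMap_app_res, res_map_resMap, res_map_resComp_inv]
  erw [e₂]
  simp only [Category.assoc, Iso.inv_hom_id_app_assoc, Iso.hom_inv_id_app_assoc]
  exact congrArg (_ ≫ ·) (Category.assoc _ _ _)

variable {P Q R : Type} [Preorder P] [Preorder Q] [Preorder R]

/-- The modification `f^* ⟶ g^*` for `f ≤ g`. -/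
def restrCell {f g : P →o Q} (h : f ≤ g) : D.restr (shapeMap f) ⟶ D.restr (shapeMap g) :=
  modMkInv (fun I X ↦ (D.pullCell I.unop h).app X) (fun {I} _ _ φ ↦ (D.pullCell I.unop h).naturality φ)
    fun {I J} w X ↦ by
      rw [natCell_restr_inv, natCell_restr_inv]
      refine D.resCell_whisker _ _ (timesCell I.unop h) (timesCell J.unop h) ?_ X
      ext x
      refine Prod.hom_ext (Subsingleton.elim _ _) ?_
      simp only [timesCell]
      exact ((Category.id_comp _).trans (w.unop.toFunctor.map_id x.2)).trans
        (Category.comp_id (𝟙 _)).symm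

lemma natCell_comp_inv {B : Type*} [Bicategory B] {F G H : Pseudofunctor B Cat.{v, w}}
    (η : F ⟶ G) (θ : G ⟶ H) {a b : B} (f : a ⟶ b) (X : F.obj a) :
    (natCell (η ≫ θ) f X).inv = (natCell θ f ((η.app a).toFunctor.obj X)).inv ≫
      (θ.app b).toFunctor.map (natCell η f X).inv := by
  have h : natCell (η ≫ θ) f X = (θ.app b).toFunctor.mapIso (natCell η f X) ≪≫
      natCell θ f ((η.app a).toFunctor.obj X) := Iso.ext (natCell_comp_hom η θ f X)
  exact congrArg Iso.inv h

/-- The modification `(g ∘ f)^* ⟶ f^* g^*`. -/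
def restrComp (f : P →o Q) (g : Q →o R) : D.restr (shapeMap (g.comp f)) ⟶
    D.restr (shapeMap g) ≫ D.restr (shapeMap f) :=
  modMkInv (fun I X ↦ (D.pullComp I.unop f g).hom.app X)
    (fun {I} _ _ φ ↦ (D.pullComp I.unop f g).hom.naturality φ)
    fun {I J} w X ↦ by
      rw [natCell_comp_inv, natCell_restr_inv, natCell_restr_inv, natCell_restr_inv]
      let c (T : Cat.{u, u}) : Cat.of (T × J.unop) ⟶ Cat.of (T × I.unop) :=
        (Functor.prod (𝟭 T) w.unop.toFunctor).toCatHom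
      refine D.resCell_comp (a := c (shape P)) (b := c (shape Q)) (c := c (shape R))
        (k := timesId I.unop f) (l := timesId I.unop g) (k' := timesId J.unop f)
        (l' := timesId J.unop g) (𝟙 _) (𝟙 _) (𝟙 _) ?_ X
      ext x
      refine Prod.hom_ext (Subsingleton.elim _ _) ?_
      simp
      change 𝟙 (w.unop.toFunctor.obj x.2) = 𝟙 _ ≫ 𝟙 _ ≫ 𝟙 _
      simp

end modifications
/-! ### The symmetry of the mesh category -/

/-- The transposition of the square. -/
def sqSwap : Sq →o Sq := ⟨Prod.swap, fun _ _ h ↦ ⟨h.2, h.1⟩⟩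

lemma sqSwap_apply (y : Sq) : sqSwap y = (y.2, y.1) := rfl

section rot
variable {n : ℕ}

/-- The automorphism `(k,l) ↦ (k+l-1,n+1-l)` of the mesh category. -/
def meshRot (n : ℕ) : Mesh n ≃o Mesh n where
  toFun x := ⟨x.k + x.l - 1, n + 1 - x.l, by have := x.l_le; lia, by have := x.l_nonneg; lia⟩
  invFun x := ⟨x.k - n + x.l, n + 1 - x.l, by have := x.l_le; lia, by have := x.l_nonneg; lia⟩
  left_inv x := Mesh.ext (by dsimp only; ring) (by dsimp only; ring)
  right_inv x := Mesh.ext (by dsimp only; ring) (by dsimp only; ring)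
  map_rel_iff' {x y} := by
    simp only [Equiv.coe_fn_mk, Mesh.le_iff]
    lia

lemma meshRot_k (x : Mesh n) : (meshRot n x).k = x.k + x.l - 1 := rfl
lemma meshRot_l (x : Mesh n) : (meshRot n x).l = n + 1 - x.l := rfl
lemma meshRot_inv_k (x : Mesh n) : ((meshRot n)⁻¹ x).k = x.k - n + x.l := rfl
lemma meshRot_inv_l (x : Mesh n) : ((meshRot n)⁻¹ x).l = n + 1 - x.l := rfl

/-- The square of the glide reflection is the translation of `k` by `n - 1`; this is the source of
the multiples of `n - 1` in `j^n`. -/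
lemma meshRot_pow_two_mul (m : ℤ) (x : Mesh n) :
    (((meshRot n) ^ (2 * m)) x).k = x.k + m * ((n : ℤ) - 1) ∧ (((meshRot n) ^ (2 * m)) x).l = x.l := by
  induction m using Int.induction_on generalizing x with
  | zero => simp
  | succ i ih =>
    rw [show (2 * ((i : ℤ) + 1)) = 2 * i + 1 + 1 by ring, zpow_add_one, zpow_add_one]
    simp only [RelIso.mul_apply]
    rw [(ih _).1, (ih _).2]
    simp only [meshRot_k, meshRot_l]
    constructor <;> ring
  | pred i ih =>
    rw [show (2 * (-(i : ℤ) - 1)) = 2 * (-(i : ℤ)) - 1 - 1 by ring, zpow_sub_one, zpow_sub_one]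
    simp only [RelIso.mul_apply]
    rw [(ih _).1, (ih _).2]
    simp only [meshRot_inv_k, meshRot_inv_l]
    constructor <;> ring

/-- Only equal or consecutive exponents need a condition. From a difference of two on, the
translation by `n - 1` already moves `w` past the bounds imposed on `v`. -/
lemma meshRot_pow_le {a b : ℤ} (hab : a ≤ b) {v w : Mesh n}
    (hv : 0 ≤ v.k ∧ v.k ≤ n - 1 ∧ v.k + v.l ≤ n) (hw : 0 ≤ w.k ∧ 1 ≤ w.k + w.l)
    (h₀ : a = b → v ≤ w) (h₁ : a + 1 = b → v.k < w.k + w.l) :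
    (meshRot n ^ a) v ≤ (meshRot n ^ b) w := by
  obtain ⟨d, rfl⟩ := Int.le.dest hab
  rw [zpow_add, RelIso.mul_apply, OrderIso.le_iff_le]
  rcases Nat.even_or_odd' d with ⟨m, rfl | rfl⟩
  · rcases Nat.eq_zero_or_pos m with rfl | hm
    · simpa using h₀ (by simp)
    · have h := meshRot_pow_two_mul (m : ℤ) w
      push_cast
      rw [Mesh.le_iff, h.1, h.2]
      have : (1 : ℤ) * ((n : ℤ) - 1) ≤ m * ((n : ℤ) - 1) :=
        mul_le_mul_of_nonneg_right (by lia) (by lia)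
      lia
  · have h := meshRot_pow_two_mul (m : ℤ) (meshRot n w)
    push_cast
    rw [zpow_add_one, RelIso.mul_apply, Mesh.le_iff, h.1, h.2]
    simp only [meshRot_k, meshRot_l]
    rcases Nat.eq_zero_or_pos m with rfl | hm
    · have := h₁ (by simp)
      simp only [Nat.cast_zero, zero_mul, add_zero]
      lia
    · have : (1 : ℤ) * ((n : ℤ) - 1) ≤ m * ((n : ℤ) - 1) :=
        mul_le_mul_of_nonneg_right (by lia) (by lia)
      lia

/-- Monotone endomaps of the mesh category preserving zero positions and mesh squares. -/
structure IsMeshMap (g : Mesh n →o Mesh n) : Prop where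
  zero (x : Mesh n) : x.l = 0 ∨ x.l = n + 1 → (g x).l = 0 ∨ (g x).l = n + 1
  square (k l : ℤ) (h : 1 ≤ l ∧ l ≤ n) : ∃ (k' l' : ℤ) (h' : 1 ≤ l' ∧ l' ≤ n),
    g.comp (Mesh.square n k l h) = Mesh.square n k' l' h' ∨
      g.comp (Mesh.square n k l h) = (Mesh.square n k' l' h').comp sqSwap

lemma IsMeshMap.comp {g h : Mesh n →o Mesh n} (hg : IsMeshMap g) (hh : IsMeshMap h) :
    IsMeshMap (g.comp h) where
  zero x hx := hg.zero _ (hh.zero x hx)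
  square k l hkl := by
    obtain ⟨k₁, l₁, h₁, e₁⟩ := hh.square k l hkl
    obtain ⟨k₂, l₂, h₂, e₂⟩ := hg.square k₁ l₁ h₁
    refine ⟨k₂, l₂, h₂, ?_⟩
    have e (sq : Sq →o Mesh n) : (g.comp h).comp sq = g.comp (h.comp sq) := rfl
    have e' (sq : Sq →o Mesh n) : g.comp (sq.comp sqSwap) = (g.comp sq).comp sqSwap := rfl
    have e'' (sq : Sq →o Mesh n) : (sq.comp sqSwap).comp sqSwap = sq := rfl
    rw [e]
    rcases e₁ with e₁ | e₁ <;> rcases e₂ with e₂ | e₂ <;> rw [e₁]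
    · exact Or.inl e₂
    · exact Or.inr e₂
    · rw [e', e₂]
      exact Or.inr rfl
    · rw [e', e₂, e'']
      exact Or.inl rfl

/-- The powers of `meshRot`. -/
def rotMap (n : ℕ) (j : ℤ) : Mesh n →o Mesh n :=
  ⟨fun x ↦ (meshRot n ^ j : Mesh n ≃o Mesh n) x, (meshRot n ^ j : Mesh n ≃o Mesh n).monotone⟩

lemma rotMap_apply (j : ℤ) (x : Mesh n) :
    rotMap n j x = (meshRot n ^ j : Mesh n ≃o Mesh n) x := rfl

/-- The generator and its inverse reflect the strip, so they transpose mesh squares; all powers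
follow by composition. -/
lemma isMeshMap_rotMap (j : ℤ) : IsMeshMap (rotMap n j) := by
  have h₁ : IsMeshMap (rotMap n 1) := by
    refine ⟨fun x hx ↦ ?_, fun k l h ↦ ⟨k + l - 1, n + 1 - l, by lia, Or.inr ?_⟩⟩
    · rw [rotMap_apply, zpow_one, meshRot_l]
      lia
    · refine OrderHom.ext _ _ (funext fun y ↦ Mesh.ext ?_ ?_)
      · simp only [OrderHom.comp_coe, Function.comp_apply, rotMap_apply, zpow_one, meshRot_k,
          square_k, square_l, sqSwap_apply]
        ring
      · simp only [OrderHom.comp_coe, Function.comp_apply, rotMap_apply, zpow_one, meshRot_l,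
          square_k, square_l, sqSwap_apply]
        ring
  have h₂ : IsMeshMap (rotMap n (-1)) := by
    refine ⟨fun x hx ↦ ?_, fun k l h ↦ ⟨k - n + l, n + 1 - l, by lia, Or.inr ?_⟩⟩
    · rw [rotMap_apply, zpow_neg_one, meshRot_inv_l]
      lia
    · refine OrderHom.ext _ _ (funext fun y ↦ Mesh.ext ?_ ?_)
      · simp only [OrderHom.comp_coe, Function.comp_apply, rotMap_apply, zpow_neg_one,
          meshRot_inv_k, square_k, square_l, sqSwap_apply]
        ring
      · simp only [OrderHom.comp_coe, Function.comp_apply, rotMap_apply, zpow_neg_one,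
          meshRot_inv_l, square_k, square_l, sqSwap_apply]
        ring
  have hadd (a b : ℤ) : rotMap n (a + b) = (rotMap n a).comp (rotMap n b) :=
    OrderHom.ext _ _ (funext fun y ↦ by
      simp only [OrderHom.comp_coe, Function.comp_apply, rotMap_apply, zpow_add, RelIso.mul_apply])
  induction j using Int.induction_on with
  | zero =>
    have : rotMap n 0 = OrderHom.id := OrderHom.ext _ _ (funext fun y ↦ by
      rw [rotMap_apply, zpow_zero]
      rfl)
    rw [this]
    exact ⟨fun x hx ↦ hx, fun k l h ↦ ⟨k, l, h, Or.inl rfl⟩⟩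
  | succ i ih => exact hadd _ _ ▸ ih.comp h₁
  | pred i ih => exact hadd _ _ ▸ ih.comp h₂

variable {D : Prederivator.{u, v, w}} {I : Cat.{u, u}} [D.IsDerivator]

lemma SqProp.swap {P : Type} [Preorder P] {sq : Sq →o P} {X : D.Dia I P} (h : SqProp sq X) :
    SqProp (sq.comp sqSwap) X := by
  rw [← sqProp_pull]
  refine LanProp.sqProp_of_least h sqSwap
    ⟨fun y ↦ ⟨y.1.swap, fun e ↦ y.2 (Prod.swap_injective e)⟩, fun _ _ h ↦ ⟨h.2, h.1⟩⟩
    (fun _ ↦ rfl) fun a _ ↦ ⟨⟨a.1.swap, fun e ↦ a.2 (Prod.swap_injective e)⟩, ?_, fun y' h' ↦ ?_⟩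
  · exact le_rfl
  · exact ⟨h'.2, h'.1⟩

variable [D.IsStable]

/-- Transposed squares do no harm, since being cocartesian is symmetric. -/
lemma IsMeshExact.pull {X : D.Dia I (Mesh n)} (hX : IsMeshExact X) {g : Mesh n →o Mesh n}
    (hg : IsMeshMap g) : IsMeshExact ((D.pull I g).obj X) := by
  refine ⟨fun x hx ↦ (isZeroAt_pull _ _ _).2 (hX.1 _ (hg.zero x hx)), fun k l h ↦ ?_⟩
  rw [sqProp_pull]
  obtain ⟨k', l', h', e | e⟩ := hg.square k l h <;> rw [e]
  · exact hX.2 _ _ _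
  · exact (hX.2 _ _ _).swap

/-- The rectangle with corners `(0,q)`, `(0,n)`, `(q,0)` and `(q,n-q)`. -/
def rectangle (n q : ℕ) (hq : q ≤ n) : Sq →o Mesh n where
  toFun y := ⟨if y.2 = 0 then (0 : ℤ) else q, (if y.1 = 0 then (q : ℤ) else n) - if y.2 = 0 then (0 : ℤ) else q,
    by split_ifs <;> lia, by split_ifs <;> lia⟩
  monotone' := by
    intro x y h
    have h₁ : x.1 ≤ y.1 := h.1
    have h₂ : x.2 ≤ y.2 := h.2
    rw [Mesh.le_iff]
    dsimp only
    split_ifs <;> lia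

lemma rectangle_k {q : ℕ} (hq : q ≤ n) (y : Sq) :
    (rectangle n q hq y).k = if y.2 = 0 then 0 else (q : ℤ) := rfl

lemma rectangle_k_add_l {q : ℕ} (hq : q ≤ n) (y : Sq) :
    (rectangle n q hq y).k + (rectangle n q hq y).l = if y.1 = 0 then (q : ℤ) else n :=
  add_sub_cancel _ _

/-- The objects of the mesh category inside of the rectangle. -/
abbrev MeshRect (n q : ℕ) : Type :=
  {x : Mesh n // 0 ≤ x.k ∧ x.k ≤ q ∧ q ≤ x.k + x.l ∧ x.k + x.l ≤ n}

/-- The upper left boundary of the rectangle. -/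
abbrev MeshRectUL (n q : ℕ) : Type := {x : MeshRect n q // x.1.k = 0 ∨ x.1.k + x.1.l = q}

/-- The mesh squares in the rectangle. -/
def rectSquare {q : ℕ} (p : MeshRect n q) (hp : 1 ≤ p.1.k ∧ q + 1 ≤ p.1.k + p.1.l) :
    Sq →o MeshRect n q where
  toFun y := ⟨Mesh.square n (p.1.k - 1) p.1.l (by have := p.2; lia) y, by
    have := p.2
    have h₁ := y.1.2
    have h₂ := y.2.2
    rw [square_k, square_l]
    lia⟩
  monotone' _ _ h' := (Mesh.square n _ _ _).monotone h'

lemma pushoutCorner_rectSquare {q : ℕ} (p : MeshRect n q)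
    (hp : 1 ≤ p.1.k ∧ q + 1 ≤ p.1.k + p.1.l) : PushoutCorner p (rectSquare p hp) := by
  set sq := rectSquare p hp with hsq
  have e : sq = mkSq (sq (0, 0)) (sq (1, 0)) (sq (0, 1)) (sq (1, 1)) (sq.monotone (by decide))
      (sq.monotone (by decide)) (sq.monotone (by decide)) (sq.monotone (by decide)) :=
    OrderHom.sq_ext rfl rfl rfl rfl
  have hk (y : Sq) : (sq y).1.k = p.1.k - 1 + (y.2 : ℕ) := rfl
  have hl (y : Sq) : (sq y).1.l = p.1.l + (y.1 : ℕ) - (y.2 : ℕ) := rfl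
  have e' : sq (1, 1) = p := by
    refine Subtype.ext (Mesh.ext ?_ ?_) <;> simp [hk, hl]
  rw [e]
  conv =>
    enter [1]
    rw [← e']
  refine pushoutCorner_mkSq _ _ _ _ ?_ ?_ ?_
  · intro h
    have := congrArg (fun x ↦ x.1.k) h
    simp [hk] at this
  · intro h
    have := congrArg (fun x ↦ x.1.l) h
    simp [hl] at this
  · intro x hx hx'
    simp only [← Subtype.coe_le_coe, Mesh.le_iff, ne_eq, Subtype.ext_iff, Mesh.ext_iff] at *
    simp only [hk, hl, Fin.isValue, Fin.val_zero, Fin.val_one] at *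
    lia

/-- Pasting of mesh squares: in the rectangle the diagram is extended from the upper left boundary,
and in this boundary the three corners of the span are cofinal. -/
lemma IsMeshExact.sqProp_rectangle {X : D.Dia I (Mesh n)} (hX : IsMeshExact X) {q : ℕ}
    (hq : q ≤ n) : SqProp (rectangle n q hq) X := by
  let ι : MeshRect n q →o Mesh n := OrderHom.Subtype.val _
  have h : LanProp (OrderHom.Subtype.val _ : MeshRectUL n q →o MeshRect n q)
      ((D.pull I ι).obj X) := by
    refine lanProp_of_local (fun _ _ h ↦ h) (fun p ↦ (2 * p.1.k + p.1.l).toNat) fun p hp ↦ ?_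
    have hp' : ¬ (p.1.k = 0 ∨ p.1.k + p.1.l = q) := fun h ↦ hp ⟨p, h⟩ rfl
    have hp₂ := p.2
    have hp'' : 1 ≤ p.1.k ∧ q + 1 ≤ p.1.k + p.1.l := by lia
    refine Or.inr ⟨_, pushoutCorner_rectSquare p hp'', ?_, fun y hy ↦ Or.inr ?_⟩
    · rw [sqProp_pull]
      exact hX.2 _ _ (by lia)
    · have hk : (rectSquare p hp'' y).1.k = p.1.k - 1 + (y.2 : ℕ) := rfl
      have hl : (rectSquare p hp'' y).1.l = p.1.l + (y.1 : ℕ) - (y.2 : ℕ) := rfl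
      rw [hk, hl]
      rcases Sq.cases y with rfl | rfl | rfl | rfl
      case _ => simp only [Fin.isValue, Fin.val_zero, Fin.val_one] at *; lia
      case _ => simp only [Fin.isValue, Fin.val_zero, Fin.val_one] at *; lia
      case _ => simp only [Fin.isValue, Fin.val_zero, Fin.val_one] at *; lia
      exact (hy rfl).elim
  let R : Sq →o MeshRect n q := ⟨fun y ↦ ⟨rectangle n q hq y, by
    rw [rectangle_k_add_l, rectangle_k]
    split_ifs <;> lia⟩, fun _ _ h ↦ (rectangle n q hq).monotone h⟩
  have hk (y : Sq) : (R y).1.k = if y.2 = 0 then 0 else (q : ℤ) := rfl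
  have hkl (y : Sq) : (R y).1.k + (R y).1.l = if y.1 = 0 then (q : ℤ) else n :=
    rectangle_k_add_l hq y
  refine (sqProp_pull ι X R).1 (h.sqProp_of_least R ⟨fun y ↦ ⟨R y.1, ?_⟩, fun _ _ h ↦ R.monotone h⟩
    (fun _ ↦ rfl) fun a _ ↦ ?_)
  · rw [hkl, hk]
    obtain ⟨y, hy⟩ := y
    rcases Sq.cases y with rfl | rfl | rfl | rfl <;> simp at hy ⊢
  · have key (a : MeshRect n q) (y : Sq) : a ≤ R y ↔
        (a.1.k ≤ if y.2 = 0 then 0 else (q : ℤ)) ∧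
          a.1.k + a.1.l ≤ if y.1 = 0 then (q : ℤ) else n := by
      rw [← hk, ← hkl]
      rfl
    have ha := a.2
    have ha' := a.1.2
    by_cases h₁ : a.1.1.k = 0
    · by_cases h₂ : a.1.1.k + a.1.1.l = q
      · refine ⟨⟨(0, 0), by decide⟩, (key _ _).2 ?_, fun _ _ ↦ ⟨Fin.zero_le _, Fin.zero_le _⟩⟩
        simp only [if_true]
        lia
      · refine ⟨⟨(1, 0), by decide⟩, (key _ _).2 ?_, fun y' hy' ↦ ?_⟩
        · simp only [if_true, one_ne_zero, if_false, Fin.isValue]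
          lia
        · have := ((key _ _).1 hy').2
          refine ⟨?_, Fin.zero_le _⟩
          simp only [OrderHom.Subtype.val_coe] at this
          split_ifs at this <;> dsimp only <;> lia
    · refine ⟨⟨(0, 1), by decide⟩, (key _ _).2 ?_, fun y' hy' ↦ ?_⟩
      · simp only [if_true, one_ne_zero, if_false, Fin.isValue]
        lia
      · have := ((key _ _).1 hy').1
        refine ⟨Fin.zero_le _, ?_⟩
        simp only [OrderHom.Subtype.val_coe] at this
        split_ifs at this <;> dsimp only <;> lia

end rot
/-! ### The positions of the stages in the mesh category -/

section
variable {n r l : ℕ}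

/-- The power of `meshRot` used for the position of `x`. -/
def stageExp (x : (ℕ × ℕ) × ℕ) : ℕ := if 2 ≤ x.1.1 ∧ x.1.1 = x.1.2 then x.1.1 + 1 else x.1.1

/-- The first coordinate of the position of `x` in the fundamental domain of `meshRot`. -/
def stageFst (x : (ℕ × ℕ) × ℕ) : ℕ := if x.1.2 = x.1.1 + 1 then x.1.2 + x.2 else 0

/-- The second coordinate of the position of `x` in the fundamental domain of `meshRot`. -/
def stageSnd (x : (ℕ × ℕ) × ℕ) : ℕ :=
  if x.1.2 = x.1.1 + 1 then 0 else if x.1.1 = x.1.2 ∧ x.1.1 ≤ 1 then x.1.1 + x.2 + 1 else 1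

lemma stage_bounds (h : l + r + 2 = n) {x : (ℕ × ℕ) × ℕ} (hx : MemK2 (r + 3) l x) :
    stageFst x + 1 ≤ n ∧ 1 ≤ stageFst x + stageSnd x ∧ stageFst x + stageSnd x ≤ n := by
  obtain ⟨⟨a, b⟩, c⟩ := x
  rw [memK2_iff] at hx
  simp only [stageFst, stageSnd]
  split_ifs <;> omega

/-- These are the comparisons that `meshRot_pow_le` asks for. -/
lemma stage_mono {x y : (ℕ × ℕ) × ℕ} (hx : MemK2 (r + 3) l x) (hy : MemK2 (r + 3) l y)
    (hxy : x ≤ y) : stageExp x ≤ stageExp y ∧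
      (stageExp x = stageExp y → stageFst x ≤ stageFst y ∧
        stageFst x + stageSnd x ≤ stageFst y + stageSnd y) ∧
      (stageExp x + 1 = stageExp y → stageFst x < stageFst y + stageSnd y) := by
  obtain ⟨⟨a, b⟩, c⟩ := x
  obtain ⟨⟨a', b'⟩, c'⟩ := y
  rw [memK2_iff] at hx hy
  have h₁ : a ≤ a' := hxy.1.1
  have h₂ : b ≤ b' := hxy.1.2
  have h₃ : c ≤ c' := hxy.2
  simp only [stageExp, stageFst, stageSnd]
  clear hxy
  split_ifs <;> omega

/-- The representative in the fundamental domain of `meshRot`. -/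
def stageBase (h : l + r + 2 = n) (x : K2 (r + 3) l) : Mesh n where
  k := stageFst x.1
  l := stageSnd x.1
  l_nonneg := by lia
  l_le := by
    have := stage_bounds h x.2
    lia

lemma stageBase_k (h : l + r + 2 = n) (x : K2 (r + 3) l) : (stageBase h x).k = stageFst x.1 := rfl
lemma stageBase_l (h : l + r + 2 = n) (x : K2 (r + 3) l) : (stageBase h x).l = stageSnd x.1 := rfl

/-- The map from `K2` to the mesh category. -/
def stageMap (n r l : ℕ) (h : l + r + 2 = n) : K2 (r + 3) l →o Mesh n where
  -- The shift by `r + 1` gives the last object the exponent `1`, and `meshRot` takes its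
  -- representative `(0,1)` to `(0,n)`.
  toFun x := rotMap n (stageExp x.1 - (r + 1)) (stageBase h x)
  monotone' x y hxy := by
    obtain ⟨h₁, h₂, h₃⟩ := stage_mono x.2 y.2 hxy
    have hx := stage_bounds h x.2
    have hy := stage_bounds h y.2
    refine meshRot_pow_le (by lia) ?_ ?_ (fun h ↦ ?_) (fun h ↦ ?_)
    · rw [stageBase_k, stageBase_l]
      lia
    · rw [stageBase_k, stageBase_l]
      lia
    · rw [Mesh.le_iff, stageBase_k, stageBase_l, stageBase_k, stageBase_l]
      lia
    · rw [stageBase_k, stageBase_k, stageBase_l]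
      lia

lemma stageMap_apply (h : l + r + 2 = n) (x : K2 (r + 3) l) :
    stageMap n r l h x = rotMap n (stageExp x.1 - (r + 1)) (stageBase h x) := rfl

lemma rotMap_add (a b : ℤ) : rotMap n (a + b) = (rotMap n a).comp (rotMap n b) :=
  OrderHom.ext _ _ (funext fun y ↦ by
    simp only [OrderHom.comp_coe, Function.comp_apply, rotMap_apply, zpow_add, RelIso.mul_apply])

lemma rotMap_zero (x : Mesh n) : rotMap n 0 x = x := by
  rw [rotMap_apply, zpow_zero]
  rfl

lemma rotMap_one (x : Mesh n) : rotMap n 1 x = meshRot n x := by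
  rw [rotMap_apply, zpow_one]

/-- The objects over `(0,0)` and `(0,1)` have exponent `0` and representatives `(0,z+1)` and
`(z+1,0)`. Those over `(1,0)` and `(1,1)` have exponent `1`, and `meshRot` moves their
representatives `(0,1)` and `(0,z+2)` to the two remaining corners `(0,n)` and `(z+1,n-z-1)`. -/
lemma stageMap_stageSquare (h : l + r + 2 = n) (z : ℕ) (hz : z < l) :
    (stageMap n r l h).comp (stageSquare (by omega) z hz) =
      (rotMap n (-(r + 1))).comp (rectangle n (z + 1) (by omega)) := by
  have e₀ (x : K2 (r + 3) l) (hx : stageExp x.1 = 0) :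
      stageMap n r l h x = rotMap n (-(r + 1)) (stageBase h x) := by
    rw [stageMap_apply, hx, Nat.cast_zero, zero_sub]
  have e₁ (x : K2 (r + 3) l) (hx : stageExp x.1 = 1) :
      stageMap n r l h x = rotMap n (-(r + 1)) (meshRot n (stageBase h x)) := by
    rw [stageMap_apply, hx, Nat.cast_one, sub_eq_neg_add, rotMap_add, OrderHom.comp_coe,
      Function.comp_apply, rotMap_one]
  have base (y : Sq) (k m : ℕ) (hk : stageFst (stageSquare (N := r + 3) (by omega) z hz y).1 = k)
      (hm : stageSnd (stageSquare (N := r + 3) (by omega) z hz y).1 = m) :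
      (stageBase h (stageSquare (by omega) z hz y)).k = k ∧
        (stageBase h (stageSquare (by omega) z hz y)).l = m :=
    ⟨congrArg _ hk, congrArg _ hm⟩
  have rect (y : Sq) : rectangle n (z + 1) (by omega) y = ⟨if y.2 = 0 then 0 else ((z + 1 : ℕ) : ℤ),
    (if y.1 = 0 then ((z + 1 : ℕ) : ℤ) else n) - if y.2 = 0 then 0 else ((z + 1 : ℕ) : ℤ),
    (rectangle n (z + 1) (by omega) y).3, (rectangle n (z + 1) (by omega) y).4⟩ := rfl
  refine OrderHom.sq_ext ?_ ?_ ?_ ?_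
  · obtain ⟨hk, hl⟩ := base (0, 0) 0 (0 + z + 1) rfl rfl
    refine (e₀ _ rfl).trans (congrArg _ (Mesh.ext ?_ ?_)) <;> rw [rect]
    · simp [hk]
    · simp [hl]
  · obtain ⟨hk, hl⟩ := base (1, 0) 0 1 rfl rfl
    refine (e₁ _ rfl).trans (congrArg _ (Mesh.ext ?_ ?_)) <;> rw [rect]
    · simp [meshRot_k, hk, hl]
    · simp [meshRot_l, hl]
  · obtain ⟨hk, hl⟩ := base (0, 1) (1 + z) 0 rfl rfl
    refine (e₀ _ rfl).trans (congrArg _ (Mesh.ext ?_ ?_)) <;> rw [rect]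
    · simp [hk, add_comm]
    · simp [hl]
  · obtain ⟨hk, hl⟩ := base (1, 1) 0 (1 + z + 1) rfl rfl
    refine (e₁ _ rfl).trans (congrArg _ (Mesh.ext ?_ ?_)) <;> rw [rect]
    · simp [meshRot_k, hk, hl, add_comm]
    · simp [meshRot_l, hl]
      ring

/-- The position of `(1,0,z)` does not depend on `z`. -/
lemma stageMap_k4 (h : l + r + 2 = n) :
    (stageMap n r l h).comp ((k2 (r + 3) l).comp (k3 (r + 3) l)) =
      ((stageMap n r l h).comp (k52 (r + 3) l)).comp (k4 (r + 3) l) := by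
  refine OrderHom.ext _ _ (funext fun x ↦ ?_)
  obtain ⟨⟨⟨a, b⟩, c⟩, hx⟩ := x
  by_cases hab : a = 1 ∧ b = 0
  · obtain ⟨rfl, rfl⟩ := hab
    refine congrArg (rotMap n _) (Mesh.ext rfl rfl)
  · refine congrArg (stageMap n r l h) (Subtype.ext ?_)
    change ((a, b), c) = ((a, b), if (a, b) = (1, 0) then 0 else c)
    rw [if_neg (by simpa using hab)]

lemma stageMap_end (h : l + 0 + 2 = n) : (stageMap n 0 l h).comp (k52 3 l) =
    (iMap n).comp (kEnd n l h) := by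
  refine OrderHom.ext _ _ (funext fun x ↦ ?_)
  obtain ⟨⟨⟨a, b⟩, c⟩, hx⟩ := x
  have hx' := memK5_iff.1 hx
  have e₀ : stageMap n 0 l h (k52 3 l ⟨((a, b), c), hx⟩) = rotMap n (stageExp ((a, b), c) - 1)
    (stageBase (r := 0) h (k52 3 l ⟨((a, b), c), hx⟩)) := by
    rw [stageMap_apply]
    simp
    rfl
  have e₁ : ((kEnd n l h) ⟨((a, b), c), hx⟩).1 = if (a, b) = (1, 0) then 1 else
    if (a, b) = (1, 1) then c + 2 else n := kEnd_coe h _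
  refine e₀.trans ?_
  have : (a = 1 ∧ b ≤ 1) ∨ (a = 2 ∧ b = 1) := by omega
  rcases this with ⟨rfl, hb⟩ | ⟨rfl, rfl⟩
  · rw [show stageExp ((1, b), c) = 1 from rfl, Nat.cast_one, sub_self, rotMap_zero]
    refine Mesh.ext ?_ ?_
    · rw [stageBase_k, k52_coe]
      simp only [stageFst]
      rw [if_neg (by omega)]
      rfl
    · rw [stageBase_l, k52_coe]
      change _ = ((_ : ℕ) : ℤ)
      rw [e₁]
      have : b = 0 ∨ b = 1 := by omega
      rcases this with rfl | rfl <;> simp [stageSnd]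
      ring
  · rw [show stageExp ((2, 1), c) = 2 from rfl, show ((2 : ℕ) : ℤ) - 1 = 1 from rfl, rotMap_one]
    refine Mesh.ext rfl ?_
    rw [meshRot_l, stageBase_l, k52_coe]
    change _ = ((_ : ℕ) : ℤ)
    rw [e₁]
    simp [stageSnd]

/-- Shifting by `(1,1)` raises the exponent by one, which the change of the normalization `r + 1`
between stages compensates. -/
lemma k5_k1_spec (hl : 1 ≤ l) (x : K1 (r + 3) (l + 1)) (hx : ¬ IsZeroPos (r + 3) x.1.1) :
    stageFst (k1 (r + 3) (l + 1) (by omega) x).1 = stageFst (k5 (r + 3) l (by omega) hl x).1 ∧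
      stageSnd (k1 (r + 3) (l + 1) (by omega) x).1 = stageSnd (k5 (r + 3) l (by omega) hl x).1 ∧
      stageExp (k1 (r + 3) (l + 1) (by omega) x).1 + 1 =
        stageExp (k5 (r + 3) l (by omega) hl x).1 := by
  by_cases h₀ : x.1.1 = (0, 0)
  · rw [k1_of_ne _ _ (by simp [h₀]), k5_coe]
    obtain ⟨⟨⟨a, b⟩, c⟩, hx'⟩ := x
    simp only [Prod.mk.injEq] at h₀
    obtain ⟨rfl, rfl⟩ := h₀
    rcases c with - | c
    · exact ⟨rfl, rfl, rfl⟩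
    · refine ⟨rfl, ?_, rfl⟩
      simp [stageSnd]
      ring
  · rw [k5_of_ne _ _ _ h₀]
    by_cases h₁ : x.1.1 = (r + 1, r + 1)
    · rw [k1_of_eq _ _ h₁, h₁]
      rcases r with - | r
      · exact ⟨rfl, rfl, rfl⟩
      · simp [topK, stageFst, stageSnd, stageExp]
    · rw [k1_of_ne _ _ h₁]
      obtain ⟨⟨⟨a, b⟩, c⟩, hx', hc⟩ := x
      rw [memAT_iff] at hx'
      simp only [IsZeroPos, Prod.mk.injEq] at hx hc h₀ h₁
      obtain rfl : a = b + 1 := by omega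
      have : ¬ b = b + 1 + 1 := by omega
      simp [stageFst, stageSnd, stageExp, this]

lemma stageMap_next_of_ne (h : l + (r + 1) + 2 = n) (hl : 1 ≤ l) (x : K1 (r + 3) (l + 1))
    (hx : ¬ IsZeroPos (r + 3) x.1.1) :
    stageMap n r (l + 1) (by omega) (k1 (r + 3) (l + 1) (by omega) x) =
      stageMap n (r + 1) l h (k52 (r + 4) l (k5 (r + 3) l (by omega) hl x)) := by
  obtain ⟨h₁, h₂, h₃⟩ := k5_k1_spec hl x hx
  have e₁ : stageBase (by omega) (k1 (r + 3) (l + 1) (by omega) x) =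
      stageBase h (k52 (r + 4) l (k5 (r + 3) l (by omega) hl x)) :=
    Mesh.ext (congrArg (fun i : ℕ ↦ (i : ℤ)) h₁) (congrArg (fun i : ℕ ↦ (i : ℤ)) h₂)
  rw [stageMap_apply, stageMap_apply, e₁, k52_coe, ← h₃]
  congr 2
  push_cast
  ring

/-- At a zero position of height `0` the truncated height `z - 1` puts the two positions one step
apart, so there is only an inequality. Both positions carry zeros, hence the induced 2-cell is still
invertible on exact diagrams. -/
lemma stageMap_next_le (h : l + (r + 1) + 2 = n) (hl : 1 ≤ l) :
    (stageMap n r (l + 1) (by omega)).comp (k1 (r + 3) (l + 1) (by omega)) ≤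
      ((stageMap n (r + 1) l h).comp (k52 (r + 4) l)).comp (k5 (r + 3) l (by omega) hl) := by
  intro x
  by_cases hx : IsZeroPos (r + 3) x.1.1
  · have h₁ := k1_of_ne (by omega) x (by
      rintro e
      rw [e] at hx
      exact absurd hx.1 (by simp))
    have h₂ := k5_of_ne (by omega) hl x (by
      rintro e
      rw [e] at hx
      exact absurd hx.1 (by simp))
    change stageMap n r (l + 1) _ (k1 (r + 3) (l + 1) _ x) ≤
      stageMap n (r + 1) l h (k52 (r + 4) l (k5 (r + 3) l _ hl x))
    rw [stageMap_apply, stageMap_apply]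
    have e : stageExp (k1 (r + 3) (l + 1) (by omega) x).1 + 1 =
        stageExp (k5 (r + 3) l (by omega) hl x).1 := by
      rw [h₁, h₂]
      have := hx.1
      simp only [stageExp]
      split_ifs <;> omega
    have e' : ((stageExp (k52 (r + 4) l (k5 (r + 3) l (by omega) hl x)).1 : ℤ) - ((r + 1 : ℕ) + 1)) =
        stageExp (k1 (r + 3) (l + 1) (by omega) x).1 - (r + 1) := by
      rw [k52_coe, ← e]
      push_cast
      ring
    rw [e']
    refine (rotMap n _).monotone ?_
    rw [Mesh.le_iff, stageBase_k, stageBase_l, stageBase_k, stageBase_l, k52_coe, h₁, h₂]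
    have := hx.1
    simp only [stageFst, stageSnd]
    split_ifs <;> omega
  · exact (stageMap_next_of_ne h hl x hx).le

lemma stageMap_zero (h : l + r + 2 = n) (x : K2 (r + 3) l) (hx : x.1.1.2 = x.1.1.1 + 1) :
    (stageMap n r l h x).l = 0 ∨ (stageMap n r l h x).l = n + 1 := by
  refine (isMeshMap_rotMap _).zero _ (Or.inl ?_)
  rw [stageBase_l, stageSnd, if_pos hx]
  rfl

lemma stageMap_start (hn : 3 ≤ n) :
    (stageMap n (n - 3) 1 (by omega)).comp (k1 (n - 3 + 3) 1 (by omega)) =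
      (jMap n hn).comp (kStart (n - 3 + 3) n (by omega)) := by
  obtain ⟨r, rfl⟩ : ∃ r, n = r + 3 := ⟨n - 3, by omega⟩
  refine OrderHom.ext _ _ (funext fun x ↦ ?_)
  suffices H : ∀ x : K1 (r + 3) 1, rotMap (r + 3) (stageExp (k1 (r + 3) 1 hn x).1 - (r + 1))
      (stageBase (by omega) (k1 (r + 3) 1 hn x)) = jMap _ hn ⟨x.1.1, x.2.1⟩ from H x
  clear x
  intro x
  generalize hw : k1 (r + 3) 1 hn x = w
  -- Odd powers reflect the strip. This produces the case distinction by parity in `j^n`, between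
  -- the levels `1` and `n` and between `0` and `n + 1`.
  have odd (m : ℤ) (v : Mesh (r + 3)) : (rotMap (r + 3) (2 * m + 1) v).k =
      v.k + v.l - 1 + m * (r + 2) ∧ (rotMap (r + 3) (2 * m + 1) v).l = r + 3 + 1 - v.l := by
    have := meshRot_pow_two_mul m (meshRot (r + 3) v)
    rw [rotMap_apply, zpow_add_one, RelIso.mul_apply, this.1, this.2, meshRot_k, meshRot_l]
    push_cast
    exact ⟨by ring, by ring⟩
  have even (m : ℤ) (v : Mesh (r + 3)) : (rotMap (r + 3) (2 * m) v).k =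
      v.k + m * (r + 2) ∧ (rotMap (r + 3) (2 * m) v).l = v.l := by
    have := meshRot_pow_two_mul m v
    rw [rotMap_apply, this.1, this.2]
    push_cast
    exact ⟨by ring, by ring⟩
  have hj : ((jMap _ hn ⟨x.1.1, x.2.1⟩).k, (jMap _ hn ⟨x.1.1, x.2.1⟩).l) = jPos (r + 3) x.1.1 := rfl
  have hc : x.1.2 < 1 := x.2.2
  have key (j : ℤ) (k l : ℕ) (he : (stageExp w.1 : ℤ) - (r + 1) = j) (hk : stageFst w.1 = k)
      (hl : stageSnd w.1 = l) (h₁ : ∀ m, j = 2 * m + 1 →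
        jPos (r + 3) x.1.1 = (k + l - 1 + m * (r + 2), r + 3 + 1 - (l : ℤ)))
      (h₂ : ∀ m, j = 2 * m → jPos (r + 3) x.1.1 = (k + m * (r + 2), (l : ℤ))) :
      rotMap (r + 3) (stageExp w.1 - (r + 1)) (stageBase (by omega) w) =
        jMap _ hn ⟨x.1.1, x.2.1⟩ := by
    have hv : (stageBase (by omega) w : Mesh (r + 3)).k = k := congrArg (fun i : ℕ ↦ (i : ℤ)) hk
    have hv' : (stageBase (by omega) w : Mesh (r + 3)).l = l := congrArg (fun i : ℕ ↦ (i : ℤ)) hl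
    rw [he]
    rcases Int.even_or_odd' j with ⟨m, rfl | rfl⟩
    · have := even m (stageBase (by omega) w)
      rw [hv, hv'] at this
      rw [h₂ m rfl] at hj
      exact Mesh.ext (this.1.trans (congrArg Prod.fst hj).symm)
        (this.2.trans (congrArg Prod.snd hj).symm)
    · have := odd m (stageBase (by omega) w)
      rw [hv, hv'] at this
      rw [h₁ m rfl] at hj
      exact Mesh.ext (this.1.trans (congrArg Prod.fst hj).symm)
        (this.2.trans (congrArg Prod.snd hj).symm)
  by_cases ht : x.1.1 = (r + 1, r + 1)
  · have hw' : w.1 = (topK (r + 3), x.1.2) := by rw [← hw, k1_of_eq _ _ ht]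
    refine key 1 0 1 ?_ ?_ ?_ (fun m hm ↦ ?_) fun m hm ↦ by omega
    · rw [hw']
      rcases r with - | r
      · rfl
      · simp [topK, stageExp]
    · rw [hw']
      rcases r with - | r
      · rfl
      · simp [topK, stageFst]
    · rw [hw']
      rcases r with - | r
      · rfl
      · simp [topK, stageSnd]
    · obtain rfl : m = 0 := by omega
      rw [ht]
      simp [jPos]
  · have hw' : w.1 = x.1 := by rw [← hw, k1_of_ne _ _ ht]
    clear hw
    obtain ⟨⟨⟨a, b⟩, c⟩, hx, hc'⟩ := x
    rw [memAT_iff] at hx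
    obtain rfl : c = 0 := by dsimp only at hc; omega
    simp only [hw'] at key
    simp only [hw']
    simp only [Prod.mk.injEq] at ht
    have ht' : ¬ (a + 2 = r + 3 ∧ b + 2 = r + 3) := by omega
    by_cases hz : b = a + 1
    · refine key _ b 0 rfl ?_ ?_ (fun m hm ↦ ?_) fun m hm ↦ ?_
      · simp [stageFst, hz]
      · simp [stageSnd, hz]
      · have hab : stageExp ((a, b), 0) = a := by simp [stageExp, hz]
        rw [hab] at hm
        rw [jPos, if_neg ht', if_pos hz, if_pos (by rw [Nat.even_iff]; omega)]
        rw [show (((a, b) : ℕ × ℕ).2 : ℤ) - (r + 3 : ℕ) = 2 * m by push_cast; omega]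
        simp
        ring
      · have hab : stageExp ((a, b), 0) = a := by simp [stageExp, hz]
        rw [hab] at hm
        rw [jPos, if_neg ht', if_pos hz, if_neg (by rw [Nat.even_iff]; omega)]
        rw [show (((a, b) : ℕ × ℕ).2 : ℤ) + 1 - (r + 3 : ℕ) = 2 * m by push_cast; omega]
        simp
        ring
    · have hab : stageExp ((a, b), 0) = a := by
        simp only [stageExp]
        split_ifs <;> omega
      refine key _ 0 1 rfl ?_ ?_ (fun m hm ↦ ?_) fun m hm ↦ ?_
      · simp [stageFst, hz]
      · simp only [stageSnd]
        split_ifs <;> omega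
      · rw [hab] at hm
        rw [jPos, if_neg ht', if_neg hz, if_neg (by rw [Nat.even_iff]; omega)]
        rw [show (((a, b) : ℕ × ℕ).1 : ℤ) + 1 - (r + 3 : ℕ) = 2 * m by push_cast; omega]
        simp
        exact Or.inl (by ring)
      · rw [hab] at hm
        rw [jPos, if_neg ht', if_neg hz, if_pos (by rw [Nat.even_iff]; omega)]
        rw [show (((a, b) : ℕ × ℕ).1 : ℤ) + 2 - (r + 3 : ℕ) = 2 * m by push_cast; omega]
        simp
        exact Or.inl (by ring)

variable {D : Prederivator.{u, v, w}} {I : Cat.{u, u}} [D.IsDerivator]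

/-- Invertibility is tested at points: where `f` and `g` agree the cell is invertible, and where
both values are zero every map is. -/
lemma isIso_pullCell_app {P Q : Type} [Preorder P] [PartialOrder Q] {f g : P →o Q} (h : f ≤ g)
    (X : D.Dia I Q) (hX : ∀ x, f x = g x ∨ (IsZeroAt X (f x) ∧ IsZeroAt X (g x))) :
    IsIso ((D.pullCell I h).app X) := by
  refine isIso_of_pull_ptMap _ fun x ↦ ?_
  rcases hX x with hx | ⟨h₁, h₂⟩
  · have h' : f.comp (ptMap x) ≤ g.comp (ptMap x) := fun y ↦ h (ptMap x y)
    have e : (D.pull I (ptMap x)).map ((D.pullCell I h).app X) =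
        (D.pullComp I (ptMap x) f).inv.app X ≫ (D.pullCell I h').app X ≫
            (D.pullComp I (ptMap x) g).hom.app X := by
      have e₁ : (timesId.{u} I (ptMap x) ◁ timesCell I h :
          timesId I (f.comp (ptMap x)) ⟶ timesId I (g.comp (ptMap x))) = timesCell I h' := by
        ext y
        exact Prod.hom_ext (Subsingleton.elim _ _) rfl
      refine (D.res_map_resMap _ _ _).trans ?_
      exact congrArg (fun z ↦ _ ≫ (D.resMap z).app X ≫ _) e₁
    have e₂ : f.comp (ptMap x) = g.comp (ptMap x) := OrderHom.ext _ _ (funext fun _ ↦ hx)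
    have : IsIso ((D.pullCell I h').app X) := ((D.pullEq I e₂).app X).isIso_hom
    rw [e]
    infer_instance
  · exact IsZeroAt.isIso ((isZeroAt_pull _ _ _).2 h₁) ((isZeroAt_pull _ _ _).2 h₂) _

variable [D.IsStable] {X : D.Dia I (Mesh n)} (hX : IsMeshExact X)
include hX

/-- The squares of the stage go to rotated rectangles; rotation preserves exactness and rectangles
are cocartesian. -/
lemma IsMeshExact.lanProp_k1 (h : l + r + 2 = n) :
    LanProp (k1 (r + 3) l (by omega)) ((D.pull I (stageMap n r l h)).obj X) := by
  refine lanProp_of_squares (fun _ _ h ↦ k1_le _ h) fun p hp ↦ Or.inr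
    ⟨stageSquare (by omega) p.1.2 p.2.2, Subtype.ext (Prod.ext (k1_ne _ p hp).symm rfl),
      isPushoutSquare_stageSquare _ _ _, ?_⟩
  rw [sqProp_pull, stageMap_stageSquare, ← sqProp_pull]
  exact (hX.pull (isMeshMap_rotMap _)).sqProp_rectangle _

lemma IsMeshExact.isIso_pullCell_stageMap (h : l + (r + 1) + 2 = n) (hl : 1 ≤ l) :
    IsIso ((D.pullCell I (stageMap_next_le h hl)).app X) := by
  refine isIso_pullCell_app _ _ fun x ↦ ?_
  by_cases hx : IsZeroPos (r + 3) x.1.1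
  · have hx' : x.1.1.2 = x.1.1.1 + 1 := hx.1
    have h₁ := k1_of_ne (by omega) x (by
      rintro e
      rw [e] at hx'
      exact absurd hx' (by simp))
    have h₂ := k5_of_ne (by omega) hl x (by
      rintro e
      rw [e] at hx'
      exact absurd hx' (by simp))
    refine Or.inr ⟨hX.1 _ (stageMap_zero _ _ ?_), hX.1 _ (stageMap_zero (r := r + 1) h _ ?_)⟩
    · rw [h₁, hx']
    · rw [k52_coe, h₂, hx']
  · exact Or.inl (stageMap_next_of_ne h hl x hx)

end
end Prederivator

/-! ### Isomorphisms between composite morphisms of prederivators -/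

section
variable {C : Type*} [Category C] {X Y Z : C}

lemma Nonempty.iso_trans (e : Nonempty (X ≅ Y)) (e' : Nonempty (Y ≅ Z)) : Nonempty (X ≅ Z) :=
  e.elim fun e ↦ e'.map fun e' ↦ e ≪≫ e'

lemma Nonempty.iso_symm (e : Nonempty (X ≅ Y)) : Nonempty (Y ≅ X) := e.map fun e ↦ e.symm

end

namespace Prederivator

section isomorphic
variable {B : Type*} [Bicategory B] {a b c d : B}

lemma isIsomorphic_comp_left (f : a ⟶ b) {g g' : b ⟶ c} (h : IsIsomorphic g g') :
    IsIsomorphic (f ≫ g) (f ≫ g') := h.map fun e ↦ whiskerLeftIso f e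

lemma isIsomorphic_comp_right {f f' : a ⟶ b} (g : b ⟶ c) (h : IsIsomorphic f f') :
    IsIsomorphic (f ≫ g) (f' ≫ g) := h.map fun e ↦ whiskerRightIso e g

lemma isIsomorphic_assoc (f : a ⟶ b) (g : b ⟶ c) (h : c ⟶ d) :
    IsIsomorphic ((f ≫ g) ≫ h) (f ≫ g ≫ h) := ⟨α_ f g h⟩

lemma isIsomorphic_comp_id (f : a ⟶ b) : IsIsomorphic (f ≫ 𝟙 b) f := ⟨ρ_ f⟩

end isomorphic

section lift
variable {F G : Prederivator.{u, v, w}} (η : F ⟶ G) (P : G.ObjectProperty)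
  [P.IsClosedUnderMapObj] (h : ∀ I X, P.prop I ((η.app I).toFunctor.obj X))

lemma isIsomorphic_lift_ι : IsIsomorphic (lift η P h ≫ P.ι) η := by
  refine isIso_modMk (modMk (fun I X ↦ 𝟙 ((η.app I).toFunctor.obj X)) (fun {I X Y} g ↦ ?_)
    fun {I J} f X ↦ ?_) fun I X ↦ ?_
  · exact (Category.comp_id _).trans (Category.id_comp _).symm
  · rw [natCell_comp_hom]
    refine (Category.id_comp _).trans ?_
    refine Eq.trans ?_ (congrArg (fun z ↦ _ ≫ z) ((G.map f).toFunctor.map_id _).symm)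
    exact ((Category.comp_id _).trans (Category.comp_id _)).symm
  · exact inferInstanceAs (IsIso (𝟙 ((η.app I).toFunctor.obj X)))

end lift

section
variable (D : Prederivator.{u, v, w})

lemma isIsomorphic_restr_comp {P Q R : Type} [Preorder P] [Preorder Q] [Preorder R]
    (f : P →o Q) (g : Q →o R) : IsIsomorphic (D.restr (shapeMap (g.comp f)))
      (D.restr (shapeMap g) ≫ D.restr (shapeMap f)) :=
  isIso_modMk (D.restrComp f g) fun I X ↦ ((D.pullComp I.unop f g).app X).isIso_hom

variable [D.IsDerivator] {E : Prederivator.{u, v, w}} {P Q : Type} [Preorder P] [Preorder Q]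

lemma isIsomorphic_restr_of_le (T : E ⟶ D.shift (shape.{u} Q)) {f g : P →o Q} (h : f ≤ g)
    (hT : ∀ (I : (Cat.{u, u})ᵒᵖ) (X : E.obj I),
      IsIso ((D.pullCell I.unop h).app ((T.app I).toFunctor.obj X))) :
    IsIsomorphic (T ≫ D.restr (shapeMap f)) (T ≫ D.restr (shapeMap g)) :=
  isIso_modMk (T ◁ D.restrCell h) hT

lemma isIsomorphic_restr_lan (T : E ⟶ D.shift (shape.{u} Q)) (k : P →o Q)
    (h : ∀ (I : (Cat.{u, u})ᵒᵖ) (X : E.obj I),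
      IsIso ((D.lanPullAdj k I).counit.app ((T.app I).toFunctor.obj X))) :
    IsIsomorphic (T ≫ D.restr (shapeMap k) ≫ D.lan (shapeMap k)) T :=
  Nonempty.iso_trans (isIso_modMk (T ◁
    (Bicategory.Adjunction.ofIsRightAdjoint (D.restr (shapeMap k))).counit) h)
    (isIsomorphic_comp_id T)

end

lemma isIso_counit_of_bijective {C₁ C₂ : Type*} [Category C₁] [Category C₂] {L : C₁ ⥤ C₂}
    {R : C₂ ⥤ C₁} (adj : L ⊣ R) {X : C₂}
    (h : ∀ Y, Function.Bijective fun φ : X ⟶ Y ↦ R.map φ) : IsIso (adj.counit.app X) := by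
  have h' (Y : C₂) : Function.Bijective fun φ : X ⟶ Y ↦ adj.counit.app X ≫ φ := by
    have e : (fun φ : X ⟶ Y ↦ adj.counit.app X ≫ φ) =
        (adj.homEquiv (R.obj X) Y).symm ∘ fun φ : X ⟶ Y ↦ R.map φ := by
      funext φ
      simp [Adjunction.homEquiv_counit]
    rw [e]
    exact (Equiv.bijective _).comp (h Y)
  obtain ⟨g, hg⟩ := (h' _).2 (𝟙 _)
  dsimp only at hg
  refine ⟨g, hg, (h' _).1 ?_⟩
  dsimp only
  rw [← Category.assoc, hg, Category.id_comp]
  exact (Category.comp_id _).symm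

/-! ### Commutativity of the triangle -/

section triangle
variable (D : Prederivator.{u, v, w}) [D.IsDerivator] [D.IsStable] {n : ℕ}

/-- The restriction morphisms from `𝒟^{M_n,ex}`. -/
def exRes {P : Type} [Preorder P] (f : P →o Mesh n) : D.DMex n ⟶ D.shift (shape.{u} P) :=
  (D.meshEx n).ι ≫ D.restr (shapeMap f)

variable {D}

lemma exRes_comp {P Q : Type} [Preorder P] [Preorder Q] (f : P →o Q) (g : Q →o Mesh n) :
    IsIsomorphic (D.exRes (g.comp f)) (D.exRes g ≫ D.restr (shapeMap f)) :=
  (isIsomorphic_comp_left _ (D.isIsomorphic_restr_comp f g)).iso_trans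
    (isIsomorphic_assoc _ _ _).iso_symm

lemma exRes_of_eq {P : Type} [Preorder P] {f g : P →o Mesh n} (h : f = g) :
    IsIsomorphic (D.exRes f) (D.exRes g) := h ▸ ⟨Iso.refl _⟩

/-- On diagrams extended along `k` the counit is invertible, so extension undoes restriction. -/
lemma exRes_comp_lan {P Q : Type} [Preorder P] [Preorder Q] (k : P →o Q) (g : Q →o Mesh n)
    (h : ∀ (I : Cat.{u, u}) (X : D.Dia I (Mesh n)), IsMeshExact X →
      LanProp k ((D.pull I g).obj X)) :
    IsIsomorphic (D.exRes (g.comp k) ≫ D.lan (shapeMap k)) (D.exRes g) := by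
  refine ((isIsomorphic_comp_right _ (exRes_comp k g)).iso_trans (isIsomorphic_assoc _ _ _)).iso_trans
    (D.isIsomorphic_restr_lan _ _ fun I X ↦ isIso_counit_of_bijective _ ?_)
  exact (h I.unop X.1 ((meshEx_iff I X.1).1 X.2)).bijective

lemma LanProp.of_bijOn {I : Cat.{u, u}} {P Q : Type} [Preorder P] [Preorder Q] {k : P →o Q}
    {X : D.Dia I Q} (h : ∀ Y, BijOn k X Y) : LanProp k X := fun Y ↦ by
  simpa [BijOn] using h Y

/-- Each step replaces a restriction of the exact diagram by another one. The extension along `k1`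
is handled by `IsMeshExact.lanProp_k1`, and the one along `k4` by `stageMap_k4` together with full
faithfulness of `k4^*`. -/
lemma exRes_stage {r l : ℕ} (h : l + r + 2 = n) :
    IsIsomorphic (D.exRes ((stageMap n r l h).comp (k1 (r + 3) l (by omega))) ≫
      D.stage (r + 3) l (by omega)) (D.exRes ((stageMap n r l h).comp (k52 (r + 3) l))) := by
  have e₁ := exRes_comp_lan (D := D) (k1 (r + 3) l (by omega)) (stageMap n r l h)
    fun I X hX ↦ hX.lanProp_k1 h
  have e₂ := exRes_comp (D := D) (k2 (r + 3) l) (stageMap n r l h)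
  have e₃ := exRes_comp (D := D) (k3 (r + 3) l) ((stageMap n r l h).comp (k2 (r + 3) l))
  have e₄ := exRes_of_eq (D := D) (stageMap_k4 h)
  have e₅ := exRes_comp_lan (D := D) (k4 (r + 3) l) ((stageMap n r l h).comp (k52 (r + 3) l))
    fun I X hX ↦ .of_bijOn (bijOn_of_coreflection k4_s4 s4_le_iff _)
  refine (isIsomorphic_assoc _ _ _).iso_symm.iso_trans ?_
  refine (isIsomorphic_comp_right _ e₁).iso_trans ?_
  refine (isIsomorphic_assoc _ _ _).iso_symm.iso_trans ?_
  refine (isIsomorphic_comp_right _ e₂.iso_symm).iso_trans ?_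
  refine (isIsomorphic_assoc _ _ _).iso_symm.iso_trans ?_
  refine (isIsomorphic_comp_right _ e₃.iso_symm).iso_trans ?_
  exact (isIsomorphic_comp_right _ e₄).iso_trans e₅

lemma exRes_of_le {P : Type} [Preorder P] {f g : P →o Mesh n} (h : f ≤ g)
    (hX : ∀ (I : Cat.{u, u}) (X : D.Dia I (Mesh n)), IsMeshExact X →
      IsIso ((D.pullCell I h).app X)) : IsIsomorphic (D.exRes f) (D.exRes g) :=
  D.isIsomorphic_restr_of_le _ h fun I X ↦ hX I.unop X.1 ((meshEx_iff I X.1).1 X.2)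

lemma exRes_next {r l : ℕ} (h : l + (r + 1) + 2 = n) (hl : 1 ≤ l) :
    IsIsomorphic
      (D.exRes ((stageMap n r (l + 1) (by omega)).comp (k1 (r + 3) (l + 1) (by omega))))
      (D.exRes (((stageMap n (r + 1) l h).comp (k52 (r + 4) l)).comp
        (k5 (r + 3) l (by omega) hl))) :=
  exRes_of_le (stageMap_next_le h hl) fun _ _ hX ↦ hX.isIso_pullCell_stageMap h hl

lemma exRes_fromStage (r : ℕ) : ∀ (l : ℕ) (hl : 1 ≤ l) (h : l + r + 2 = n),
    IsIsomorphic (D.exRes ((stageMap n r l h).comp (k1 (r + 3) l (by omega))) ≫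
      D.fromStage n r l hl h) (D.iRes n) := by
  induction r with
  | zero =>
    intro l hl h
    have e := exRes_comp_lan (D := D) (kEnd n l h) (iMap n)
      fun I X hX ↦ .of_bijOn (bijOn_of_reflection (kEnd_sEnd h hl) (kEnd_le_iff h hl) _)
    refine (isIsomorphic_assoc _ _ _).iso_symm.iso_trans ?_
    refine (isIsomorphic_comp_right _ (exRes_stage (r := 0) h)).iso_trans ?_
    exact (isIsomorphic_comp_right _ (exRes_of_eq (stageMap_end h))).iso_trans e
  | succ r ih =>
    intro l hl h
    refine (isIsomorphic_assoc _ _ _).iso_symm.iso_trans ?_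
    refine (isIsomorphic_comp_right _ (exRes_stage h)).iso_trans ?_
    refine (isIsomorphic_assoc _ _ _).iso_symm.iso_trans ?_
    refine (isIsomorphic_comp_right _ (exRes_comp _ _).iso_symm).iso_trans ?_
    refine (isIsomorphic_comp_right _ (exRes_next h hl).iso_symm).iso_trans ?_
    exact ih (l + 1) (by omega) (by omega)

theorem jRes_mainMorphism (hn : 3 ≤ n) :
    IsIsomorphic (D.jRes n hn ≫ D.mainMorphism n hn) (D.iRes n) := by
  have e : IsIsomorphic (D.jRes n hn ≫ (D.anTwo n).ι) (D.exRes (jMap n hn)) :=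
    isIsomorphic_lift_ι _ _ _
  refine (isIsomorphic_assoc _ _ _).iso_symm.iso_trans ?_
  refine (isIsomorphic_comp_right _ e).iso_trans ?_
  refine (isIsomorphic_assoc _ _ _).iso_symm.iso_trans ?_
  refine (isIsomorphic_comp_right _ (exRes_comp _ _).iso_symm).iso_trans ?_
  refine (isIsomorphic_comp_right _ (exRes_of_eq (stageMap_start hn).symm)).iso_trans ?_
  exact exRes_fromStage _ _ _ _

lemma iso_app_of_isIsomorphic {F G : Prederivator.{u, v, w}} {η θ : F ⟶ G}
    (h : IsIsomorphic η θ) (I : (Cat.{u, u})ᵒᵖ) :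
    Nonempty ((η.app I).toFunctor ≅ (θ.app I).toFunctor) := by
  obtain ⟨e⟩ := h
  exact ⟨⟨(e.hom.as.app I).toNatTrans, (e.inv.as.app I).toNatTrans,
    congrArg (fun z ↦ (z.as.app I).toNatTrans) e.hom_inv_id,
    congrArg (fun z ↦ (z.as.app I).toNatTrans) e.inv_hom_id⟩⟩

end triangle
end Prederivator

open Prederivator in
theorem theorem6p3 (D : Prederivator.{u, v, w}) [D.IsDerivator] [D.IsStable] (n : ℕ) (hn : 3 ≤ n) :
    ∃ _ : D.HasLan,
      Prederivator.IsEquiv (D.mainMorphism n hn) ∧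
      Prederivator.IsEquiv (D.iRes n) ∧
      Prederivator.IsEquiv (D.jRes n hn) ∧
      Nonempty (D.jRes n hn ≫ D.mainMorphism n hn ≅ D.iRes n) := by
  refine ⟨hasLan D, ?_⟩
  have e := jRes_mainMorphism (D := D) hn
  have hi (I : (Cat.{u, u})ᵒᵖ) := iRes_isEquivalence (D := D) (n := n) I
  have hc (I : (Cat.{u, u})ᵒᵖ) : (((D.jRes n hn).app I).toFunctor ⋙
      ((D.mainMorphism n hn).app I).toFunctor).IsEquivalence := by
    obtain ⟨e'⟩ := iso_app_of_isIsomorphic e I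
    have := hi I
    exact Functor.isEquivalence_of_iso e'.symm
  -- Essential surjectivity is inherited from the composite with `(j^n)^*`; fullness and
  -- faithfulness come from the stages.
  have hm (I : (Cat.{u, u})ᵒᵖ) : ((D.mainMorphism n hn).app I).toFunctor.IsEquivalence := by
    have := hc I
    have h₁ : ((D.mainMorphism n hn).app I).toFunctor.Faithful :=
      ⟨fun h ↦ (bijective_mainMorphism n hn _ _).1 h⟩
    have h₂ : ((D.mainMorphism n hn).app I).toFunctor.Full :=
      ⟨fun f ↦ (bijective_mainMorphism n hn _ _).2 f⟩
    refine ⟨h₁, h₂, ⟨fun Z ↦ ?_⟩⟩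
    exact ⟨_, ⟨(((D.jRes n hn).app I).toFunctor ⋙
      ((D.mainMorphism n hn).app I).toFunctor).objObjPreimageIso Z⟩⟩
  have hj (I : (Cat.{u, u})ᵒᵖ) : ((D.jRes n hn).app I).toFunctor.IsEquivalence := by
    have := hc I
    have := hm I
    exact Functor.isEquivalence_of_comp_right _ ((D.mainMorphism n hn).app I).toFunctor
  exact ⟨isEquiv_of_objectwise _ hm, isEquiv_of_objectwise _ hi, isEquiv_of_objectwise _ hj, e⟩
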